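/- Let $N\ge 1$ be an integer and let $\alpha\ge 0$. On the Hilbert space $L^2((0,\infty))^N$ of the star graph with $N$ infinite edges, let $H=-\frac{d^2}{dx^2}$ be the operator whose domain consists of all $u=(u_1,\dots,u_N)$ with $u_j\in H^2(0,\infty)$ that satisfy the vertex conditions $u_1(0)=\dots=u_N(0)=:u(0)$ and $\sum_{j=1}^N u_j'(0)=\alpha u(0)$. For $\omega>0$, $x,y\ge0$ and $1\le j,l\le N$ put $$\sigma_j^{\,l}(\omega,x,y)=\frac2\pi\,\delta_j^l\sin(\omega x)\sin(\omega y)+\frac{2/\pi}{\alpha^2+N^2\omega^2}\bigl\{N\omega^2\cos[\omega(x+y)]+\alpha\omega\sin[\omega(x+y)]\bigr\}.$$ Then $\sigma$ is the spectral density kernel of $H$, in the following three senses. (1) *Spectral projections.* $H$ has a spectral resolution $H=\int\lambda\,dE(\lambda)$ with a projection-valued measure $E$ on $\mathbb R$. For every such $E$ and every $\lambda\ge0$, the projection $P(\lambda)=E([0,\lambda])$ has the integral kernel $P_j^{\,l}(\lambda,x,y)=\int_0^{\sqrt\lambda}\sigma_j^{\,l}(\omega,x,y)\,d\omega$: for all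 $f\in L^2((0,\infty))^N$, all $j$ and almost all $x>0$, $(P(\lambda)f)_j(x)=\sum_{l=1}^N\int_0^\infty P_j^{\,l}(\lambda,x,y)f_l(y)\,dy$, with absolutely convergent integrals. (2) *Cosine transform of the wave kernel.* There is a wave kernel $G_j^{\,l}(t,x,y)$, for each $j,l$ and each $x,y\ge0$ a finite signed measure in $t\in[0,\infty)$, such that for all initial data $f\in C_c^\infty((0,\infty))^N$ a classical solution $u$ ($C^2$ for $t,x\ge 0$) of $u_{tt}=u_{xx}$, $u(0,x)=f(x)$, $u_t(0,x)=0$ with the above vertex conditions at all times $t\ge0$ is given by $u_j(t,x)=\sum_l\int_0^\infty G_j^{\,l}(t,x,y)f_l(y)\,dy$, in the sense of integration against continuous compactly supported functions of $t\in[0,\infty)$; and for all $j,l$ and $x,y\ge0$, $$G_j^{\,l}(t,x,y)=\int_0^\infty\cos(\omega t)\,\sigma_j^{\,l}(\omega,x,y)\,d\omega$$ when tested over $t\in[0,\infty)$ against even Schwartz functions of $t$, and $$\sigma_j^{\,l}(\omega,x,y)=\frac2\pi\int_{[0,\infty)}\cos(\omega t)\,G_j^{\,l}(t,x,y)\,dt\qquad(\omega>0).$$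 (3) *Scattering eigenfunctions (Kottos–Smilansky).* For $\omega>0$ let $$\psi_j^{\,l}(x)=\delta_j^le^{-i\omega x}+\Bigl[-\delta_j^l+\frac1N\bigl(1+e^{-2i\tan^{-1}\frac{\alpha}{N\omega}}\bigr)\Bigr]e^{i\omega x}.$$ For every $l$ the function $\psi^{\,l}=(\psi_1^{\,l},\dots,\psi_N^{\,l})$ satisfies $-\psi''=\omega^2\psi$ and the vertex conditions. One has $$\psi_j^{\,l}(x)=-2i\,\delta_j^l\sin(\omega x)+2\omega\,\frac{N\omega-i\alpha}{\alpha^2+N^2\omega^2}\,e^{i\omega x},$$ and for all $j,j'$ and $x,y\ge0$ $$\frac1{2\pi}\sum_{l=1}^N\psi_j^{\,l}(x)\,\overline{\psi_{j'}^{\,l}(y)}=\sigma_j^{\,j'}(\omega,x,y).$$ -/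

import Mathlib

open MeasureTheory Set
open scoped ENNReal InnerProductSpace

namespace StarGraph

/-! ### Spectral resolutions of unbounded operators -/

/-- A projection-valued measure on the Borel sets of `ℝ`, acting on the Hilbert space `𝓗`.
Only the values on measurable sets are meaningful. -/
structure ProjValuedMeasure (𝓗 : Type*) [NormedAddCommGroup 𝓗] [InnerProductSpace ℂ 𝓗]
    [CompleteSpace 𝓗] where
  /-- the projection attached to a set -/
  proj : Set ℝ → 𝓗 →L[ℂ] 𝓗
  isStarProjection : ∀ s, MeasurableSet s → IsStarProjection (proj s)
  proj_univ : proj univ = 1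
  hasSum_iUnion : ∀ s : ℕ → Set ℝ, (∀ n, MeasurableSet (s n)) →
    Pairwise (Function.onFun Disjoint s) →
    ∀ u : 𝓗, HasSum (fun n => proj (s n) u) (proj (⋃ n, s n) u)

section

variable {𝓗 : Type*} [NormedAddCommGroup 𝓗] [InnerProductSpace ℂ 𝓗] [CompleteSpace 𝓗]

theorem ProjValuedMeasure.proj_empty (E : ProjValuedMeasure 𝓗) : E.proj ∅ = 0 := by
  ext u
  have h := E.hasSum_iUnion (fun _ => ∅) (fun _ => MeasurableSet.empty)
    (fun i j _ => by simp [Function.onFun]) u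
  have h2 := h.summable.tendsto_atTop_zero
  simpa using tendsto_nhds_unique (tendsto_const_nhds) h2

theorem ProjValuedMeasure.re_inner_nonneg (E : ProjValuedMeasure 𝓗) {s : Set ℝ}
    (hs : MeasurableSet s) (u : 𝓗) : 0 ≤ (⟪u, E.proj s u⟫_ℂ).re := by
  have h := E.isStarProjection s hs
  have h1 : E.proj s u = E.proj s (E.proj s u) := by
    conv_lhs => rw [← h.isIdempotentElem.eq]
    rfl
  have h2 : ContinuousLinearMap.adjoint (E.proj s) = E.proj s := h.isSelfAdjoint
  rw [h1, ← ContinuousLinearMap.adjoint_inner_left, h2]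
  exact inner_self_nonneg (𝕜 := ℂ)

/-- The scalar spectral measure `s ↦ ⟨u, E(s) u⟩ = ‖E(s) u‖²` of a vector `u`. -/
noncomputable def ProjValuedMeasure.scalarMeasure (E : ProjValuedMeasure 𝓗) (u : 𝓗) :
    Measure ℝ :=
  Measure.ofMeasurable (fun s _ => ENNReal.ofReal (⟪u, E.proj s u⟫_ℂ).re)
    (by simp [E.proj_empty])
    (by
      intro s hs hd
      have h := E.hasSum_iUnion s hs hd u
      have h1 : HasSum (fun n => (⟪u, E.proj (s n) u⟫_ℂ).re)
          (⟪u, E.proj (⋃ n, s n) u⟫_ℂ).re :=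
        Complex.hasSum_re (h.mapL (innerSL ℂ u))
      rw [← h1.tsum_eq]
      exact ENNReal.ofReal_tsum_of_nonneg (fun n => E.re_inner_nonneg (hs n) u) h1.summable)

/-- `E` is the spectral resolution of the operator `A`, i.e. `A = ∫ λ dE(λ)`: the domain of `A`
consists of the vectors `u` with `∫ λ² d⟨u, E(λ) u⟩ < ∞`, and on it
`⟨u, A u⟩ = ∫ λ d⟨u, E(λ) u⟩`. -/
def IsSpectralResolution (A : 𝓗 →ₗ.[ℂ] 𝓗) (E : ProjValuedMeasure 𝓗) : Prop :=
  (∀ u : 𝓗, u ∈ A.domain ↔ ∫⁻ l : ℝ, ENNReal.ofReal (l ^ 2) ∂(E.scalarMeasure u) < ∞) ∧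
  ∀ u : A.domain, ⟪(u : 𝓗), A u⟫_ℂ = ((∫ l : ℝ, l ∂(E.scalarMeasure (u : 𝓗)) : ℝ) : ℂ)

end

/-! ### The Hilbert space and the Hamiltonian of the star graph -/

/-- `L²((0,∞))^N`, one copy of `L²` for each edge. -/
abbrev L2Star (N : ℕ) : Type :=
  PiLp 2 (fun _ : Fin N => Lp ℂ 2 (volume.restrict (Ioi (0 : ℝ))))

/-- `(f, f')` represents `u ∈ L²((0,∞))^N` as an element of `H²((0,∞))^N` with `-u'' = w`:
on every edge `f` is the continuously differentiable representative of `u`, `f'` is its derivative,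
also in `L²`, and `f'` is absolutely continuous with derivative `-w`. -/
structure IsH2Representative {N : ℕ} (u w : L2Star N) (f f' : Fin N → ℝ → ℂ) : Prop where
  ae_eq : ∀ j, u j =ᵐ[volume.restrict (Ioi (0 : ℝ))] f j
  memLp : ∀ j, MemLp (f' j) 2 (volume.restrict (Ioi (0 : ℝ)))
  eq_integral : ∀ j, ∀ x : ℝ, 0 ≤ x → f j x = f j 0 + ∫ t in (0 : ℝ)..x, f' j t
  deriv_eq_integral : ∀ j, ∀ x : ℝ, 0 ≤ x → f' j x = f' j 0 - ∫ t in (0 : ℝ)..x, w j t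

/-- The vertex conditions on boundary values `b j = u_j(0)` and derivatives `b' j = u_j'(0)`:
continuity, `u_j(0) = u(0)` for all `j`, and `∑ j, u_j'(0) = α u(0)`. -/
def VertexCondition {N : ℕ} (α : ℝ) (b b' : Fin N → ℂ) : Prop :=
  (∀ j k, b j = b k) ∧ ∀ k, ∑ j, b' j = α * b k

theorem intervalIntegrable_of_L2 {g : ℝ → ℂ} (hg : MemLp g 2 (volume.restrict (Ioi (0 : ℝ))))
    {x : ℝ} (hx : 0 ≤ x) : IntervalIntegrable g volume 0 x := by
  rw [intervalIntegrable_iff_integrableOn_Ioc_of_le hx]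
  have h : MemLp g 2 (volume.restrict (Ioc 0 x)) :=
    hg.mono_measure (Measure.restrict_mono Ioc_subset_Ioi_self le_rfl)
  exact h.integrable (by norm_num)

theorem integral_congr_L2 {g h : ℝ → ℂ} (hgh : g =ᵐ[volume.restrict (Ioi (0 : ℝ))] h)
    {x : ℝ} (hx : 0 ≤ x) : ∫ t in (0 : ℝ)..x, g t = ∫ t in (0 : ℝ)..x, h t := by
  rw [intervalIntegral.integral_of_le hx, intervalIntegral.integral_of_le hx]
  exact integral_congr_ae
    (hgh.filter_mono (ae_mono (Measure.restrict_mono Ioc_subset_Ioi_self le_rfl)))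

/-- The graph `{(u, H u)}` of the Hamiltonian `H = -d²/dx²` on functions in `H²` on every edge
that satisfy the vertex conditions. -/
def hamiltonianGraph (N : ℕ) (α : ℝ) : Submodule ℂ (L2Star N × L2Star N) where
  carrier := {p | ∃ f f' : Fin N → ℝ → ℂ, IsH2Representative p.1 p.2 f f' ∧
    VertexCondition α (fun j => f j 0) (fun j => f' j 0)}
  zero_mem' := by
    have h0 : ((0 : Lp ℂ 2 (volume.restrict (Ioi (0 : ℝ)))) : ℝ → ℂ)
        =ᵐ[volume.restrict (Ioi (0 : ℝ))] 0 := Lp.coeFn_zero _ _ _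
    refine ⟨fun _ _ => 0, fun _ _ => 0, ⟨fun j => h0, fun j => ?_, fun j x hx => by simp,
      fun j x hx => ?_⟩, by simp [VertexCondition]⟩
    · exact MemLp.zero' (p := 2)
    · have := integral_congr_L2 h0 hx
      simp only [Pi.zero_apply, intervalIntegral.integral_zero] at this
      simp only [Prod.snd_zero, PiLp.zero_apply]
      rw [this]; simp
  add_mem' := by
    rintro ⟨u, w⟩ ⟨v, z⟩ ⟨f, f', hf, hb⟩ ⟨g, g', hg, hc⟩
    refine ⟨fun j x => f j x + g j x, fun j x => f' j x + g' j x,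
      ⟨fun j => ?_, fun j => (hf.memLp j).add (hg.memLp j), fun j x hx => ?_, fun j x hx => ?_⟩,
      fun j k => ?_, fun k => ?_⟩
    · filter_upwards [Lp.coeFn_add (u j) (v j), hf.ae_eq j, hg.ae_eq j] with x h1 h2 h3
      simp only [Prod.fst_add, PiLp.add_apply]
      rw [h1, Pi.add_apply, h2, h3]
    · rw [intervalIntegral.integral_add (intervalIntegrable_of_L2 (hf.memLp j) hx)
        (intervalIntegrable_of_L2 (hg.memLp j) hx), hf.eq_integral j x hx, hg.eq_integral j x hx]
      ring
    · have h := integral_congr_L2 (Lp.coeFn_add (w j) (z j)) hx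
      simp only [Pi.add_apply] at h
      rw [intervalIntegral.integral_add (intervalIntegrable_of_L2 (Lp.memLp _) hx)
        (intervalIntegrable_of_L2 (Lp.memLp _) hx)] at h
      simp only [Prod.snd_add, PiLp.add_apply]
      rw [h, hf.deriv_eq_integral j x hx, hg.deriv_eq_integral j x hx]
      ring
    · have h1 := hb.1 j k
      have h2 := hc.1 j k
      simp only at h1 h2 ⊢
      rw [h1, h2]
    · have h1 := hb.2 k
      have h2 := hc.2 k
      simp only at h1 h2 ⊢
      rw [Finset.sum_add_distrib, h1, h2]
      ring
  smul_mem' := by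
    rintro c ⟨u, w⟩ ⟨f, f', hf, hb⟩
    refine ⟨fun j x => c * f j x, fun j x => c * f' j x,
      ⟨fun j => ?_, fun j => (hf.memLp j).const_mul c, fun j x hx => ?_, fun j x hx => ?_⟩,
      fun j k => ?_, fun k => ?_⟩
    · filter_upwards [Lp.coeFn_smul c (u j), hf.ae_eq j] with x h1 h2
      simp only [Prod.smul_fst, PiLp.smul_apply]
      rw [h1, Pi.smul_apply, h2, smul_eq_mul]
    · rw [intervalIntegral.integral_const_mul, hf.eq_integral j x hx]
      ring
    · have h := integral_congr_L2 (Lp.coeFn_smul c (w j)) hx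
      simp only [Pi.smul_apply, smul_eq_mul, intervalIntegral.integral_const_mul] at h
      simp only [Prod.smul_snd, PiLp.smul_apply]
      rw [h, hf.deriv_eq_integral j x hx]
      ring
    · have h1 := hb.1 j k
      simp only at h1 ⊢
      rw [h1]
    · have h1 := hb.2 k
      simp only at h1 ⊢
      rw [← Finset.mul_sum, h1]
      ring

theorem ae_zero_of_primitive_zero {g : ℝ → ℂ} (hg : MemLp g 2 (volume.restrict (Ioi (0 : ℝ))))
    (h : ∀ x : ℝ, 0 ≤ x → ∫ t in (0 : ℝ)..x, g t = 0) :
    g =ᵐ[volume.restrict (Ioi (0 : ℝ))] 0 := by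
  let G : ℝ → ℂ := indicator (Ioi 0) g
  have hloc : LocallyIntegrable G volume := by
    refine (LocallyIntegrable.mono_measure (μ := volume) ?_ le_rfl)
    have h1 : MemLp G 2 volume := (memLp_indicator_iff_restrict measurableSet_Ioi).2 hg
    exact h1.locallyIntegrable (by norm_num)
  have hG : ∀ x : ℝ, ∫ t in (0 : ℝ)..x, G t = 0 := by
    intro x
    rcases le_total 0 x with hx | hx
    · rw [← h x hx]
      refine intervalIntegral.integral_congr_ae (Filter.Eventually.of_forall fun t ht => ?_)
      rw [uIoc_of_le hx] at ht
      exact indicator_of_mem (show t ∈ Ioi (0:ℝ) from ht.1) g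
    · rw [intervalIntegral.integral_congr_ae (g := fun _ => 0)]
      · simp
      · refine Filter.Eventually.of_forall fun t ht => ?_
        rw [uIoc_of_ge hx] at ht
        exact indicator_of_notMem (show t ∉ Ioi (0:ℝ) from not_lt.2 ht.2) g
  have hae : G =ᵐ[volume] 0 := by
    filter_upwards [LocallyIntegrable.ae_hasDerivAt_integral hloc] with x hx
    have h1 := hx 0
    simp only [hG] at h1
    exact h1.unique (hasDerivAt_const x (0 : ℂ))
  rw [Filter.EventuallyEq, ae_restrict_iff' measurableSet_Ioi]
  filter_upwards [hae] with x hx hx0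
  rwa [show G x = g x from indicator_of_mem hx0 g] at hx

/-- The relation `hamiltonianGraph` is the graph of an operator. -/
theorem hamiltonianGraph_functional (N : ℕ) (α : ℝ) (p : L2Star N × L2Star N)
    (hp : p ∈ hamiltonianGraph N α) (h0 : p.1 = 0) : p.2 = 0 := by
  obtain ⟨u, w⟩ := p
  obtain ⟨f, f', hf, -⟩ := hp
  simp only at h0
  subst h0
  have hcont : ∀ j, ContinuousOn (f' j) (Ici 0) := by
    intro j x hx
    have hx1 : (0 : ℝ) ≤ x + 1 := by have : (0 : ℝ) ≤ x := hx; linarith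
    have h1 := intervalIntegral.continuousOn_primitive_interval'
      (intervalIntegrable_of_L2 (Lp.memLp (w j)) hx1) (left_mem_uIcc)
    have h2 : ContinuousOn (f' j) (Icc 0 (x + 1)) := by
      rw [uIcc_of_le hx1] at h1
      exact (continuousOn_const.sub h1).congr fun z hz => hf.deriv_eq_integral j z hz.1
    have h3 : Icc 0 (x + 1) ∈ nhdsWithin x (Ici 0) := by
      rw [← Ici_inter_Iic]
      exact Filter.inter_mem self_mem_nhdsWithin
        (mem_nhdsWithin_of_mem_nhds (Iic_mem_nhds (by linarith)))
    exact (h2 x ⟨hx, by linarith⟩).mono_of_mem_nhdsWithin h3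
  -- the continuous representative of the zero function vanishes
  have hf0 : ∀ j, ∀ x : ℝ, 0 ≤ x → f j x = 0 := by
    intro j
    have h1 : f j =ᵐ[volume.restrict (Ioi (0 : ℝ))] fun _ => 0 := by
      filter_upwards [hf.ae_eq j, Lp.coeFn_zero ℂ 2 (volume.restrict (Ioi (0 : ℝ)))] with x h2 h3
      rw [← h2]
      exact h3
    have hc : ContinuousOn (f j) (Ici 0) := by
      intro x hx
      have hx1 : (0 : ℝ) ≤ x + 1 := by have : (0 : ℝ) ≤ x := hx; linarith
      have h1 := intervalIntegral.continuousOn_primitive_interval'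
        (intervalIntegrable_of_L2 (hf.memLp j) hx1) (left_mem_uIcc)
      have h2 : ContinuousOn (f j) (Icc 0 (x + 1)) := by
        rw [uIcc_of_le hx1] at h1
        exact (continuousOn_const.add h1).congr fun z hz => hf.eq_integral j z hz.1
      have h3 : Icc 0 (x + 1) ∈ nhdsWithin x (Ici 0) := by
        rw [← Ici_inter_Iic]
        exact Filter.inter_mem self_mem_nhdsWithin
          (mem_nhdsWithin_of_mem_nhds (Iic_mem_nhds (by linarith)))
      exact (h2 x ⟨hx, by linarith⟩).mono_of_mem_nhdsWithin h3
    have h2 : EqOn (f j) (fun _ => 0) (Ioi 0) :=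
      Measure.eqOn_open_of_ae_eq h1 isOpen_Ioi (hc.mono Ioi_subset_Ici_self) continuousOn_const
    have h3 : EqOn (f j) (fun _ => 0) (Ici 0) :=
      h2.of_subset_closure hc continuousOn_const Ioi_subset_Ici_self (by rw [closure_Ioi])
    exact fun x hx => h3 hx
  -- hence so does its derivative
  have hf0' : ∀ j, ∀ x : ℝ, 0 ≤ x → f' j x = 0 := by
    intro j
    have h1 : f' j =ᵐ[volume.restrict (Ioi (0 : ℝ))] fun _ => 0 := by
      refine ae_zero_of_primitive_zero (hf.memLp j) fun x hx => ?_
      have h := hf.eq_integral j x hx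
      rw [hf0 j x hx, hf0 j 0 le_rfl, zero_add] at h
      exact h.symm
    have h2 : EqOn (f' j) (fun _ => 0) (Ioi 0) :=
      Measure.eqOn_open_of_ae_eq h1 isOpen_Ioi ((hcont j).mono Ioi_subset_Ici_self)
        continuousOn_const
    have h3 : EqOn (f' j) (fun _ => 0) (Ici 0) :=
      h2.of_subset_closure (hcont j) continuousOn_const Ioi_subset_Ici_self (by rw [closure_Ioi])
    exact fun x hx => h3 hx
  -- hence so does the second derivative
  ext1 j
  refine Lp.ext ((ae_zero_of_primitive_zero (Lp.memLp (w j)) fun x hx => ?_).trans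
    (Lp.coeFn_zero _ _ _).symm)
  have h := hf.deriv_eq_integral j x hx
  rw [hf0' j x hx, hf0' j 0 le_rfl, zero_sub] at h
  exact neg_eq_zero.1 h.symm

/-- The Hamiltonian `H = -d²/dx²` on the star graph with `N` infinite edges and the delta
condition of strength `α` at the vertex; its graph is `hamiltonianGraph N α`. -/
noncomputable def hamiltonian (N : ℕ) (α : ℝ) : L2Star N →ₗ.[ℂ] L2Star N :=
  (hamiltonianGraph N α).toLinearPMap

theorem hamiltonian_graph (N : ℕ) (α : ℝ) :
    (hamiltonian N α).graph = hamiltonianGraph N α :=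
  Submodule.toLinearPMap_graph_eq _ (hamiltonianGraph_functional N α)

/-- The operator `A` has the matrix-valued integral kernel `K j l x y`:
`(A f)_j(x) = ∑ l, ∫₀^∞ K j l x y f_l(y) dy` for almost all `x > 0`, with absolutely convergent
integrals. -/
def HasIntegralKernel {N : ℕ} (A : L2Star N →L[ℂ] L2Star N) (K : Fin N → Fin N → ℝ → ℝ → ℝ) :
    Prop :=
  ∀ (f : L2Star N) (j : Fin N), ∀ᵐ x ∂(volume.restrict (Ioi (0 : ℝ))),
    (∀ l, IntegrableOn (fun y => (K j l x y : ℂ) * f l y) (Ioi 0)) ∧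
    A f j x = ∑ l, ∫ y in Ioi (0 : ℝ), (K j l x y : ℂ) * f l y

/-! ### The wave kernel -/

/-- `u j t x` (for `t ≥ 0`, `x ≥ 0`) is a classical solution of the initial-value problem
`u_tt = u_xx`, `u(0, x) = f(x)`, `u_t(0, x) = 0` on the star graph, with the vertex conditions at
all times. Derivatives at the vertex and at time `0` are one-sided. -/
structure IsWaveSolution {N : ℕ} (α : ℝ) (f : Fin N → ℝ → ℂ) (u : Fin N → ℝ → ℝ → ℂ) : Prop where
  contDiffOn : ∀ j, ContDiffOn ℝ 2 (fun p : ℝ × ℝ => u j p.1 p.2) (Ici 0 ×ˢ Ici 0)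
  wave : ∀ j, ∀ t > 0, ∀ x > 0,
    deriv (deriv fun s => u j s x) t = deriv (deriv fun z => u j t z) x
  initial : ∀ j, ∀ x ≥ 0, u j 0 x = f j x
  initial_deriv : ∀ j, ∀ x ≥ 0, HasDerivWithinAt (fun t => u j t x) 0 (Ici 0) 0
  vertex : ∀ t ≥ 0, VertexCondition α (fun j => u j t 0)
    (fun j => derivWithin (fun x => u j t x) (Ici 0) 0)

/-- `G j l x y` is the wave kernel `G_j^l(t, x, y)` of the star graph. For fixed `j, l, x, y` it is
a finite signed measure in the time variable `t ∈ [0, ∞)`, and for all smooth initial data `f` with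
compact support in the open edges a solution `u` of the wave problem is given by
`u_j(t, x) = ∑ l, ∫₀^∞ G_j^l(t, x, y) f_l(y) dy`, in the sense of distributions in `t ∈ [0, ∞)`. -/
def IsWaveKernel (N : ℕ) (α : ℝ) (G : Fin N → Fin N → ℝ → ℝ → SignedMeasure ℝ) : Prop :=
  (∀ j l, ∀ x ≥ 0, ∀ y ≥ 0, ∀ s ⊆ Iio (0 : ℝ), G j l x y s = 0) ∧
  ∀ f : Fin N → ℝ → ℂ,
    (∀ l, ContDiff ℝ (⊤ : ℕ∞) (f l) ∧ HasCompactSupport (f l) ∧ tsupport (f l) ⊆ Ioi 0) →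
    ∃ u : Fin N → ℝ → ℝ → ℂ, IsWaveSolution α f u ∧
      ∀ φ : ℝ → ℂ, Continuous φ → HasCompactSupport φ → ∀ j, ∀ x ≥ 0,
        (∀ l, IntegrableOn (fun y => (∫ᵛ t, φ t ∂<•(G j l x y)) * f l y) (Ioi 0)) ∧
        ∫ t in Ioi (0 : ℝ), φ t * u j t x =
          ∑ l, ∫ y in Ioi (0 : ℝ), (∫ᵛ t, φ t ∂<•(G j l x y)) * f l y

/-! ### The explicit spectral density kernel and the scattering eigenfunctions -/

/-- The spectral density kernel `σ_j^l(ω, x, y)`. -/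
noncomputable def spectralDensity (N : ℕ) (α : ℝ) (j l : Fin N) (ω x y : ℝ) : ℝ :=
  (2 / Real.pi) * (if j = l then 1 else 0) * (Real.sin (ω * x) * Real.sin (ω * y)) +
  (2 / Real.pi) / (α ^ 2 + (N : ℝ) ^ 2 * ω ^ 2) *
    (N * ω ^ 2 * Real.cos (ω * (x + y)) + α * ω * Real.sin (ω * (x + y)))

/-- The component on edge `j` of the scattering eigenfunction `ψ^l` of frequency `ω` that comes in
along edge `l`:
`ψ_j^l(x) = δ_j^l e^{-iωx} + [-δ_j^l + (1/N) (1 + e^{-2i arctan(α/(Nω))})] e^{iωx}`. -/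
noncomputable def scatteringFunction (N : ℕ) (α ω : ℝ) (j l : Fin N) (x : ℝ) : ℂ :=
  (if j = l then 1 else 0) * Complex.exp (-(Complex.I * ω * x)) +
  (-(if j = l then 1 else 0) +
    1 / N * (1 + Complex.exp (-(2 * Complex.I * (Real.arctan (α / (N * ω)) : ℝ))))) *
    Complex.exp (Complex.I * ω * x)

end StarGraph

/-! Put κ = α/N. The projection onto vectors constant in the edge index decouples the vertex
condition: edge vectors of sum zero see the Dirichlet condition, constant vectors see the Robin
condition f'(0) = κ f(0). The real generalized eigenfunctions `eigenfunction` therefore combine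
sin(ωx) with the normalized ω cos(ωx) + κ sin(ωx), and the sum of their products over the index k is
σ (`sum_eigenfunction_mul_eigenfunction`).

Completeness rests on Gram matrices. The exponentials e^{-sx} placed on one edge form a total family
with Gram matrix δ_{jl}/(s+t). Their integrals against the eigenfunctions are explicit functions of
ω. By rational integrals, in which κ ≥ 0 matters, these have the same Gram matrix, and they are
total because a Stieltjes transform is injective. Hence there is a unitary U carrying one family to
the other (`exists_isEigenTransform`).

U turns H into multiplication by ω². On the Laplace side -u'' becomes f'(0) + s f(0) - s² Lu, and
the vertex condition says exactly how this first-order polynomial in s is determined by its value at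
one point σ (`laplace_resolvent`, `mem_hamiltonianGraph_iff`). Cutting off in ω² then gives one
spectral resolution of H. A spectral resolution is defined here only through its domain and
quadratic form, so uniqueness needs an argument: A - c is bounded by r on the spectral subspace of
[c-r, c+r] and bounded below by r' on that of {|λ-c| ≥ r'}. Iterating the two bounds for r < r'
separates the subspaces (`proj_Icc_unique`). The kernel of the projection follows from unitarity and
the inversion formula `symm_apply_ae_eq`.

For the wave equation, d'Alembert's formula with odd reflection leaves one unknown, the wave h
emitted by the vertex, and the vertex condition becomes h' + κh = F'/N with F the sum of the initial
data. Solving it gives a kernel made of two point masses and an exponential tail. The cosine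
transforms of these pieces add up to σ, and the cosine inversion formula gives the converse. The
claims on scattering functions follow from e^{-2i arctan t} = (1-it)/(1+it). -/

namespace StarGraph

/-- Lebesgue measure on the half line. -/
local notation "μ₊" => (volume.restrict (Ioi (0 : ℝ)) : Measure ℝ)

/-! ### Uniqueness of the spectral resolution on compact intervals -/

section SpectralUniqueness

variable {𝓗 : Type*} [NormedAddCommGroup 𝓗] [InnerProductSpace ℂ 𝓗] [CompleteSpace 𝓗]

namespace ProjValuedMeasure

variable (E : ProjValuedMeasure 𝓗)

theorem proj_union {s t : Set ℝ} (hs : MeasurableSet s) (ht : MeasurableSet t)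
    (hd : Disjoint s t) : E.proj (s ∪ t) = E.proj s + E.proj t := by
  ext u
  let S : ℕ → Set ℝ := fun n => if n = 0 then s else if n = 1 then t else ∅
  have hS : ∀ n, MeasurableSet (S n) := by
    intro n
    simp only [S]
    split_ifs <;> simp [hs, ht]
  have hdS : Pairwise (Function.onFun Disjoint S) := by
    intro i j hij
    simp only [S, Function.onFun]
    split_ifs <;> simp_all [disjoint_comm]
  have hU : ⋃ n, S n = s ∪ t := by
    ext x
    simp only [S, mem_iUnion, mem_union]
    constructor
    · rintro ⟨n, hn⟩
      split_ifs at hn <;> simp_all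
    · rintro (h | h)
      · exact ⟨0, by simpa using h⟩
      · exact ⟨1, by simpa using h⟩
  have h1 := E.hasSum_iUnion S hS hdS u
  rw [hU] at h1
  have h2 : HasSum (fun n => E.proj (S n) u) (∑ n ∈ {0, 1}, E.proj (S n) u) := by
    refine hasSum_sum_of_ne_finset_zero fun n hn => ?_
    simp only [Finset.mem_insert, Finset.mem_singleton, not_or] at hn
    simp [S, hn.1, hn.2, E.proj_empty]
  simpa [S] using h1.unique h2

/-- Idempotency of P + Q gives PQ + QP = 0. Multiplying by P on the left and on the right shows that
PQ and QP both equal -PQP, so they commute and 2PQ = 0. -/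
theorem proj_proj_of_disjoint {s t : Set ℝ} (hs : MeasurableSet s) (ht : MeasurableSet t)
    (hd : Disjoint s t) : E.proj s * E.proj t = 0 := by
  have hP := (E.isStarProjection s hs).isIdempotentElem.eq
  have hQ := (E.isStarProjection t ht).isIdempotentElem.eq
  have hR := (E.isStarProjection _ (hs.union ht)).isIdempotentElem.eq
  rw [E.proj_union hs ht hd] at hR
  set P := E.proj s
  set Q := E.proj t
  have h1 : P * Q + Q * P = 0 := by
    have : (P + Q) * (P + Q) = P * P + Q * Q + (P * Q + Q * P) := by noncomm_ring
    rw [this, hP, hQ] at hR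
    simpa using hR
  have h2 : P * Q + P * Q * P = 0 := by
    have := congrArg (P * ·) h1
    simpa [mul_add, ← mul_assoc, hP] using this
  have h3 : P * Q * P + Q * P = 0 := by
    have := congrArg (· * P) h1
    simpa [add_mul, mul_assoc, hP] using this
  have h4 : P * Q = Q * P := by
    rw [eq_neg_of_add_eq_zero_left h2, eq_neg_of_add_eq_zero_right h3]
  rw [← h4, ← two_smul ℂ] at h1
  simpa using h1

theorem proj_proj {s t : Set ℝ} (hs : MeasurableSet s) (ht : MeasurableSet t) (u : 𝓗) :
    E.proj s (E.proj t u) = E.proj (s ∩ t) u := by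
  have h1 : E.proj t = E.proj (s ∩ t) + E.proj (t \ s) := by
    rw [← E.proj_union (hs.inter ht) (ht.diff hs)
      (disjoint_left.2 fun x h1 h2 => h2.2 h1.1), inter_comm, inter_union_sdiff]
  have h2 : E.proj s = E.proj (s ∩ t) + E.proj (s \ t) := by
    rw [← E.proj_union (hs.inter ht) (hs.diff ht)
      (disjoint_left.2 fun x h1 h2 => h2.2 h1.2), inter_union_sdiff]
  have h3 : E.proj s * E.proj t = E.proj (s ∩ t) := by
    conv_lhs => rw [h1, mul_add]
    rw [E.proj_proj_of_disjoint hs (ht.diff hs) (disjoint_left.2 fun x h1 h2 => h2.2 h1), h2,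
      add_mul, (E.isStarProjection _ (hs.inter ht)).isIdempotentElem.eq,
      E.proj_proj_of_disjoint (hs.diff ht) (hs.inter ht)
        (disjoint_left.2 fun x h1 h2 => h1.2 h2.2)]
    simp
  rw [← h3]
  rfl

theorem proj_compl {s : Set ℝ} (hs : MeasurableSet s) (u : 𝓗) :
    E.proj sᶜ u = u - E.proj s u := by
  have h := E.proj_union hs hs.compl disjoint_compl_right
  rw [union_compl_self, E.proj_univ] at h
  rw [eq_sub_iff_add_eq, add_comm]
  exact (congrArg (fun T : 𝓗 →L[ℂ] 𝓗 => T u) h).symm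

theorem inner_proj_left {s : Set ℝ} (hs : MeasurableSet s) (u v : 𝓗) :
    ⟪E.proj s u, v⟫_ℂ = ⟪u, E.proj s v⟫_ℂ := by
  have h2 : ContinuousLinearMap.adjoint (E.proj s) = E.proj s :=
    (E.isStarProjection s hs).isSelfAdjoint
  rw [← ContinuousLinearMap.adjoint_inner_right, h2]

theorem inner_proj_self {s : Set ℝ} (hs : MeasurableSet s) (u : 𝓗) :
    ⟪u, E.proj s u⟫_ℂ = ((‖E.proj s u‖ ^ 2 : ℝ) : ℂ) := by
  have h := E.proj_proj hs hs u
  rw [inter_self] at h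
  rw [← h, ← E.inner_proj_left hs, inner_self_eq_norm_sq_to_K, h]
  simp

theorem norm_proj_le {s : Set ℝ} (hs : MeasurableSet s) (u : 𝓗) : ‖E.proj s u‖ ≤ ‖u‖ := by
  have h1 := norm_inner_le_norm (𝕜 := ℂ) u (E.proj s u)
  rw [E.inner_proj_self hs, Complex.norm_real, Real.norm_of_nonneg (by positivity)] at h1
  rcases (norm_nonneg (E.proj s u)).eq_or_lt with h0 | h0
  · rw [← h0]
    exact norm_nonneg u
  · nlinarith

theorem scalarMeasure_apply (u : 𝓗) {s : Set ℝ} (hs : MeasurableSet s) :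
    E.scalarMeasure u s = ENNReal.ofReal (‖E.proj s u‖ ^ 2) := by
  rw [scalarMeasure, Measure.ofMeasurable_apply s hs, E.inner_proj_self hs, Complex.ofReal_re]

theorem scalarMeasure_univ (u : 𝓗) :
    E.scalarMeasure u univ = ENNReal.ofReal (‖u‖ ^ 2) := by
  rw [E.scalarMeasure_apply u MeasurableSet.univ, E.proj_univ]
  rfl

instance (u : 𝓗) : IsFiniteMeasure (E.scalarMeasure u) :=
  ⟨by rw [scalarMeasure_univ]; exact ENNReal.ofReal_lt_top⟩

theorem scalarMeasure_proj (u : 𝓗) {s : Set ℝ} (hs : MeasurableSet s) :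
    E.scalarMeasure (E.proj s u) = (E.scalarMeasure u).restrict s := by
  ext t ht
  rw [Measure.restrict_apply ht, E.scalarMeasure_apply _ ht, E.scalarMeasure_apply _ (ht.inter hs),
    E.proj_proj ht hs]

theorem scalarMeasure_smul (c : ℂ) (u : 𝓗) :
    E.scalarMeasure (c • u) = ENNReal.ofReal (‖c‖ ^ 2) • E.scalarMeasure u := by
  ext t ht
  rw [Measure.smul_apply, E.scalarMeasure_apply _ ht, E.scalarMeasure_apply _ ht, map_smul,
    norm_smul, mul_pow, ENNReal.ofReal_mul (by positivity), smul_eq_mul]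

/-- Every E(t) commutes with E(s), so E(t)p stays in the range of E(s) and E(t)q in that of the
complement. Pythagoras then applies for each t. -/
theorem scalarMeasure_add {s : Set ℝ} (hs : MeasurableSet s) {p q : 𝓗} (hp : E.proj s p = p)
    (hq : E.proj s q = 0) :
    E.scalarMeasure (p + q) = E.scalarMeasure p + E.scalarMeasure q := by
  ext t ht
  rw [Measure.add_apply, E.scalarMeasure_apply _ ht, E.scalarMeasure_apply _ ht,
    E.scalarMeasure_apply _ ht, ← ENNReal.ofReal_add (by positivity) (by positivity), map_add]
  congr 1
  have h : ⟪E.proj t p, E.proj t q⟫_ℂ = 0 := by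
    rw [E.inner_proj_left ht, E.proj_proj ht ht, inter_self, ← hp, E.inner_proj_left hs,
      E.proj_proj hs ht, inter_comm, ← E.proj_proj ht hs, hq, map_zero, inner_zero_right]
  have := norm_add_sq_eq_norm_sq_add_norm_sq_of_inner_eq_zero _ _ h
  nlinarith

/-- The squared distance is the finite scalar measure of the complement of [-n, n], and these sets
decrease to the empty set. -/
theorem tendsto_proj_Icc (u : 𝓗) :
    Filter.Tendsto (fun n : ℕ => E.proj (Icc (-(n : ℝ)) n) u) Filter.atTop (nhds u) := by
  have h1 : Filter.Tendsto (fun n : ℕ => E.scalarMeasure u (Icc (-(n : ℝ)) n)ᶜ) Filter.atTop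
      (nhds (E.scalarMeasure u (⋂ n : ℕ, (Icc (-(n : ℝ)) n)ᶜ))) := by
    refine tendsto_measure_iInter_atTop (fun n => measurableSet_Icc.compl.nullMeasurableSet)
      (fun m n hmn => compl_subset_compl.2 (Icc_subset_Icc ?_ ?_)) ⟨0, measure_ne_top _ _⟩
    · have : (m : ℝ) ≤ n := by exact_mod_cast hmn
      linarith
    · exact_mod_cast hmn
  have h2 : ⋂ n : ℕ, (Icc (-(n : ℝ)) n)ᶜ = ∅ := by
    refine eq_empty_of_forall_notMem fun x hx => ?_
    obtain ⟨n, hn⟩ := exists_nat_ge |x|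
    exact mem_iInter.1 hx n ⟨(abs_le.1 hn).1, (abs_le.1 hn).2⟩
  rw [h2, measure_empty] at h1
  have h3 := (ENNReal.tendsto_toReal ENNReal.zero_ne_top).comp h1
  have h4 : Filter.Tendsto (fun n : ℕ => ‖u - E.proj (Icc (-(n : ℝ)) n) u‖ ^ 2) Filter.atTop
      (nhds 0) := by
    refine h3.congr fun n => ?_
    simp only [Function.comp]
    rw [E.scalarMeasure_apply _ measurableSet_Icc.compl, E.proj_compl measurableSet_Icc,
      ENNReal.toReal_ofReal (by positivity)]
  have h5 := h4.sqrt
  simp only [Real.sqrt_zero, Real.sqrt_sq (norm_nonneg _)] at h5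
  exact (tendsto_iff_norm_sub_tendsto_zero.2 (by simpa [norm_sub_rev] using h5))

end ProjValuedMeasure

namespace IsSpectralResolution

variable {A : 𝓗 →ₗ.[ℂ] 𝓗} {E : ProjValuedMeasure 𝓗}

theorem proj_mem_domain (h : IsSpectralResolution A E) {s : Set ℝ} (hs : MeasurableSet s) {u : 𝓗}
    (hu : u ∈ A.domain) : E.proj s u ∈ A.domain := by
  rw [h.1] at hu ⊢
  rw [E.scalarMeasure_proj u hs]
  exact (lintegral_mono' Measure.restrict_le_self le_rfl).trans_lt hu

theorem proj_Icc_mem_domain (h : IsSpectralResolution A E) (a b : ℝ) (u : 𝓗) :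
    E.proj (Icc a b) u ∈ A.domain := by
  rw [h.1, E.scalarMeasure_proj u measurableSet_Icc]
  refine setLIntegral_lt_top_of_isCompact (measure_ne_top _ _) isCompact_Icc ?_
  fun_prop

theorem integrable_id (h : IsSpectralResolution A E) {u : 𝓗} (hu : u ∈ A.domain) :
    Integrable (fun l : ℝ => l) (E.scalarMeasure u) := by
  have h1 : MemLp (fun l : ℝ => l) 2 (E.scalarMeasure u) := by
    refine ⟨by fun_prop, ?_⟩
    rw [eLpNorm_lt_top_iff_lintegral_rpow_enorm_lt_top (by norm_num) (by norm_num)]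
    convert (h.1 u).1 hu using 3 with l
    simp only [ENNReal.toReal_ofNat, ENNReal.rpow_ofNat]
    rw [Real.enorm_eq_ofReal_abs, ← ENNReal.ofReal_pow (abs_nonneg _), sq_abs]
  exact h1.integrable (by norm_num)

theorem re_inner_le (h : IsSpectralResolution A E) {s : Set ℝ} (hs : MeasurableSet s) {b : ℝ}
    (hb : ∀ x ∈ s, x ≤ b) (w : A.domain) (hw : E.proj s w = w) :
    (⟪(w : 𝓗), A w⟫_ℂ).re ≤ b * ‖(w : 𝓗)‖ ^ 2 := by
  rw [h.2 w, Complex.ofReal_re]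
  have hi := h.integrable_id w.2
  have hr : E.scalarMeasure (w : 𝓗) = (E.scalarMeasure (w : 𝓗)).restrict s := by
    conv_lhs => rw [← hw, E.scalarMeasure_proj _ hs]
  have h1 : ∫ l, l ∂(E.scalarMeasure (w : 𝓗)) ≤ ∫ _, b ∂(E.scalarMeasure (w : 𝓗)) := by
    refine integral_mono_ae hi (integrable_const b) ?_
    rw [hr]
    exact (ae_restrict_iff' hs).2 (Filter.Eventually.of_forall hb)
  refine h1.trans_eq ?_
  rw [integral_const, Measure.real, E.scalarMeasure_univ, ENNReal.toReal_ofReal (by positivity),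
    smul_eq_mul, mul_comm]

theorem le_re_inner (h : IsSpectralResolution A E) {s : Set ℝ} (hs : MeasurableSet s) {a : ℝ}
    (ha : ∀ x ∈ s, a ≤ x) (w : A.domain) (hw : E.proj s w = w) :
    a * ‖(w : 𝓗)‖ ^ 2 ≤ (⟪(w : 𝓗), A w⟫_ℂ).re := by
  rw [h.2 w, Complex.ofReal_re]
  have hi := h.integrable_id w.2
  have hr : E.scalarMeasure (w : 𝓗) = (E.scalarMeasure (w : 𝓗)).restrict s := by
    conv_lhs => rw [← hw, E.scalarMeasure_proj _ hs]
  have h1 : ∫ _, a ∂(E.scalarMeasure (w : 𝓗)) ≤ ∫ l, l ∂(E.scalarMeasure (w : 𝓗)) := by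
    refine integral_mono_ae (integrable_const a) hi ?_
    rw [hr]
    exact (ae_restrict_iff' hs).2 (Filter.Eventually.of_forall ha)
  refine le_trans (le_of_eq ?_) h1
  rw [integral_const, Measure.real, E.scalarMeasure_univ, ENNReal.toReal_ofReal (by positivity),
    smul_eq_mul, mul_comm]

/-- The operator maps the ranges of complementary spectral projections to orthogonal vectors. -/
theorem inner_eq_zero (h : IsSpectralResolution A E) {s : Set ℝ} (hs : MeasurableSet s)
    (p q : A.domain) (hp : E.proj s p = p) (hq : E.proj s q = 0) :
    ⟪(p : 𝓗), A q⟫_ℂ = 0 ∧ ⟪(q : 𝓗), A p⟫_ℂ = 0 := by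
  -- The scalar measure of p + zq does not depend on the unimodular z, so the cross terms of the
  -- quadratic form vanish for every such z. The values z = 1 and z = i separate the two inner
  -- products.
  have key : ∀ z : ℂ, ‖z‖ = 1 → z * ⟪(p : 𝓗), A q⟫_ℂ + (starRingEnd ℂ) z * ⟪(q : 𝓗), A p⟫_ℂ = 0 := by
    intro z hz
    have h1 := h.2 (p + z • q)
    have hzq : E.scalarMeasure (z • (q : 𝓗)) = E.scalarMeasure (q : 𝓗) := by
      rw [E.scalarMeasure_smul, hz]
      simp
    have h2 : E.scalarMeasure ((p + z • q : A.domain) : 𝓗) =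
        E.scalarMeasure (p : 𝓗) + E.scalarMeasure (q : 𝓗) := by
      rw [Submodule.coe_add, Submodule.coe_smul,
        E.scalarMeasure_add hs hp (by rw [map_smul, hq, smul_zero]), hzq]
    rw [h2, integral_add_measure (h.integrable_id p.2) (h.integrable_id q.2), A.map_add, A.map_smul,
      Submodule.coe_add, Submodule.coe_smul, Complex.ofReal_add, ← h.2 p, ← h.2 q] at h1
    simp only [inner_add_left, inner_add_right, inner_smul_left, inner_smul_right] at h1
    have h3 : (starRingEnd ℂ) z * z = 1 := by
      rw [← Complex.normSq_eq_conj_mul_self, Complex.normSq_eq_norm_sq, hz]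
      simp
    linear_combination h1 - ⟪(q : 𝓗), A q⟫_ℂ * h3
  have h1 := key 1 (by simp)
  have hI := key Complex.I (by simp)
  simp only [one_mul, map_one, Complex.conj_I] at h1 hI
  have hI' : Complex.I * (⟪(p : 𝓗), A q⟫_ℂ - ⟪(q : 𝓗), A p⟫_ℂ) = 0 := by linear_combination hI
  have h2 := (mul_eq_zero.1 hI').resolve_left Complex.I_ne_zero
  constructor
  · linear_combination (h1 + h2) / 2
  · linear_combination (h1 - h2) / 2

/-- The component y of Ap in the range of E(sᶜ) should be orthogonal to Ap, but `inner_eq_zero`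
applies only to vectors of the domain. The truncations of y by E([-n, n]) lie there, remain in the
range of E(sᶜ), and converge to y. -/
theorem proj_apply_eq_self (h : IsSpectralResolution A E) {s : Set ℝ} (hs : MeasurableSet s)
    (p : A.domain) (hp : E.proj s p = p) : E.proj s (A p) = A p := by
  have h1 : E.proj sᶜ (A p) = 0 := by
    set y := E.proj sᶜ (A p)
    have h2 : ∀ n : ℕ, ⟪E.proj (Icc (-(n : ℝ)) n) y, A p⟫_ℂ = 0 := by
      intro n
      refine (h.inner_eq_zero hs p ⟨_, h.proj_Icc_mem_domain _ _ _⟩ hp ?_).2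
      simp only [y]
      rw [E.proj_proj measurableSet_Icc hs.compl, E.proj_proj hs
        (measurableSet_Icc.inter hs.compl)]
      have : s ∩ (Icc (-(n : ℝ)) n ∩ sᶜ) = ∅ := by
        ext x
        simp only [mem_inter_iff, mem_compl_iff, mem_empty_iff_false, iff_false]
        tauto
      rw [this, E.proj_empty]
      rfl
    have h3 : ⟪y, A p⟫_ℂ = 0 := by
      have h4 := (E.tendsto_proj_Icc y).inner (tendsto_const_nhds (x := A p)) (𝕜 := ℂ)
      simp only [h2] at h4
      exact tendsto_nhds_unique h4 tendsto_const_nhds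
    have h5 := E.inner_proj_self hs.compl (A p)
    rw [← E.inner_proj_left hs.compl, h3] at h5
    have h6 : ‖y‖ ^ 2 = 0 := by exact_mod_cast h5.symm
    simpa using h6
  rw [E.proj_compl hs, sub_eq_zero] at h1
  exact h1.symm

theorem apply_proj (h : IsSpectralResolution A E) {s : Set ℝ} (hs : MeasurableSet s)
    (v : A.domain) : A ⟨E.proj s v, h.proj_mem_domain hs v.2⟩ = E.proj s (A v) := by
  let p : A.domain := ⟨E.proj s v, h.proj_mem_domain hs v.2⟩
  let q : A.domain := ⟨E.proj sᶜ v, h.proj_mem_domain hs.compl v.2⟩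
  have hv : v = p + q := by
    ext
    simp [p, q, E.proj_compl hs]
  have hp : E.proj s (A p) = A p := by
    refine h.proj_apply_eq_self hs p ?_
    simp only [p]
    rw [E.proj_proj hs hs, inter_self]
  have hq : E.proj s (A q) = 0 := by
    have : E.proj sᶜ (A q) = A q := by
      refine h.proj_apply_eq_self hs.compl q ?_
      simp only [q]
      rw [E.proj_proj hs.compl hs.compl, inter_self]
    rw [← this, E.proj_proj hs hs.compl, inter_compl_self, E.proj_empty]
    rfl
  conv_rhs => rw [hv, A.map_add, map_add, hp, hq, add_zero]

/-- The quadratic form is real by definition of a spectral resolution; polarization with 1 and i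
makes the operator symmetric. -/
theorem inner_symm (h : IsSpectralResolution A E) (p q : A.domain) :
    ⟪(p : 𝓗), A q⟫_ℂ = ⟪A p, (q : 𝓗)⟫_ℂ := by
  have hreal : ∀ x : A.domain, ⟪A x, (x : 𝓗)⟫_ℂ = ⟪(x : 𝓗), A x⟫_ℂ := by
    intro x
    rw [← inner_conj_symm, h.2 x, Complex.conj_ofReal]
  have key : ∀ z : ℂ, z * ⟪(p : 𝓗), A q⟫_ℂ + (starRingEnd ℂ) z * ⟪(q : 𝓗), A p⟫_ℂ =
      z * ⟪A p, (q : 𝓗)⟫_ℂ + (starRingEnd ℂ) z * ⟪A q, (p : 𝓗)⟫_ℂ := by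
    intro z
    have h1 := hreal (p + z • q)
    rw [A.map_add, A.map_smul, Submodule.coe_add, Submodule.coe_smul] at h1
    simp only [inner_add_left, inner_add_right, inner_smul_left, inner_smul_right] at h1
    linear_combination -h1 + hreal p + z * (starRingEnd ℂ) z * hreal q
  have h1 := key 1
  have hI := key Complex.I
  simp only [one_mul, map_one, Complex.conj_I] at h1 hI
  linear_combination h1 / 2 - Complex.I * hI / 2 +
    (⟪(p : 𝓗), A q⟫_ℂ - ⟪A p, (q : 𝓗)⟫_ℂ - ⟪(q : 𝓗), A p⟫_ℂ + ⟪A q, (p : 𝓗)⟫_ℂ) / 2 * Complex.I_sq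

/-- On the range of the spectral projection of an interval of radius `r` around `c`, the operator
`A - c` is bounded by `r`. -/
theorem norm_sub_smul_le (h : IsSpectralResolution A E) {c r : ℝ} (hr : 0 < r) (y : A.domain)
    (hy : E.proj (Icc (c - r) (c + r)) y = y) : ‖A y - (c : ℂ) • (y : 𝓗)‖ ≤ r * ‖(y : 𝓗)‖ := by
  have hI : MeasurableSet (Icc (c - r) (c + r)) := measurableSet_Icc
  have hAy := h.proj_apply_eq_self hI y hy
  set z₀ : 𝓗 := A y - (c : ℂ) • (y : 𝓗) with hz₀
  have hzE : E.proj (Icc (c - r) (c + r)) z₀ = z₀ := by rw [hz₀, map_sub, map_smul, hAy, hy]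
  have hzd : z₀ ∈ A.domain := by rw [← hzE]; exact h.proj_Icc_mem_domain _ _ _
  let z : A.domain := ⟨z₀, hzd⟩
  -- The form of A - c is bounded by r in absolute value on this subspace. Subtracting its values at
  -- x + y and x - y and using the parallelogram law gives 4 Re⟨x, (A-c)y⟩ ≤ 2r(‖x‖² + ‖y‖²). The
  -- choice x = (A-c)y / r turns this into the norm bound.
  let x : A.domain := ((r⁻¹ : ℝ) : ℂ) • z
  have hx : E.proj (Icc (c - r) (c + r)) x = x := by
    simp only [x, Submodule.coe_smul, map_smul, z, hzE]
  have hup := h.re_inner_le hI (fun t ht => ht.2) (x + y)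
    (by rw [Submodule.coe_add, map_add, hx, hy])
  have hlo := h.le_re_inner hI (fun t ht => ht.1) (x - y)
    (by rw [Submodule.coe_sub, map_sub, hx, hy])
  have hpar := parallelogram_law_with_norm ℂ (x : 𝓗) (y : 𝓗)
  have hs : (⟪(y : 𝓗), A x⟫_ℂ).re = (⟪(x : 𝓗), A y⟫_ℂ).re := by
    rw [h.inner_symm y x, ← inner_conj_symm, Complex.conj_re]
  have hxy : (⟪(x : 𝓗), A y⟫_ℂ).re = r⁻¹ * ‖z₀‖ ^ 2 + c * (⟪(x : 𝓗), (y : 𝓗)⟫_ℂ).re := by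
    have e1 : A y = z₀ + (c : ℂ) • (y : 𝓗) := by rw [hz₀]; simp
    rw [e1, inner_add_right, inner_smul_right, Complex.add_re, Complex.re_ofReal_mul]
    congr 1
    simp only [x, z, Submodule.coe_smul, inner_smul_left, Complex.conj_ofReal]
    rw [Complex.re_ofReal_mul, inner_self_eq_norm_sq_to_K]
    norm_cast
  have hnx : ‖(x : 𝓗)‖ ^ 2 = (r⁻¹) ^ 2 * ‖z₀‖ ^ 2 := by
    simp only [x, z, Submodule.coe_smul, norm_smul, mul_pow]
    simp
  have hsum := norm_add_sq (𝕜 := ℂ) (x : 𝓗) (y : 𝓗)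
  have hdiff := norm_sub_sq (𝕜 := ℂ) (x : 𝓗) (y : 𝓗)
  simp only [Submodule.coe_add, Submodule.coe_sub, A.map_add, A.map_sub, inner_add_left,
    inner_add_right, inner_sub_left, inner_sub_right, Complex.add_re, Complex.sub_re, hs, hxy]
    at hup hlo
  rw [RCLike.re_eq_complex_re] at hsum hdiff
  rw [hsum] at hup
  rw [hdiff] at hlo
  rw [hnx] at hup hlo
  have e2 : r⁻¹ * ‖z₀‖ ^ 2 * 4 ≤ 2 * r * ((r⁻¹) ^ 2 * ‖z₀‖ ^ 2 + ‖(y : 𝓗)‖ ^ 2) := by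
    nlinarith [hup, hlo]
  have e3 : ‖z₀‖ ^ 2 ≤ (r * ‖(y : 𝓗)‖) ^ 2 := by
    have e4 : r * (r⁻¹ * ‖z₀‖ ^ 2 * 4) = 4 * ‖z₀‖ ^ 2 := by field_simp
    have e5 : r * (2 * r * ((r⁻¹) ^ 2 * ‖z₀‖ ^ 2 + ‖(y : 𝓗)‖ ^ 2)) =
        2 * ‖z₀‖ ^ 2 + 2 * (r * ‖(y : 𝓗)‖) ^ 2 := by field_simp
    have := mul_le_mul_of_nonneg_left e2 hr.le
    rw [e4, e5] at this
    linarith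
  exact (sq_le_sq₀ (norm_nonneg _) (by positivity)).1 e3

/-- On the range of the spectral projection of the complement of an interval of radius `r` around
`c`, the operator `A - c` is bounded below by `r`. -/
theorem le_norm_sub_smul (h : IsSpectralResolution A E) {c r : ℝ} (w : A.domain)
    (hw : E.proj {l | r ≤ |l - c|} w = w) : r * ‖(w : 𝓗)‖ ≤ ‖A w - (c : ℂ) • (w : 𝓗)‖ := by
  rcases le_or_gt r 0 with hr | hr
  · exact (mul_nonpos_of_nonpos_of_nonneg hr (norm_nonneg _)).trans (norm_nonneg _)
  have hJ : MeasurableSet {l : ℝ | r ≤ |l - c|} := measurableSet_le (by fun_prop) (by fun_prop)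
  have hS : MeasurableSet (Ici (c + r)) := measurableSet_Ici
  have hT : MeasurableSet (Iic (c - r)) := measurableSet_Iic
  have hJu : {l : ℝ | r ≤ |l - c|} = Ici (c + r) ∪ Iic (c - r) := by
    ext l
    simp only [mem_ofPred_eq, mem_union, mem_Ici, mem_Iic, le_abs]
    constructor <;> rintro (h | h) <;> [left; right; left; right] <;> linarith
  have hd : Disjoint (Ici (c + r)) (Iic (c - r)) :=
    disjoint_left.2 fun x h1 h2 => by
      have h3 : c + r ≤ x := h1
      have h4 : x ≤ c - r := h2
      linarith
  let p : A.domain := ⟨E.proj (Ici (c + r)) w, h.proj_mem_domain hS w.2⟩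
  let q : A.domain := ⟨E.proj (Iic (c - r)) w, h.proj_mem_domain hT w.2⟩
  have hwpq : w = p + q := by
    ext
    conv_lhs => rw [← hw, hJu, E.proj_union hS hT hd]
    rfl
  have hp : E.proj (Ici (c + r)) p = p := by
    simp only [p]
    rw [E.proj_proj hS hS, inter_self]
  have hq : E.proj (Iic (c - r)) q = q := by
    simp only [q]
    rw [E.proj_proj hT hT, inter_self]
  have hq0 : E.proj (Ici (c + r)) q = 0 := by
    simp only [q]
    rw [E.proj_proj hS hT, disjoint_iff_inter_eq_empty.1 hd, E.proj_empty]
    rfl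
  have hpq : ⟪(p : 𝓗), (q : 𝓗)⟫_ℂ = 0 := by
    rw [← hp, E.inner_proj_left hS, hq0, inner_zero_right]
  have hqp : ⟪(q : 𝓗), (p : 𝓗)⟫_ℂ = 0 := by rw [← inner_conj_symm, hpq, map_zero]
  obtain ⟨hpq', hqp'⟩ := h.inner_eq_zero hS p q hp hq0
  have h1 := h.le_re_inner hS (fun t ht => ht) p hp
  have h2 := h.re_inner_le hT (fun t ht => ht) q hq
  have hn1 : ‖(w : 𝓗)‖ ^ 2 = ‖(p : 𝓗)‖ ^ 2 + ‖(q : 𝓗)‖ ^ 2 := by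
    have := norm_add_sq_eq_norm_sq_add_norm_sq_of_inner_eq_zero _ _ hpq
    rw [hwpq, Submodule.coe_add]
    nlinarith
  have hn2 : ‖(p : 𝓗) - q‖ ^ 2 = ‖(w : 𝓗)‖ ^ 2 := by
    have := norm_sub_sq (𝕜 := ℂ) (p : 𝓗) (q : 𝓗)
    rw [hpq] at this
    rw [this, hn1]
    simp
  have hn3 : ‖(p : 𝓗) - q‖ = ‖(w : 𝓗)‖ := by
    rwa [sq_eq_sq₀ (norm_nonneg _) (norm_nonneg _)] at hn2
  -- Here p is the part of w above c + r and q the part below c - r. Testing against p - q makes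
  -- both parts contribute positively, and p - q has the same norm as w.
  have h3 : r * ‖(w : 𝓗)‖ ^ 2 ≤ (⟪(p : 𝓗) - q, A w - (c : ℂ) • (w : 𝓗)⟫_ℂ).re := by
    have e1 : ⟪(p : 𝓗) - q, A w - (c : ℂ) • (w : 𝓗)⟫_ℂ =
        ⟪(p : 𝓗), A p⟫_ℂ - ⟪(q : 𝓗), A q⟫_ℂ - c * (⟪(p : 𝓗), (p : 𝓗)⟫_ℂ - ⟪(q : 𝓗), (q : 𝓗)⟫_ℂ) := by
      rw [hwpq, A.map_add, Submodule.coe_add]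
      simp only [inner_sub_left, inner_sub_right, inner_add_right, inner_smul_right, hpq, hqp, hpq',
        hqp']
      ring
    rw [e1, Complex.sub_re, Complex.sub_re, Complex.re_ofReal_mul, Complex.sub_re,
      ← RCLike.re_eq_complex_re, inner_self_eq_norm_sq,
      inner_self_eq_norm_sq, hn1]
    simp only [RCLike.re_eq_complex_re]
    nlinarith [h1, h2]
  have h4 := (h3.trans (Complex.re_le_norm _)).trans (norm_inner_le_norm _ _)
  rw [hn3] at h4
  rcases (norm_nonneg (w : 𝓗)).eq_or_lt with h0 | h0
  · rw [← h0]; simp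
  · nlinarith

/-- Both spectral projections commute with A. Under n applications of A - c the vector v grows at
most like rⁿ, while its component in the range of F grows at least like r'ⁿ. As r < r', that
component is at most (r/r')ⁿ‖v‖ for every n. -/
theorem proj_eq_zero_of_proj_Icc_eq {F : ProjValuedMeasure 𝓗} (hE : IsSpectralResolution A E)
    (hF : IsSpectralResolution A F) {c r r' : ℝ} (hr : 0 < r) (hr' : r < r') (v : 𝓗)
    (hv : E.proj (Icc (c - r) (c + r)) v = v) : F.proj {l | r' ≤ |l - c|} v = 0 := by
  have hI : MeasurableSet (Icc (c - r) (c + r)) := measurableSet_Icc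
  have hJ : MeasurableSet {l : ℝ | r' ≤ |l - c|} := measurableSet_le (by fun_prop) (by fun_prop)
  have key : ∀ n : ℕ, ∀ y : 𝓗, E.proj (Icc (c - r) (c + r)) y = y →
      r' ^ n * ‖F.proj {l | r' ≤ |l - c|} y‖ ≤ r ^ n * ‖y‖ := by
    intro n
    induction n with
    | zero =>
      intro y _
      simpa using F.norm_proj_le hJ y
    | succ n ih =>
      intro y hy
      have hyd : y ∈ A.domain := by rw [← hy]; exact hE.proj_Icc_mem_domain _ _ _
      let Y : A.domain := ⟨y, hyd⟩
      have hAy := hE.proj_apply_eq_self hI Y hy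
      have h1 := ih (A Y - (c : ℂ) • y) (by rw [map_sub, map_smul, hAy, hy])
      have h2 := hE.norm_sub_smul_le hr Y hy
      have h3 := hF.le_norm_sub_smul (c := c) (r := r') ⟨_, hF.proj_mem_domain hJ hyd⟩
        (by simp only; rw [F.proj_proj hJ hJ, inter_self])
      rw [hF.apply_proj hJ Y] at h3
      rw [map_sub, map_smul] at h1
      calc r' ^ (n + 1) * ‖F.proj {l | r' ≤ |l - c|} y‖
          = r' ^ n * (r' * ‖F.proj {l | r' ≤ |l - c|} y‖) := by ring
        _ ≤ r' ^ n * _ := mul_le_mul_of_nonneg_left h3 (pow_nonneg (hr.trans hr').le n)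
        _ ≤ r ^ n * ‖A Y - (c : ℂ) • y‖ := h1
        _ ≤ r ^ n * (r * ‖y‖) := mul_le_mul_of_nonneg_left h2 (pow_nonneg hr.le n)
        _ = r ^ (n + 1) * ‖y‖ := by ring
  have h0 : 0 < r' := hr.trans hr'
  have hlim : Filter.Tendsto (fun n : ℕ => (r / r') ^ n * ‖v‖) Filter.atTop (nhds 0) := by
    simpa using (tendsto_pow_atTop_nhds_zero_of_lt_one (div_nonneg hr.le h0.le)
      ((div_lt_one h0).2 hr')).mul_const ‖v‖
  have hle : ‖F.proj {l | r' ≤ |l - c|} v‖ ≤ 0 := by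
    refine ge_of_tendsto' hlim fun n => ?_
    have := key n v hv
    rw [div_pow, div_mul_eq_mul_div, le_div_iff₀ (pow_pos h0 n)]
    linarith
  exact norm_le_zero_iff.1 hle

theorem proj_Icc_eq_self {F : ProjValuedMeasure 𝓗} (hE : IsSpectralResolution A E)
    (hF : IsSpectralResolution A F) {c r : ℝ} (hr : 0 ≤ r) (v : 𝓗)
    (hv : E.proj (Icc (c - r) (c + r)) v = v) : F.proj (Icc (c - r) (c + r)) v = v := by
  have h0 : ∀ r' > r, F.scalarMeasure v {l | r' ≤ |l - c|} = 0 := by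
    intro r' hr'
    have hJ : MeasurableSet {l : ℝ | r' ≤ |l - c|} := measurableSet_le (by fun_prop) (by fun_prop)
    -- The radius r may be 0, and the preceding lemma needs a positive one below r'; the midpoint of
    -- r and r' qualifies.
    have hv' : E.proj (Icc (c - (r + r') / 2) (c + (r + r') / 2)) v = v := by
      rw [← hv, E.proj_proj measurableSet_Icc measurableSet_Icc, inter_eq_right.2]
      exact Icc_subset_Icc (by linarith) (by linarith)
    rw [F.scalarMeasure_apply _ hJ,
      hE.proj_eq_zero_of_proj_Icc_eq hF (by linarith) (by linarith) v hv']
    simp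
  have h1 : F.scalarMeasure v (Icc (c - r) (c + r))ᶜ = 0 := by
    have hU : (Icc (c - r) (c + r))ᶜ = ⋃ n : ℕ, {l : ℝ | r + 1 / ((n : ℝ) + 1) ≤ |l - c|} := by
      ext l
      simp only [mem_compl_iff, mem_iUnion, mem_ofPred_eq]
      rw [← Real.closedBall_eq_Icc, Metric.mem_closedBall, Real.dist_eq, not_le]
      constructor
      · intro h
        obtain ⟨n, hn⟩ := exists_nat_one_div_lt (sub_pos.2 h)
        exact ⟨n, by linarith⟩
      · rintro ⟨n, hn⟩
        have : (0 : ℝ) < 1 / ((n : ℝ) + 1) := by positivity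
        linarith
    rw [hU]
    refine measure_iUnion_null fun n => h0 _ ?_
    have : (0 : ℝ) < 1 / ((n : ℝ) + 1) := by positivity
    linarith
  rw [F.scalarMeasure_apply _ measurableSet_Icc.compl, F.proj_compl measurableSet_Icc,
    ENNReal.ofReal_eq_zero] at h1
  have h2 : ‖v - F.proj (Icc (c - r) (c + r)) v‖ = 0 := by
    have h3 := norm_nonneg (v - F.proj (Icc (c - r) (c + r)) v)
    nlinarith
  exact (sub_eq_zero.1 (norm_eq_zero.1 h2)).symm

/-- Two spectral resolutions of the same operator agree on compact intervals. -/
theorem proj_Icc_unique {F : ProjValuedMeasure 𝓗} (hE : IsSpectralResolution A E)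
    (hF : IsSpectralResolution A F) {a b : ℝ} (hab : a ≤ b) :
    E.proj (Icc a b) = F.proj (Icc a b) := by
  obtain ⟨c, r, hr, rfl, rfl⟩ : ∃ c r : ℝ, 0 ≤ r ∧ a = c - r ∧ b = c + r :=
    ⟨(a + b) / 2, (b - a) / 2, by linarith, by ring, by ring⟩
  have hI : MeasurableSet (Icc (c - r) (c + r)) := measurableSet_Icc
  -- The two inclusions of ranges read FE = E and EF = F. Taking adjoints in the first gives EF = E,
  -- hence E = F.
  have h1 : ∀ u, F.proj (Icc (c - r) (c + r)) (E.proj (Icc (c - r) (c + r)) u) =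
      E.proj (Icc (c - r) (c + r)) u := fun u =>
    hE.proj_Icc_eq_self hF hr _ (by rw [E.proj_proj hI hI, inter_self])
  have h2 : ∀ u, E.proj (Icc (c - r) (c + r)) (F.proj (Icc (c - r) (c + r)) u) =
      F.proj (Icc (c - r) (c + r)) u := fun u =>
    hF.proj_Icc_eq_self hE hr _ (by rw [F.proj_proj hI hI, inter_self])
  ext u
  refine ext_inner_left ℂ fun v => ?_
  rw [← h1 u, ← F.inner_proj_left hI, ← E.inner_proj_left hI, h2, F.inner_proj_left hI]

end IsSpectralResolution

end SpectralUniqueness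

/-! ### Injectivity of the Laplace transform -/

section Laplace

/-- A function whose Laplace transform vanishes at the points `c + n`, `n : ℕ`, vanishes. -/
theorem ae_eq_zero_of_laplace_eq_zero {f : ℝ → ℂ} {c : ℝ}
    (hf : IntegrableOn (fun x => (Real.exp (-(c * x)) : ℂ) * f x) (Ioi 0))
    (h : ∀ n : ℕ, ∫ x in Ioi (0 : ℝ), (Real.exp (-((c + n) * x)) : ℂ) * f x = 0) :
    f =ᵐ[volume.restrict (Ioi (0 : ℝ))] 0 := by
  set g : ℝ → ℂ := fun x => (Real.exp (-(c * x)) : ℂ) * f x with hg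
  have hmul : ∀ n : ℕ, IntegrableOn (fun x => ((Real.exp (-x) ^ n : ℝ) : ℂ) * g x) (Ioi 0) := by
    intro n
    refine Integrable.bdd_mul (c := 1) hf (by fun_prop) ?_
    refine (ae_restrict_iff' measurableSet_Ioi).2 (Filter.Eventually.of_forall fun x hx => ?_)
    rw [Complex.norm_real, Real.norm_of_nonneg (by positivity)]
    exact pow_le_one₀ (Real.exp_pos _).le (Real.exp_le_one_iff.2 (neg_nonpos.2 (le_of_lt hx)))
  have hpow : ∀ n : ℕ, ∫ x in Ioi (0 : ℝ), ((Real.exp (-x) ^ n : ℝ) : ℂ) * g x = 0 := by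
    intro n
    rw [← h n]
    congr 1 with x
    rw [hg, ← mul_assoc, ← Complex.ofReal_mul, ← Real.exp_nat_mul, ← Real.exp_add]
    congr 3
    ring
  -- In the variable u = e^{-x} the hypotheses say that all moments of g vanish. A test function is
  -- continuous in u on [0, 1], so Weierstrass approximation finishes the proof.
  have hpoly : ∀ p : Polynomial ℝ,
      IntegrableOn (fun x => ((p.eval (Real.exp (-x)) : ℝ) : ℂ) * g x) (Ioi 0) ∧
      ∫ x in Ioi (0 : ℝ), ((p.eval (Real.exp (-x)) : ℝ) : ℂ) * g x = 0 := by
    intro p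
    have e : (fun x => ((p.eval (Real.exp (-x)) : ℝ) : ℂ) * g x) = fun x =>
        ∑ i ∈ Finset.range (p.natDegree + 1),
          (p.coeff i : ℂ) * (((Real.exp (-x) ^ i : ℝ) : ℂ) * g x) := by
      funext x
      rw [Polynomial.eval_eq_sum_range, Complex.ofReal_sum, Finset.sum_mul]
      refine Finset.sum_congr rfl fun i _ => ?_
      push_cast
      ring
    rw [e]
    refine ⟨integrable_finsetSum _ fun i _ => (hmul i).const_mul _, ?_⟩
    rw [integral_finsetSum _ fun i _ => (hmul i).const_mul _]
    refine Finset.sum_eq_zero fun i _ => ?_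
    rw [integral_const_mul, hpow, mul_zero]
  have hloc : LocallyIntegrableOn g (Ioi 0) volume := IntegrableOn.locallyIntegrableOn hf
  have hae := isOpen_Ioi.ae_eq_zero_of_integral_contDiff_smul_eq_zero hloc ?_
  · rw [Filter.EventuallyEq, ae_restrict_iff' measurableSet_Ioi]
    filter_upwards [hae] with x hx hx0
    have h1 := hx hx0
    rw [hg] at h1
    exact (mul_eq_zero.1 h1).resolve_left (by exact_mod_cast (Real.exp_pos _).ne')
  intro ψ hψ hcs hsupp
  have hψ0 : ∀ x, x ∉ Ioi (0 : ℝ) → ψ x = 0 := fun x hx =>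
    image_eq_zero_of_notMem_tsupport fun hx' => hx (hsupp hx')
  rw [← setIntegral_eq_integral_of_forall_compl_eq_zero (s := Ioi (0 : ℝ))
    (fun x hx => by rw [hψ0 x hx, zero_smul])]
  obtain ⟨R, hR⟩ := hcs.isCompact.isBounded.subset_closedBall 0
  have hψR : ∀ x, R < x → ψ x = 0 := fun x hx =>
    image_eq_zero_of_notMem_tsupport fun hx' => by
      have := hR hx'
      rw [Metric.mem_closedBall, dist_zero_right, Real.norm_eq_abs] at this
      linarith [le_abs_self x]
  -- The only critical point is u = 0. Near it ψ(-log u) vanishes because ψ has bounded support. At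
  -- u = 0 itself the convention log 0 = 0 gives ψ(0), which is 0 because the support lies in the
  -- open half line.
  have hφ : ContinuousOn (fun u => ψ (-Real.log u)) (Icc 0 1) := by
    intro u hu
    rcases hu.1.eq_or_lt with rfl | hu0
    · have : (fun u => ψ (-Real.log u)) =ᶠ[nhdsWithin 0 (Icc 0 1)] fun _ => 0 := by
        have h1 : Iio (Real.exp (-R)) ∈ nhdsWithin (0 : ℝ) (Icc 0 1) :=
          mem_nhdsWithin_of_mem_nhds (Iio_mem_nhds (Real.exp_pos _))
        filter_upwards [h1, self_mem_nhdsWithin] with v hv hv'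
        rcases hv'.1.eq_or_lt with rfl | hv0
        · rw [Real.log_zero, neg_zero, hψ0 0 (by simp)]
        · refine hψR _ ?_
          have := Real.log_lt_log hv0 hv
          rw [Real.log_exp] at this
          linarith
      refine ContinuousWithinAt.congr_of_eventuallyEq continuousWithinAt_const this ?_
      rw [Real.log_zero, neg_zero, hψ0 0 (by simp)]
    · exact ((hψ.continuous.continuousAt).comp
        (Real.continuousAt_log hu0.ne').neg).continuousWithinAt
  have hψg : IntegrableOn (fun x => (ψ x : ℂ) * g x) (Ioi 0) := by
    obtain ⟨M, hM⟩ := hψ.continuous.bounded_above_of_compact_support hcs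
    refine Integrable.bdd_mul (c := M) hf ?_ (Filter.Eventually.of_forall fun x => ?_)
    · have := hψ.continuous
      fun_prop
    · rw [Complex.norm_real]
      exact hM x
  have hsm : (fun x => ψ x • g x) = fun x => (ψ x : ℂ) * g x := by
    funext x
    rw [Complex.real_smul]
  rw [hsm]
  have hle : ∀ ε > 0, ‖∫ x in Ioi (0 : ℝ), (ψ x : ℂ) * g x‖ ≤ ε * ∫ x in Ioi (0 : ℝ), ‖g x‖ := by
    intro ε hε
    obtain ⟨p, hp⟩ := exists_polynomial_near_of_continuousOn 0 1 _ hφ ε hε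
    have h1 : ∫ x in Ioi (0 : ℝ), (ψ x : ℂ) * g x =
        ∫ x in Ioi (0 : ℝ), ((ψ x : ℂ) * g x - ((p.eval (Real.exp (-x)) : ℝ) : ℂ) * g x) := by
      rw [integral_sub hψg (hpoly p).1, (hpoly p).2, sub_zero]
    rw [h1, ← integral_const_mul]
    refine norm_integral_le_of_norm_le (hf.norm.const_mul ε) ?_
    refine (ae_restrict_iff' measurableSet_Ioi).2 (Filter.Eventually.of_forall fun x hx => ?_)
    have h2 := hp (Real.exp (-x)) ⟨(Real.exp_pos _).le,
      Real.exp_le_one_iff.2 (neg_nonpos.2 (le_of_lt hx))⟩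
    simp only [Real.log_exp, neg_neg] at h2
    rw [← sub_mul, norm_mul, ← Complex.ofReal_sub, Complex.norm_real, Real.norm_eq_abs, abs_sub_comm]
    exact mul_le_mul_of_nonneg_right h2.le (norm_nonneg _)
  have hlim : Filter.Tendsto (fun ε : ℝ => ε * ∫ x in Ioi (0 : ℝ), ‖g x‖)
      (nhdsWithin 0 (Ioi 0)) (nhds 0) := by
    have : Filter.Tendsto (fun ε : ℝ => ε * ∫ x in Ioi (0 : ℝ), ‖g x‖) (nhds 0)
        (nhds (0 * ∫ x in Ioi (0 : ℝ), ‖g x‖)) := Filter.tendsto_id.mul_const _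
    rw [zero_mul] at this
    exact this.mono_left nhdsWithin_le_nhds
  have := ge_of_tendsto hlim (Filter.eventually_of_mem self_mem_nhdsWithin fun ε hε => hle ε hε)
  exact norm_le_zero_iff.1 this

end Laplace

/-! ### Rational integrals over the half line -/

section RationalIntegrals

/-- For a nonnegative derivative, convergence of the antiderivative at infinity already implies
integrability. -/
theorem integrable_and_integral_of_antideriv {g g' : ℝ → ℝ} {l : ℝ}
    (hd : ∀ x, HasDerivAt g (g' x) x) (h0 : ∀ x, 0 ≤ g' x) (hg : g 0 = 0)
    (hl : Filter.Tendsto g Filter.atTop (nhds l)) :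
    IntegrableOn g' (Ioi 0) ∧ ∫ x in Ioi (0 : ℝ), g' x = l := by
  have h1 := integrableOn_Ioi_deriv_of_nonneg' (a := 0) (fun x _ => hd x) (fun x _ => h0 x) hl
  refine ⟨h1, ?_⟩
  rw [integral_Ioi_of_hasDerivAt_of_tendsto (hd 0).continuousAt.continuousWithinAt
    (fun x _ => hd x) h1 hl, hg, sub_zero]

theorem tendsto_arctan_div {s : ℝ} (hs : 0 < s) :
    Filter.Tendsto (fun x => Real.arctan (x / s)) Filter.atTop (nhds (Real.pi / 2)) :=
  (tendsto_nhds_of_tendsto_nhdsWithin Real.tendsto_arctan_atTop).comp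
    (Filter.tendsto_id.atTop_div_const hs)

theorem tendsto_div_sq_add_sq {s : ℝ} (hs : 0 < s) :
    Filter.Tendsto (fun x : ℝ => x / (s ^ 2 + x ^ 2)) Filter.atTop (nhds 0) := by
  refine squeeze_zero' (g := fun x => x⁻¹) ?_ ?_ tendsto_inv_atTop_zero
  · filter_upwards [Filter.eventually_gt_atTop 0] with x hx
    positivity
  · filter_upwards [Filter.eventually_gt_atTop 0] with x hx
    rw [inv_eq_one_div, div_le_div_iff₀ (by positivity) hx]
    nlinarith [sq_nonneg s]

theorem hasDerivAt_arctan_div {s : ℝ} (hs : 0 < s) (x : ℝ) :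
    HasDerivAt (fun x => Real.arctan (x / s)) (s / (s ^ 2 + x ^ 2)) x := by
  have h := ((hasDerivAt_id x).div_const s).arctan
  refine h.congr_deriv ?_
  simp only [id]
  field_simp

theorem hasDerivAt_inv_sq_add_sq {s : ℝ} (hs : 0 < s) (x : ℝ) :
    HasDerivAt (fun x : ℝ => (s ^ 2 + x ^ 2)⁻¹) (-(2 * x) / (s ^ 2 + x ^ 2) ^ 2) x := by
  have h1 : HasDerivAt (fun x : ℝ => s ^ 2 + x ^ 2) (2 * x) x := by
    simpa using (hasDerivAt_pow 2 x).const_add (s ^ 2)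
  exact h1.inv (by positivity)

theorem integral_inv_sq_add_sq {s : ℝ} (hs : 0 < s) :
    IntegrableOn (fun x : ℝ => (s ^ 2 + x ^ 2)⁻¹) (Ioi 0) ∧
    ∫ x in Ioi (0 : ℝ), (s ^ 2 + x ^ 2)⁻¹ = Real.pi / (2 * s) := by
  refine integrable_and_integral_of_antideriv (g := fun x => s⁻¹ * Real.arctan (x / s))
    (fun x => ?_) (fun x => by positivity) (by simp) ?_
  · refine ((hasDerivAt_arctan_div hs x).const_mul s⁻¹).congr_deriv ?_
    field_simp
  · convert (tendsto_arctan_div hs).const_mul s⁻¹ using 2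
    field_simp

theorem integral_inv_sq_add_sq_sq {s : ℝ} (hs : 0 < s) :
    IntegrableOn (fun x : ℝ => (s ^ 2 + x ^ 2)⁻¹ * (s ^ 2 + x ^ 2)⁻¹) (Ioi 0) ∧
    ∫ x in Ioi (0 : ℝ), (s ^ 2 + x ^ 2)⁻¹ * (s ^ 2 + x ^ 2)⁻¹ = Real.pi / (2 * s * s * (s + s)) := by
  refine integrable_and_integral_of_antideriv
    (g := fun x => (2 * s ^ 2)⁻¹ * (x * (s ^ 2 + x ^ 2)⁻¹ + s⁻¹ * Real.arctan (x / s)))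
    (fun x => ?_) (fun x => by positivity) (by simp) ?_
  · refine ((((hasDerivAt_id x).mul (hasDerivAt_inv_sq_add_sq hs x)).add
      ((hasDerivAt_arctan_div hs x).const_mul s⁻¹)).const_mul _).congr_deriv ?_
    simp only [id]
    field_simp
    ring
  · have h := ((tendsto_div_sq_add_sq hs).add
      ((tendsto_arctan_div hs).const_mul s⁻¹)).const_mul (2 * s ^ 2)⁻¹
    simp only [div_eq_mul_inv _ (s ^ 2 + _)] at h
    convert h using 2
    field_simp
    ring

/-- Partial fractions for s ≠ t. They degenerate at s = t, where an explicit antiderivative takes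
over. -/
theorem integral_inv_sq_add_sq_mul {s t : ℝ} (hs : 0 < s) (ht : 0 < t) :
    IntegrableOn (fun x : ℝ => (s ^ 2 + x ^ 2)⁻¹ * (t ^ 2 + x ^ 2)⁻¹) (Ioi 0) ∧
    ∫ x in Ioi (0 : ℝ), (s ^ 2 + x ^ 2)⁻¹ * (t ^ 2 + x ^ 2)⁻¹ =
      Real.pi / (2 * s * t * (s + t)) := by
  rcases eq_or_ne s t with rfl | hst
  · exact integral_inv_sq_add_sq_sq hs
  have hne : t ^ 2 - s ^ 2 ≠ 0 := by
    rw [sq_sub_sq]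
    exact mul_ne_zero (by positivity) (sub_ne_zero.2 hst.symm)
  have e : (fun x : ℝ => (s ^ 2 + x ^ 2)⁻¹ * (t ^ 2 + x ^ 2)⁻¹) = fun x =>
      (t ^ 2 - s ^ 2)⁻¹ * ((s ^ 2 + x ^ 2)⁻¹ - (t ^ 2 + x ^ 2)⁻¹) := by
    funext x
    have h1 : s ^ 2 + x ^ 2 ≠ 0 := by positivity
    have h2 : t ^ 2 + x ^ 2 ≠ 0 := by positivity
    field_simp
    ring
  obtain ⟨i1, j1⟩ := integral_inv_sq_add_sq hs
  obtain ⟨i2, j2⟩ := integral_inv_sq_add_sq ht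
  rw [e]
  refine ⟨(i1.sub i2).const_mul _, ?_⟩
  rw [integral_const_mul, integral_sub i1 i2, j1, j2]
  have h3 : t - s ≠ 0 := sub_ne_zero.2 hst.symm
  have h4 : s + t ≠ 0 := by positivity
  rw [show t ^ 2 - s ^ 2 = (t - s) * (s + t) by ring]
  field_simp

theorem integral_sq_mul_inv_mul {s t : ℝ} (hs : 0 < s) (ht : 0 < t) :
    IntegrableOn (fun x : ℝ => x ^ 2 * ((s ^ 2 + x ^ 2)⁻¹ * (t ^ 2 + x ^ 2)⁻¹)) (Ioi 0) ∧
    ∫ x in Ioi (0 : ℝ), x ^ 2 * ((s ^ 2 + x ^ 2)⁻¹ * (t ^ 2 + x ^ 2)⁻¹) =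
      Real.pi / 2 * (1 / (s + t)) := by
  have e : (fun x : ℝ => x ^ 2 * ((s ^ 2 + x ^ 2)⁻¹ * (t ^ 2 + x ^ 2)⁻¹)) = fun x =>
      (s ^ 2 + x ^ 2)⁻¹ - t ^ 2 * ((s ^ 2 + x ^ 2)⁻¹ * (t ^ 2 + x ^ 2)⁻¹) := by
    funext x
    have h1 : s ^ 2 + x ^ 2 ≠ 0 := by positivity
    have h2 : t ^ 2 + x ^ 2 ≠ 0 := by positivity
    field_simp
    ring
  obtain ⟨i1, j1⟩ := integral_inv_sq_add_sq hs
  obtain ⟨i2, j2⟩ := integral_inv_sq_add_sq_mul hs ht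
  rw [e]
  refine ⟨i1.sub (i2.const_mul _), ?_⟩
  rw [integral_sub i1 (i2.const_mul _), integral_const_mul, j1, j2]
  have h4 : s + t ≠ 0 := by positivity
  field_simp
  ring

theorem integral_sq_mul_inv_cube {s : ℝ} (hs : 0 < s) :
    IntegrableOn (fun x : ℝ => x ^ 2 *
      ((s ^ 2 + x ^ 2)⁻¹ * (s ^ 2 + x ^ 2)⁻¹ * (s ^ 2 + x ^ 2)⁻¹)) (Ioi 0) ∧
    ∫ x in Ioi (0 : ℝ), x ^ 2 * ((s ^ 2 + x ^ 2)⁻¹ * (s ^ 2 + x ^ 2)⁻¹ * (s ^ 2 + x ^ 2)⁻¹) =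
      Real.pi / 2 * (1 / ((s + s) * (s + s) * (s + s))) := by
  refine integrable_and_integral_of_antideriv
    (g := fun x => (8 * s ^ 2)⁻¹ * (x * (s ^ 2 + x ^ 2)⁻¹) +
      (8 * s ^ 3)⁻¹ * Real.arctan (x / s) -
      4⁻¹ * (x * (s ^ 2 + x ^ 2)⁻¹ * (s ^ 2 + x ^ 2)⁻¹))
    (fun x => ?_) (fun x => by positivity) (by simp) ?_
  · have hx := (hasDerivAt_id x).mul (hasDerivAt_inv_sq_add_sq hs x)
    refine (((hx.const_mul _).add ((hasDerivAt_arctan_div hs x).const_mul _)).sub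
      ((hx.mul (hasDerivAt_inv_sq_add_sq hs x)).const_mul _)).congr_deriv ?_
    simp only [id, Pi.mul_apply]
    field_simp
    ring
  · have h5 : Filter.Tendsto (fun x : ℝ => (s ^ 2 + x ^ 2)⁻¹) Filter.atTop (nhds 0) := by
      refine tendsto_inv_atTop_zero.comp (Filter.tendsto_atTop_add_const_left _ _ ?_)
      exact Filter.tendsto_pow_atTop (by norm_num)
    have h := (((tendsto_div_sq_add_sq hs).const_mul (8 * s ^ 2)⁻¹).add
      ((tendsto_arctan_div hs).const_mul (8 * s ^ 3)⁻¹)).sub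
      (((tendsto_div_sq_add_sq hs).mul h5).const_mul 4⁻¹)
    simp only [div_eq_mul_inv _ (s ^ 2 + _)] at h
    convert h using 2
    field_simp
    ring

/-- Multiplied by (s+k)(t+k) the value no longer depends on k; this is why the Robin functions have
the same Gram matrix as the sines. Partial fractions in s and k work for s ≠ k, symmetry in s and t
covers t ≠ k, and the triple pole and k = 0 are separate. -/
theorem integral_sq_mul_inv_mul_mul {s t k : ℝ} (hs : 0 < s) (ht : 0 < t) (hk : 0 ≤ k) :
    IntegrableOn (fun x : ℝ => x ^ 2 *
      ((s ^ 2 + x ^ 2)⁻¹ * (t ^ 2 + x ^ 2)⁻¹ * (k ^ 2 + x ^ 2)⁻¹)) (Ioi 0) ∧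
    ∫ x in Ioi (0 : ℝ), x ^ 2 * ((s ^ 2 + x ^ 2)⁻¹ * (t ^ 2 + x ^ 2)⁻¹ * (k ^ 2 + x ^ 2)⁻¹) =
      Real.pi / 2 * (1 / ((s + t) * (s + k) * (t + k))) := by
  rcases hk.eq_or_lt with rfl | hk0
  · obtain ⟨i, j⟩ := integral_inv_sq_add_sq_mul hs ht
    have e : EqOn (fun x : ℝ => x ^ 2 *
        ((s ^ 2 + x ^ 2)⁻¹ * (t ^ 2 + x ^ 2)⁻¹ * (0 ^ 2 + x ^ 2)⁻¹))
        (fun x => (s ^ 2 + x ^ 2)⁻¹ * (t ^ 2 + x ^ 2)⁻¹) (Ioi 0) := by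
      intro x hx
      have : x ≠ 0 := (show (0 : ℝ) < x from hx).ne'
      simp only [ne_eq, OfNat.ofNat_ne_zero, not_false_eq_true, zero_pow, zero_add]
      field_simp
    refine ⟨i.congr_fun e.symm measurableSet_Ioi, ?_⟩
    rw [setIntegral_congr_fun measurableSet_Ioi e, j]
    field_simp
    ring
  have key : ∀ {s t : ℝ}, 0 < s → 0 < t → s ≠ k → IntegrableOn (fun x : ℝ => x ^ 2 *
      ((s ^ 2 + x ^ 2)⁻¹ * (t ^ 2 + x ^ 2)⁻¹ * (k ^ 2 + x ^ 2)⁻¹)) (Ioi 0) ∧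
    ∫ x in Ioi (0 : ℝ), x ^ 2 * ((s ^ 2 + x ^ 2)⁻¹ * (t ^ 2 + x ^ 2)⁻¹ * (k ^ 2 + x ^ 2)⁻¹) =
      Real.pi / 2 * (1 / ((s + t) * (s + k) * (t + k))) := by
    intro s t hs ht hsk
    have hne : s ^ 2 - k ^ 2 ≠ 0 := by
      rw [sq_sub_sq]
      exact mul_ne_zero (by positivity) (sub_ne_zero.2 hsk)
    have e : (fun x : ℝ => x ^ 2 *
        ((s ^ 2 + x ^ 2)⁻¹ * (t ^ 2 + x ^ 2)⁻¹ * (k ^ 2 + x ^ 2)⁻¹)) = fun x =>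
        (s ^ 2 - k ^ 2)⁻¹ * (s ^ 2 * ((s ^ 2 + x ^ 2)⁻¹ * (t ^ 2 + x ^ 2)⁻¹) -
          k ^ 2 * ((k ^ 2 + x ^ 2)⁻¹ * (t ^ 2 + x ^ 2)⁻¹)) := by
      funext x
      have h1 : s ^ 2 + x ^ 2 ≠ 0 := by positivity
      have h2 : t ^ 2 + x ^ 2 ≠ 0 := by positivity
      have h3 : k ^ 2 + x ^ 2 ≠ 0 := by positivity
      field_simp
      ring
    obtain ⟨i1, j1⟩ := integral_inv_sq_add_sq_mul hs ht
    obtain ⟨i2, j2⟩ := integral_inv_sq_add_sq_mul hk0 ht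
    rw [e]
    refine ⟨((i1.const_mul _).sub (i2.const_mul _)).const_mul _, ?_⟩
    rw [integral_const_mul, integral_sub (i1.const_mul _) (i2.const_mul _), integral_const_mul,
      integral_const_mul, j1, j2]
    have h3 : s - k ≠ 0 := sub_ne_zero.2 hsk
    rw [show s ^ 2 - k ^ 2 = (s - k) * (s + k) by ring]
    field_simp
    ring
  by_cases h1 : s = k
  · by_cases h2 : t = k
    · subst h1
      subst h2
      exact integral_sq_mul_inv_cube hs
    · have h := key ht hs h2
      have e : ∀ x : ℝ, x ^ 2 * ((s ^ 2 + x ^ 2)⁻¹ * (t ^ 2 + x ^ 2)⁻¹ * (k ^ 2 + x ^ 2)⁻¹) =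
          x ^ 2 * ((t ^ 2 + x ^ 2)⁻¹ * (s ^ 2 + x ^ 2)⁻¹ * (k ^ 2 + x ^ 2)⁻¹) := fun x => by ring
      simp only [e]
      refine ⟨h.1, h.2.trans ?_⟩
      rw [add_comm t s]
      ring
  · exact key hs ht h1

end RationalIntegrals

/-! ### Cosine transform and injectivity of the Stieltjes transform -/

section CosineTransform

open FourierTransform

/-- Fubini: a bounded kernel times a product of two integrable functions is integrable on the
product. Cosines and truncated exponentials are the kernels to which it is applied. -/
theorem integral_mul_integral_swap {μ ν : Measure ℝ} [SFinite μ] [SFinite ν] {f g : ℝ → ℂ}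
    (hf : Integrable f μ) (hg : Integrable g ν) {K : ℝ → ℝ → ℂ}
    (hK : Measurable (Function.uncurry K)) {C : ℝ} (hC : ∀ x y, ‖K x y‖ ≤ C) :
    ∫ x, f x * ∫ y, K x y * g y ∂ν ∂μ = ∫ y, g y * ∫ x, K x y * f x ∂μ ∂ν := by
  have hint : Integrable (Function.uncurry fun x y => K x y * (f x * g y)) (μ.prod ν) := by
    refine Integrable.bdd_mul (f := Function.uncurry K) (c := C) (hf.mul_prod hg)
      hK.aestronglyMeasurable (Filter.Eventually.of_forall fun z => hC _ _)
  have h1 : ∀ x, f x * ∫ y, K x y * g y ∂ν = ∫ y, K x y * (f x * g y) ∂ν := fun x => by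
    rw [← integral_const_mul]
    congr 1 with y
    ring
  have h2 : ∀ y, g y * ∫ x, K x y * f x ∂μ = ∫ x, K x y * (f x * g y) ∂μ := fun y => by
    rw [← integral_const_mul]
    congr 1 with x
    ring
  simp only [h1, h2]
  exact integral_integral_swap hint

theorem integral_eq_integral_Ioi_add_neg {f : ℝ → ℂ} (hf : Integrable f) :
    ∫ x, f x = ∫ x in Ioi (0 : ℝ), (f x + f (-x)) := by
  rw [integral_add hf.integrableOn hf.comp_neg.integrableOn, integral_comp_neg_Ioi, neg_zero,
    add_comm, intervalIntegral.integral_Iic_add_Ioi hf.integrableOn hf.integrableOn]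

theorem integrable_cos_mul {φ : ℝ → ℂ} {μ : Measure ℝ} (hφ : Integrable φ μ) (ω : ℝ) :
    Integrable (fun t => (Real.cos (ω * t) : ℂ) * φ t) μ :=
  Integrable.bdd_mul (c := 1) hφ (by fun_prop) (Filter.Eventually.of_forall fun t => by
    rw [Complex.norm_real]
    exact Real.abs_cos_le_one _)

/-- The Fourier integral of an even function is a cosine integral over the half line. -/
theorem integral_exp_mul_even {φ : ℝ → ℂ} (hφ : Integrable φ) (he : ∀ t, φ (-t) = φ t) (ω : ℝ) :
    ∫ t, Complex.exp ((ω * t : ℝ) * Complex.I) * φ t =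
      2 * ∫ t in Ioi (0 : ℝ), (Real.cos (ω * t) : ℂ) * φ t := by
  have hi : Integrable fun t => Complex.exp ((ω * t : ℝ) * Complex.I) * φ t :=
    Integrable.bdd_mul (c := 1) hφ (by fun_prop) (Filter.Eventually.of_forall fun t => by
      rw [Complex.norm_exp_ofReal_mul_I])
  rw [integral_eq_integral_Ioi_add_neg hi, ← integral_const_mul]
  congr 1 with t
  rw [he, mul_neg, Complex.ofReal_neg, Complex.ofReal_cos, Complex.cos, neg_mul]
  ring

/-- The cosine transform. -/
noncomputable def cosTransform (φ : ℝ → ℂ) (ω : ℝ) : ℂ :=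
  ∫ t in Ioi (0 : ℝ), (Real.cos (ω * t) : ℂ) * φ t

theorem cosTransform_neg (φ : ℝ → ℂ) (ω : ℝ) : cosTransform φ (-ω) = cosTransform φ ω := by
  simp [cosTransform, neg_mul, Real.cos_neg]

theorem fourier_eq_cosTransform (φ : SchwartzMap ℝ ℂ) (he : ∀ t, φ (-t) = φ t) (ξ : ℝ) :
    𝓕 φ ξ = 2 * cosTransform φ (2 * Real.pi * ξ) := by
  rw [SchwartzMap.fourier_coe, Real.fourier_eq', cosTransform,
    ← integral_exp_mul_even φ.integrable he,
    ← integral_neg_eq_self (fun t => Complex.exp ((2 * Real.pi * ξ * t : ℝ) * Complex.I) * φ t)]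
  congr 1 with t
  simp only [RCLike.inner_apply, conj_trivial, smul_eq_mul, he]
  congr 3
  push_cast
  ring

/-- For even φ it is a rescaled Fourier transform, hence that of a Schwartz function. -/
theorem integrable_cosTransform (φ : SchwartzMap ℝ ℂ) (he : ∀ t, φ (-t) = φ t) :
    Integrable (cosTransform φ) := by
  have h := (𝓕 φ).integrable (μ := volume)
  have h1 : Integrable fun ω : ℝ => 𝓕 φ (ω * (2 * Real.pi)⁻¹) :=
    h.comp_mul_right' (by positivity)
  refine (h1.const_mul (1 / 2)).congr (Filter.Eventually.of_forall fun ω => ?_)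
  simp only
  rw [fourier_eq_cosTransform φ he]
  have : 2 * Real.pi * (ω * (2 * Real.pi)⁻¹) = ω := by field_simp
  rw [this]
  ring

/-- Inversion of the cosine transform. -/
theorem cosTransform_cosTransform (φ : SchwartzMap ℝ ℂ) (he : ∀ t, φ (-t) = φ t) (t : ℝ) :
    φ t = (2 / Real.pi : ℝ) * cosTransform (cosTransform φ) t := by
  have h1 : φ t = 𝓕⁻ (⇑(𝓕 φ : SchwartzMap ℝ ℂ)) t := by
    have h0 : 𝓕⁻ (𝓕 φ) = φ := fourierInv_fourier_eq φ
    rw [← SchwartzMap.fourierInv_coe, h0]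
  have he2 : ∀ ξ, 𝓕 φ (-ξ) = 𝓕 φ ξ := by
    intro ξ
    rw [fourier_eq_cosTransform φ he, fourier_eq_cosTransform φ he, mul_neg, cosTransform_neg]
  have h2 : 𝓕⁻ (⇑(𝓕 φ : SchwartzMap ℝ ℂ)) t =
      ∫ ξ, Complex.exp ((2 * Real.pi * t * ξ : ℝ) * Complex.I) * 𝓕 φ ξ := by
    rw [Real.fourierInv_eq']
    congr 1 with ξ
    simp only [RCLike.inner_apply, conj_trivial, smul_eq_mul]
    congr 3
    push_cast
    ring
  rw [h1, h2, integral_exp_mul_even (𝓕 φ).integrable he2]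
  have h3 : ∀ ξ : ℝ, (Real.cos (2 * Real.pi * t * ξ) : ℂ) * 𝓕 φ ξ =
      (fun ω => 2 * ((Real.cos (t * ω) : ℂ) * cosTransform φ ω)) (2 * Real.pi * ξ) := by
    intro ξ
    simp only
    rw [fourier_eq_cosTransform φ he]
    have : t * (2 * Real.pi * ξ) = 2 * Real.pi * t * ξ := by ring
    rw [this]
    ring
  rw [setIntegral_congr_fun measurableSet_Ioi fun ξ _ => h3 ξ, integral_comp_mul_left_Ioi
    (fun ω => 2 * ((Real.cos (t * ω) : ℂ) * cosTransform φ ω)) 0 (by positivity), mul_zero, integral_const_mul, cosTransform,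
    Complex.real_smul]
  push_cast
  field_simp

theorem integral_exp_mul_cos_sin {s : ℝ} (hs : 0 < s) (ω : ℝ) :
    (∫ x in Ioi (0 : ℝ), Real.exp (-(s * x)) * Real.cos (ω * x) = s / (s ^ 2 + ω ^ 2)) ∧
    ∫ x in Ioi (0 : ℝ), Real.exp (-(s * x)) * Real.sin (ω * x) = ω / (s ^ 2 + ω ^ 2) := by
  set a : ℂ := -s + ω * Complex.I with ha
  have hre : a.re < 0 := by simp [ha, hs]
  have hi := integrableOn_exp_mul_complex_Ioi hre 0
  have hv := integral_exp_mul_complex_Ioi hre 0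
  have e : ∀ x : ℝ, a * x = ((-(s * x) : ℝ) : ℂ) + ((ω * x : ℝ) : ℂ) * Complex.I := fun x => by
    rw [ha]
    push_cast
    ring
  have hRe : ∀ x : ℝ, (Complex.exp (a * x)).re = Real.exp (-(s * x)) * Real.cos (ω * x) := by
    intro x
    rw [e, Complex.exp_re]
    simp
  have hIm : ∀ x : ℝ, (Complex.exp (a * x)).im = Real.exp (-(s * x)) * Real.sin (ω * x) := by
    intro x
    rw [e, Complex.exp_im]
    simp
  have hns : Complex.normSq a = s ^ 2 + ω ^ 2 := by
    rw [ha, Complex.normSq_apply]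
    simp
    ring
  have h1 := integral_re hi
  have h2 := integral_im hi
  simp only [RCLike.re_eq_complex_re, RCLike.im_eq_complex_im, hRe, hIm] at h1 h2
  rw [h1, h2, hv]
  simp only [Complex.ofReal_zero, mul_zero, Complex.exp_zero, Complex.div_re, Complex.div_im, hns]
  constructor <;> simp [ha, neg_div]

theorem integrableOn_exp_neg_mul {s : ℝ} (hs : 0 < s) :
    IntegrableOn (fun x : ℝ => (Real.exp (-(s * x)) : ℂ)) (Ioi 0) := by
  have h : IntegrableOn (fun x : ℝ => Real.exp (-(s * x))) (Ioi 0) := by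
    simpa [neg_mul] using exp_neg_integrableOn_Ioi 0 hs
  exact h.ofReal

/-- A function whose Stieltjes transform in `ω²` vanishes at the squares of the positive integers
vanishes. -/
theorem ae_eq_zero_of_stieltjes_eq_zero {k : ℝ → ℂ}
    (hk : IntegrableOn (fun ω => (((1 + ω ^ 2)⁻¹ : ℝ) : ℂ) * k ω) (Ioi 0))
    (h : ∀ n : ℕ, ∫ ω in Ioi (0 : ℝ), (((((n : ℝ) + 1) ^ 2 + ω ^ 2)⁻¹ : ℝ) : ℂ) * k ω = 0) :
    k =ᵐ[volume.restrict (Ioi (0 : ℝ))] 0 := by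
  set g : ℝ → ℂ := fun ω => (((1 + ω ^ 2)⁻¹ : ℝ) : ℂ) * k ω with hg
  have h0 : ∫ ω in Ioi (0 : ℝ), g ω = 0 := by simpa [hg] using h 0
  have hbd : ∀ s : ℝ, 1 ≤ s → IntegrableOn (fun ω => (((s ^ 2 + ω ^ 2)⁻¹ : ℝ) : ℂ) * g ω) (Ioi 0) := by
    intro s hs
    refine Integrable.bdd_mul (c := 1) hk (by fun_prop) (Filter.Eventually.of_forall fun ω => ?_)
    rw [Complex.norm_real, Real.norm_of_nonneg (by positivity)]
    exact inv_le_one_of_one_le₀ (by nlinarith [sq_nonneg ω])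
  -- The function k itself need not be integrable, so the hypotheses are transferred to g = k/(1+ω²)
  -- by k/(s²+ω²) = g - (s²-1) g/(s²+ω²), where ∫ g = 0 is the case s = 1. Dividing by s² - 1
  -- requires s ≥ 2, hence the shift.
  have h1 : ∀ n : ℕ, ∫ ω in Ioi (0 : ℝ), ((((2 + (n : ℝ)) ^ 2 + ω ^ 2)⁻¹ : ℝ) : ℂ) * g ω = 0 := by
    intro n
    have h2 := h (n + 1)
    set s : ℝ := 2 + (n : ℝ) with hs
    have hs1 : ((n + 1 : ℕ) : ℝ) + 1 = s := by push_cast; rw [hs]; ring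
    rw [hs1] at h2
    have hs0 : (2 : ℝ) ≤ s := by rw [hs]; linarith [(Nat.cast_nonneg n : (0 : ℝ) ≤ n)]
    have e : ∀ ω : ℝ, (((s ^ 2 + ω ^ 2)⁻¹ : ℝ) : ℂ) * k ω =
        g ω - ((s ^ 2 - 1 : ℝ) : ℂ) * ((((s ^ 2 + ω ^ 2)⁻¹ : ℝ) : ℂ) * g ω) := by
      intro ω
      have p1 : 1 + ω ^ 2 ≠ 0 := by positivity
      have p2 : s ^ 2 + ω ^ 2 ≠ 0 := by positivity
      have : (s ^ 2 + ω ^ 2)⁻¹ = (1 + ω ^ 2)⁻¹ - (s ^ 2 - 1) * ((s ^ 2 + ω ^ 2)⁻¹ * (1 + ω ^ 2)⁻¹) := by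
        field_simp
        ring
      rw [hg]
      conv_lhs => rw [this]
      push_cast
      ring
    simp only [e] at h2
    rw [integral_sub hk ((hbd s (by linarith)).const_mul _), h0, integral_const_mul, zero_sub,
      neg_eq_zero] at h2
    refine (mul_eq_zero.1 h2).resolve_left ?_
    have : s ^ 2 - 1 ≠ 0 := by nlinarith
    exact_mod_cast this
  have hFbd : ∀ x, ‖cosTransform g x‖ ≤ ∫ ω in Ioi (0 : ℝ), ‖g ω‖ := by
    intro x
    refine norm_integral_le_of_norm_le hk.norm (Filter.Eventually.of_forall fun ω => ?_)
    rw [norm_mul, Complex.norm_real]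
    exact mul_le_of_le_one_left (norm_nonneg _) (Real.abs_cos_le_one _)
  have hFc : Continuous (cosTransform g) := by
    refine continuous_of_dominated (bound := fun ω => ‖g ω‖) (fun x => ?_) (fun x => ?_) hk.norm ?_
    · exact (integrable_cos_mul hk x).aestronglyMeasurable
    · refine Filter.Eventually.of_forall fun ω => ?_
      rw [norm_mul, Complex.norm_real]
      exact mul_le_of_le_one_left (norm_nonneg _) (Real.abs_cos_le_one _)
    · refine Filter.Eventually.of_forall fun ω => ?_
      fun_prop
  -- By Fubini the Laplace transform of the cosine transform of g at s is s ∫ g/(s²+ω²), which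
  -- vanishes at s = 2, 3, ….
  have hF : cosTransform g =ᵐ[volume.restrict (Ioi (0 : ℝ))] 0 := by
    refine ae_eq_zero_of_laplace_eq_zero (c := 2) ?_ fun n => ?_
    · refine Integrable.mul_bdd (c := ∫ ω in Ioi (0 : ℝ), ‖g ω‖)
        (integrableOn_exp_neg_mul two_pos) hFc.aestronglyMeasurable
        (Filter.Eventually.of_forall hFbd)
    · have hn : (0 : ℝ) < 2 + n := by positivity
      have h3 := integral_mul_integral_swap (f := g) (K := fun x y => (Real.cos (x * y) : ℂ)) (C := 1)
        (μ := volume.restrict (Ioi (0 : ℝ))) (ν := volume.restrict (Ioi (0 : ℝ)))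
        hk (integrableOn_exp_neg_mul hn) (by fun_prop) (fun x y => by
          rw [Complex.norm_real]
          exact Real.abs_cos_le_one _)
      have h4 : ∀ ω : ℝ, ∫ x in Ioi (0 : ℝ), (Real.cos (ω * x) : ℂ) *
          (Real.exp (-((2 + (n : ℝ)) * x)) : ℂ) =
          ((2 + (n : ℝ) : ℝ) : ℂ) * ((((2 + (n : ℝ)) ^ 2 + ω ^ 2)⁻¹ : ℝ) : ℂ) := by
        intro ω
        rw [← Complex.ofReal_mul, ← div_eq_mul_inv, ← (integral_exp_mul_cos_sin hn ω).1,
          ← integral_complex_ofReal]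
        congr 1 with x
        push_cast
        ring
      simp only [h4] at h3
      calc _ = ∫ y in Ioi (0 : ℝ), (Real.exp (-((2 + (n : ℝ)) * y)) : ℂ) *
            ∫ x in Ioi (0 : ℝ), (Real.cos (x * y) : ℂ) * g x := by
              congr 1 with y
              rw [cosTransform]
              simp only [mul_comm y]
        _ = _ := h3.symm
        _ = ((2 + (n : ℝ) : ℝ) : ℂ) * ∫ x in Ioi (0 : ℝ),
              ((((2 + (n : ℝ)) ^ 2 + x ^ 2)⁻¹ : ℝ) : ℂ) * g x := by
              rw [← integral_const_mul]
              congr 1 with x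
              ring
        _ = 0 := by rw [h1, mul_zero]
  have hloc : LocallyIntegrableOn g (Ioi 0) volume := IntegrableOn.locallyIntegrableOn hk
  have hae := isOpen_Ioi.ae_eq_zero_of_integral_contDiff_smul_eq_zero hloc ?_
  · rw [Filter.EventuallyEq, ae_restrict_iff' measurableSet_Ioi]
    filter_upwards [hae] with x hx hx0
    have h1 := hx hx0
    rw [hg] at h1
    refine (mul_eq_zero.1 h1).resolve_left ?_
    have : (1 + x ^ 2)⁻¹ ≠ 0 := by positivity
    exact_mod_cast this
  intro ψ hψ hcs hsupp
  have hψ0 : ∀ x, x ∉ Ioi (0 : ℝ) → ψ x = 0 := fun x hx =>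
    image_eq_zero_of_notMem_tsupport fun hx' => hx (hsupp hx')
  rw [← setIntegral_eq_integral_of_forall_compl_eq_zero (s := Ioi (0 : ℝ))
    (fun x hx => by rw [hψ0 x hx, zero_smul])]
  have hcs2 : HasCompactSupport fun x => ((ψ x + ψ (-x) : ℝ) : ℂ) := by
    have h5 : HasCompactSupport fun x => ψ (-x) := hcs.comp_homeomorph (Homeomorph.neg ℝ)
    exact (hcs.add h5).comp_left (g := Complex.ofReal) Complex.ofReal_zero
  have hcd2 : ContDiff ℝ (⊤ : ℕ∞) fun x => ((ψ x + ψ (-x) : ℝ) : ℂ) :=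
    Complex.ofRealCLM.contDiff.comp (hψ.add (hψ.comp contDiff_neg))
  -- The even extension of the test function: it agrees with ψ on the half line and is a
  -- superposition of cosines by inversion, so its pairing with g is an integral of the vanishing
  -- cosine transform of g.
  let Ψ : SchwartzMap ℝ ℂ := hcs2.toSchwartzMap hcd2
  have hΨ : ∀ x, Ψ x = ((ψ x + ψ (-x) : ℝ) : ℂ) := fun x => rfl
  have hΨe : ∀ x, Ψ (-x) = Ψ x := fun x => by
    rw [hΨ, hΨ, neg_neg, add_comm]
  have h6 : ∫ x in Ioi (0 : ℝ), ψ x • g x = ∫ x in Ioi (0 : ℝ), g x * Ψ x := by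
    refine setIntegral_congr_fun measurableSet_Ioi fun x hx => ?_
    have hx' : -x ∉ Ioi (0 : ℝ) := fun h7 => by
      have h8 : (0 : ℝ) < x := hx
      have h9 : (0 : ℝ) < -x := h7
      linarith
    rw [hΨ, hψ0 _ hx', add_zero, Complex.real_smul, mul_comm]
  have h7 := integral_mul_integral_swap (f := g) (g := cosTransform Ψ)
    (K := fun x y => (Real.cos (x * y) : ℂ)) (C := 1)
    (μ := volume.restrict (Ioi (0 : ℝ))) (ν := volume.restrict (Ioi (0 : ℝ)))
    hk (integrable_cosTransform Ψ hΨe).integrableOn (by fun_prop) (fun x y => by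
      rw [Complex.norm_real]
      exact Real.abs_cos_le_one _)
  rw [h6]
  have h8 : ∫ x in Ioi (0 : ℝ), g x * Ψ x = ((2 / Real.pi : ℝ) : ℂ) *
      ∫ x in Ioi (0 : ℝ), g x * ∫ y in Ioi (0 : ℝ), (Real.cos (x * y) : ℂ) * cosTransform Ψ y := by
    rw [← integral_const_mul]
    congr 1 with x
    rw [cosTransform_cosTransform Ψ hΨe x, cosTransform]
    ring
  rw [h8, h7]
  have h9 : ∫ y in Ioi (0 : ℝ), cosTransform Ψ y * ∫ x in Ioi (0 : ℝ), (Real.cos (x * y) : ℂ) * g x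
      = 0 := by
    refine integral_eq_zero_of_ae ?_
    filter_upwards [hF] with y hy
    have : ∫ x in Ioi (0 : ℝ), (Real.cos (x * y) : ℂ) * g x = cosTransform g y := by
      rw [cosTransform]
      simp only [mul_comm y]
    rw [this, hy]
    simp
  rw [h9, mul_zero]

end CosineTransform

/-! ### Total families with equal Gram matrices -/

section Gram

variable {H ι : Type*} [NormedAddCommGroup H] [InnerProductSpace ℂ H] [CompleteSpace H]

theorem denseRange_linearCombination {v : ι → H} (hv : ∀ u : H, (∀ i, ⟪v i, u⟫_ℂ = 0) → u = 0) :
    DenseRange (Finsupp.linearCombination ℂ v) := by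
  have h1 : (Submodule.span ℂ (range v)).topologicalClosure = ⊤ := by
    rw [Submodule.topologicalClosure_eq_top_iff, Submodule.eq_bot_iff]
    intro u hu
    exact hv u fun i => (Submodule.mem_orthogonal _ _).1 hu _ (Submodule.subset_span ⟨i, rfl⟩)
  rw [DenseRange, ← LinearMap.coe_range, Finsupp.range_linearCombination]
  exact Submodule.dense_iff_topologicalClosure_eq_top.2 h1

/-- Two total families with the same Gram matrix are unitarily equivalent. -/
theorem exists_linearIsometryEquiv_of_inner_eq {v w : ι → H}
    (hv : ∀ u : H, (∀ i, ⟪v i, u⟫_ℂ = 0) → u = 0) (hw : ∀ u : H, (∀ i, ⟪w i, u⟫_ℂ = 0) → u = 0)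
    (h : ∀ i j, ⟪v i, v j⟫_ℂ = ⟪w i, w j⟫_ℂ) : ∃ U : H ≃ₗᵢ[ℂ] H, ∀ i, U (v i) = w i := by
  -- Equality of the Gram matrices makes the norms of corresponding linear combinations equal, so
  -- the assignment is well defined and isometric on a dense subspace, with dense image.
  have hin : ∀ c : ι →₀ ℂ, ‖Finsupp.linearCombination ℂ w c‖ = ‖Finsupp.linearCombination ℂ v c‖ := by
    intro c
    have : ⟪Finsupp.linearCombination ℂ w c, Finsupp.linearCombination ℂ w c⟫_ℂ =
        ⟪Finsupp.linearCombination ℂ v c, Finsupp.linearCombination ℂ v c⟫_ℂ := by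
      simp only [Finsupp.linearCombination_apply, Finsupp.sum, sum_inner, inner_sum,
        inner_smul_left, inner_smul_right, h]
    rw [inner_self_eq_norm_sq_to_K, inner_self_eq_norm_sq_to_K] at this
    have h2 : ‖Finsupp.linearCombination ℂ w c‖ ^ 2 = ‖Finsupp.linearCombination ℂ v c‖ ^ 2 := by
      exact_mod_cast this
    exact (sq_eq_sq₀ (norm_nonneg _) (norm_nonneg _)).1 h2
  let U := (LinearEquiv.refl ℂ (ι →₀ ℂ)).extendOfIsometry (Finsupp.linearCombination ℂ v)
    (Finsupp.linearCombination ℂ w) (denseRange_linearCombination hv)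
    (denseRange_linearCombination hw) hin
  refine ⟨U, fun i => ?_⟩
  have h1 := LinearEquiv.extendOfIsometry_eq (LinearEquiv.refl ℂ (ι →₀ ℂ))
    (Finsupp.linearCombination ℂ v)
    (Finsupp.linearCombination ℂ w) (denseRange_linearCombination hv)
    (denseRange_linearCombination hw) hin (Finsupp.single i 1)
  simpa using h1

end Gram

/-! ### Generalized eigenfunctions and the unitary eigenfunction transform -/

section Transform

/-- The matrix that acts as `a` on the vectors of sum zero and as `b` on the constant vectors. -/
noncomputable def edgeMix (N : ℕ) (a b : ℝ) (k j : Fin N) : ℝ :=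
  ((if k = j then 1 else 0) - (N : ℝ)⁻¹) * a + (N : ℝ)⁻¹ * b

variable {N : ℕ}

theorem edgeMix_comm (a b : ℝ) (k j : Fin N) : edgeMix N a b k j = edgeMix N a b j k := by
  simp only [edgeMix, eq_comm]

theorem sum_edgeMix_mul (a b : ℝ) (g : Fin N → ℂ) (j : Fin N) :
    ∑ k, (edgeMix N a b k j : ℂ) * g k =
      a * (g j - (N : ℂ)⁻¹ * ∑ k, g k) + b * ((N : ℂ)⁻¹ * ∑ k, g k) := by
  have e : ∀ k, (edgeMix N a b k j : ℂ) * g k =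
      a * (if k = j then g k else 0) + (b - a) * (N : ℂ)⁻¹ * g k := by
    intro k
    rw [edgeMix]
    split_ifs <;> push_cast <;> ring
  simp only [e, Finset.sum_add_distrib, ← Finset.mul_sum, Finset.sum_ite_eq', Finset.mem_univ,
    if_true]
  ring

/-- The matrices I - J/N and J/N, with J the matrix of ones, are complementary symmetric
projections, so products are formed coefficientwise. -/
theorem sum_edgeMix_mul_edgeMix (hN : 0 < N) (a b a' b' : ℝ) (j l : Fin N) :
    ∑ k, edgeMix N a b k j * edgeMix N a' b' k l = edgeMix N (a * a') (b * b') j l := by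
  have hN' : (N : ℝ) ≠ 0 := by positivity
  have e : ∀ k, edgeMix N a b k j * edgeMix N a' b' k l =
      (if k = j then (if k = l then a * a' else 0) else 0) +
      (if k = j then (N : ℝ)⁻¹ * (a * (b' - a')) else 0) +
      (if k = l then (N : ℝ)⁻¹ * (a' * (b - a)) else 0) +
      (N : ℝ)⁻¹ * (N : ℝ)⁻¹ * ((b - a) * (b' - a')) := by
    intro k
    simp only [edgeMix]
    split_ifs <;> ring
  rw [Finset.sum_congr rfl fun k _ => e k]
  simp only [Finset.sum_add_distrib, Finset.sum_ite_eq', Finset.mem_univ, if_true,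
    Finset.sum_const, Finset.card_univ, Fintype.card_fin, nsmul_eq_mul]
  rw [edgeMix]
  split_ifs <;> field_simp <;> ring

/-- The Laplace transform at `s` of `x ↦ sin (ω x)`. -/
noncomputable def sinLaplace (s ω : ℝ) : ℝ := ω * (s ^ 2 + ω ^ 2)⁻¹

/-- The normalized solution of `-f'' = ω² f` on the half line with `f'(0) = κ f(0)`. -/
noncomputable def robin (κ ω x : ℝ) : ℝ :=
  (ω * Real.cos (ω * x) + κ * Real.sin (ω * x)) * (√(κ ^ 2 + ω ^ 2))⁻¹

/-- The Laplace transform at `s` of `robin κ ω`. -/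
noncomputable def robinLaplace (κ s ω : ℝ) : ℝ :=
  ω * (s + κ) * (s ^ 2 + ω ^ 2)⁻¹ * (√(κ ^ 2 + ω ^ 2))⁻¹

/-- The generalized eigenfunctions of the star graph, real and normalized. -/
noncomputable def eigenfunction (N : ℕ) (κ : ℝ) (k j : Fin N) (ω x : ℝ) : ℝ :=
  √(2 / Real.pi) * edgeMix N (Real.sin (ω * x)) (robin κ ω x) k j

/-- The Laplace transforms of the generalized eigenfunctions. -/
noncomputable def eigenfunctionLaplace (N : ℕ) (κ : ℝ) (k j : Fin N) (s ω : ℝ) : ℝ :=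
  √(2 / Real.pi) * edgeMix N (sinLaplace s ω) (robinLaplace κ s ω) k j

theorem measurable_sinLaplace (s : ℝ) : Measurable (sinLaplace s) := by
  unfold sinLaplace
  fun_prop

theorem measurable_robinLaplace (κ s : ℝ) : Measurable (robinLaplace κ s) := by
  unfold robinLaplace
  fun_prop

theorem sinLaplace_mul (s t : ℝ) : (fun ω => sinLaplace s ω * sinLaplace t ω) =
    fun ω => ω ^ 2 * ((s ^ 2 + ω ^ 2)⁻¹ * (t ^ 2 + ω ^ 2)⁻¹) := by
  funext ω
  rw [sinLaplace, sinLaplace]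
  ring

theorem inv_sqrt_mul_inv_sqrt (κ ω : ℝ) :
    (√(κ ^ 2 + ω ^ 2))⁻¹ * (√(κ ^ 2 + ω ^ 2))⁻¹ = (κ ^ 2 + ω ^ 2)⁻¹ := by
  rw [← mul_inv, Real.mul_self_sqrt (by positivity)]

theorem robinLaplace_mul (κ s t : ℝ) : (fun ω => robinLaplace κ s ω * robinLaplace κ t ω) =
    fun ω => (s + κ) * (t + κ) *
      (ω ^ 2 * ((s ^ 2 + ω ^ 2)⁻¹ * (t ^ 2 + ω ^ 2)⁻¹ * (κ ^ 2 + ω ^ 2)⁻¹)) := by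
  funext ω
  rw [robinLaplace, robinLaplace, ← inv_sqrt_mul_inv_sqrt κ ω]
  ring

theorem integral_sinLaplace_mul {s t : ℝ} (hs : 0 < s) (ht : 0 < t) :
    Integrable (fun ω => sinLaplace s ω * sinLaplace t ω) μ₊ ∧
    ∫ ω in Ioi (0 : ℝ), sinLaplace s ω * sinLaplace t ω = Real.pi / 2 * (1 / (s + t)) := by
  rw [sinLaplace_mul]
  exact integral_sq_mul_inv_mul hs ht

/-- The factors s + κ and t + κ cancel against the rational integral, leaving the value of the
Dirichlet case. This uses κ ≥ 0, the case without a bound state to be added. -/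
theorem integral_robinLaplace_mul {κ s t : ℝ} (hκ : 0 ≤ κ) (hs : 0 < s) (ht : 0 < t) :
    Integrable (fun ω => robinLaplace κ s ω * robinLaplace κ t ω) μ₊ ∧
    ∫ ω in Ioi (0 : ℝ), robinLaplace κ s ω * robinLaplace κ t ω =
      Real.pi / 2 * (1 / (s + t)) := by
  rw [robinLaplace_mul]
  obtain ⟨i, j⟩ := integral_sq_mul_inv_mul_mul hs ht hκ
  refine ⟨i.const_mul _, ?_⟩
  rw [integral_const_mul, j]
  have h1 : s + κ ≠ 0 := by positivity
  have h2 : t + κ ≠ 0 := by positivity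
  have h3 : s + t ≠ 0 := by positivity
  field_simp

theorem memLp_sinLaplace {s : ℝ} (hs : 0 < s) : MemLp (sinLaplace s) 2 μ₊ := by
  rw [memLp_two_iff_integrable_sq (measurable_sinLaplace s).aestronglyMeasurable]
  simpa only [sq] using (integral_sinLaplace_mul hs hs).1

theorem memLp_robinLaplace {κ s : ℝ} (hκ : 0 ≤ κ) (hs : 0 < s) :
    MemLp (robinLaplace κ s) 2 μ₊ := by
  rw [memLp_two_iff_integrable_sq (measurable_robinLaplace κ s).aestronglyMeasurable]
  simpa only [sq] using (integral_robinLaplace_mul hκ hs hs).1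

theorem memLp_eigenfunctionLaplace {κ s : ℝ} (hκ : 0 ≤ κ) (hs : 0 < s) (k j : Fin N) :
    MemLp (fun ω => (eigenfunctionLaplace N κ k j s ω : ℂ)) 2 μ₊ := by
  refine MemLp.ofReal ?_
  exact (((memLp_sinLaplace hs).const_mul _).add ((memLp_robinLaplace hκ hs).const_mul _)).const_mul _

theorem memLp_exp_neg_mul {s : ℝ} (hs : 0 < s) :
    MemLp (fun x : ℝ => (Real.exp (-(s * x)) : ℂ)) 2 μ₊ := by
  suffices h : MemLp (fun x : ℝ => Real.exp (-(s * x))) 2 μ₊ from h.ofReal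
  rw [memLp_two_iff_integrable_sq (by fun_prop)]
  have h : IntegrableOn (fun x : ℝ => Real.exp (-(2 * s) * x)) (Ioi 0) :=
    exp_neg_integrableOn_Ioi 0 (by positivity)
  refine h.congr (Filter.Eventually.of_forall fun x => ?_)
  simp only
  rw [← Real.exp_nat_mul]
  congr 1
  push_cast
  ring

theorem integral_exp_mul_exp {s t : ℝ} (hs : 0 < s) (ht : 0 < t) :
    ∫ x in Ioi (0 : ℝ), Real.exp (-(s * x)) * Real.exp (-(t * x)) = 1 / (s + t) := by
  have h := integral_exp_mul_Ioi (a := -(s + t)) (by linarith) 0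
  simp only [mul_zero, Real.exp_zero] at h
  rw [neg_div_neg_eq] at h
  rw [← h]
  congr 1 with x
  rw [← Real.exp_add]
  congr 1
  ring

/-- Laplace transform of the generalized eigenfunctions. -/
theorem integral_exp_mul_eigenfunction {s : ℝ} (hs : 0 < s) (κ : ℝ) (k j : Fin N) (ω : ℝ) :
    ∫ x in Ioi (0 : ℝ), (eigenfunction N κ k j ω x : ℂ) * (Real.exp (-(s * x)) : ℂ) =
      (eigenfunctionLaplace N κ k j s ω : ℂ) := by
  have hi : IntegrableOn (fun x : ℝ => Real.exp (-(s * x))) (Ioi 0) := by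
    simpa [neg_mul] using exp_neg_integrableOn_Ioi 0 hs
  have hc : IntegrableOn (fun x : ℝ => Real.exp (-(s * x)) * Real.cos (ω * x)) (Ioi 0) :=
    Integrable.mul_bdd (c := 1) hi (by fun_prop) (Filter.Eventually.of_forall fun x => by
      exact Real.abs_cos_le_one _)
  have hsn : IntegrableOn (fun x : ℝ => Real.exp (-(s * x)) * Real.sin (ω * x)) (Ioi 0) :=
    Integrable.mul_bdd (c := 1) hi (by fun_prop) (Filter.Eventually.of_forall fun x => by
      exact Real.abs_sin_le_one _)
  obtain ⟨h1, h2⟩ := integral_exp_mul_cos_sin hs ω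
  have e : ∀ x : ℝ, eigenfunction N κ k j ω x * Real.exp (-(s * x)) =
      √(2 / Real.pi) * (((if k = j then 1 else 0) - (N : ℝ)⁻¹) +
        (N : ℝ)⁻¹ * (√(κ ^ 2 + ω ^ 2))⁻¹ * κ) * (Real.exp (-(s * x)) * Real.sin (ω * x)) +
      √(2 / Real.pi) * ((N : ℝ)⁻¹ * (√(κ ^ 2 + ω ^ 2))⁻¹ * ω) *
        (Real.exp (-(s * x)) * Real.cos (ω * x)) := by
    intro x
    rw [eigenfunction, edgeMix, robin]
    ring
  simp only [← Complex.ofReal_mul, e]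
  rw [integral_complex_ofReal, integral_add (hsn.const_mul _) (hc.const_mul _), integral_const_mul,
    integral_const_mul, h1, h2]
  congr 1
  rw [eigenfunctionLaplace, edgeMix, sinLaplace, robinLaplace]
  ring

theorem abs_robin_le (κ ω x : ℝ) : |robin κ ω x| ≤ 2 := by
  have h0 : 0 ≤ √(κ ^ 2 + ω ^ 2) := Real.sqrt_nonneg _
  have h1 : |ω| ≤ √(κ ^ 2 + ω ^ 2) := Real.abs_le_sqrt (by nlinarith [sq_nonneg κ])
  have h2 : |κ| ≤ √(κ ^ 2 + ω ^ 2) := Real.abs_le_sqrt (by nlinarith [sq_nonneg ω])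
  rw [robin, abs_mul, abs_inv, abs_of_nonneg h0]
  refine mul_inv_le_of_le_mul₀ h0 (by norm_num) ?_
  refine (abs_add_le _ _).trans ?_
  rw [abs_mul, abs_mul]
  have h3 := mul_le_mul h1 (Real.abs_cos_le_one (ω * x)) (abs_nonneg _) h0
  have h4 := mul_le_mul h2 (Real.abs_sin_le_one (ω * x)) (abs_nonneg _) h0
  linarith

theorem abs_eigenfunction_le (κ : ℝ) (k j : Fin N) (ω x : ℝ) :
    |eigenfunction N κ k j ω x| ≤ √(2 / Real.pi) * 4 := by
  have hN : (N : ℝ)⁻¹ ≤ 1 := by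
    have : 1 ≤ N := (Nat.zero_le _).trans_lt k.2
    exact inv_le_one_of_one_le₀ (by exact_mod_cast this)
  have hN0 : (0 : ℝ) ≤ (N : ℝ)⁻¹ := by positivity
  rw [eigenfunction, abs_mul, abs_of_nonneg (Real.sqrt_nonneg _)]
  refine mul_le_mul_of_nonneg_left ?_ (Real.sqrt_nonneg _)
  rw [edgeMix]
  refine (abs_add_le _ _).trans ?_
  rw [abs_mul, abs_mul, abs_of_nonneg hN0]
  have h1 : |(if k = j then (1 : ℝ) else 0) - (N : ℝ)⁻¹| ≤ 2 := by
    rw [abs_le]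
    split_ifs <;> constructor <;> linarith
  have h2 := mul_le_mul h1 (Real.abs_sin_le_one (ω * x)) (abs_nonneg _) (by norm_num)
  have h3 := mul_le_mul hN (abs_robin_le κ ω x) (abs_nonneg _) (by norm_num)
  linarith

/-- The element of `L²((0,∞))^N` with given components. -/
noncomputable def mkL2Star (f : Fin N → ℝ → ℂ) (hf : ∀ k, MemLp (f k) 2 μ₊) : L2Star N :=
  WithLp.toLp 2 fun k => (hf k).toLp (f k)

theorem mkL2Star_ae_eq (f : Fin N → ℝ → ℂ) (hf : ∀ k, MemLp (f k) 2 μ₊) (k : Fin N) :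
    mkL2Star f hf k =ᵐ[μ₊] f k := (hf k).coeFn_toLp

theorem inner_eq_sum_integral (u v : L2Star N) :
    ⟪u, v⟫_ℂ = ∑ k, ∫ x in Ioi (0 : ℝ), (starRingEnd ℂ) (u k x) * v k x := by
  rw [PiLp.inner_apply]
  refine Finset.sum_congr rfl fun k _ => ?_
  rw [L2.inner_def]
  congr 1 with x
  rw [RCLike.inner_apply, mul_comm]

theorem inner_mkL2Star (f : Fin N → ℝ → ℂ) (hf : ∀ k, MemLp (f k) 2 μ₊) (v : L2Star N) :
    ⟪mkL2Star f hf, v⟫_ℂ = ∑ k, ∫ x in Ioi (0 : ℝ), (starRingEnd ℂ) (f k x) * v k x := by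
  rw [inner_eq_sum_integral]
  refine Finset.sum_congr rfl fun k _ => integral_congr_ae ?_
  filter_upwards [mkL2Star_ae_eq f hf k] with x hx
  rw [hx]

theorem integrable_mul_L2 {f : ℝ → ℂ} (hf : MemLp f 2 μ₊) (u : Lp ℂ 2 μ₊) :
    Integrable (fun x => f x * u x) μ₊ :=
  hf.integrable_mul (Lp.memLp u)

/-- An element of `L²((0,∞))^N` with vanishing Laplace transforms is zero. -/
theorem eq_zero_of_laplace_eq_zero {u : L2Star N}
    (h : ∀ s : ℝ, 1 ≤ s → ∀ j, ∫ x in Ioi (0 : ℝ), (Real.exp (-(s * x)) : ℂ) * u j x = 0) :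
    u = 0 := by
  ext1 j
  refine Lp.ext ((ae_eq_zero_of_laplace_eq_zero (c := 1) ?_ fun n => ?_).trans
    (Lp.coeFn_zero _ _ _).symm)
  · exact integrable_mul_L2 (memLp_exp_neg_mul one_pos) (u j)
  · exact h _ (by linarith [(Nat.cast_nonneg n : (0 : ℝ) ≤ n)]) j

/-- The Laplace transforms of the generalized eigenfunctions form a total family. -/
theorem eq_zero_of_eigenfunctionLaplace {κ : ℝ} (hN : 0 < N) (hκ : 0 ≤ κ) {g : L2Star N}
    (h : ∀ s > 0, ∀ j, ∑ k, ∫ ω in Ioi (0 : ℝ), (eigenfunctionLaplace N κ k j s ω : ℂ) * g k ω = 0) :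
    g = 0 := by
  have hN' : (N : ℂ) ≠ 0 := by exact_mod_cast hN.ne'
  have hπ : ((√(2 / Real.pi) : ℝ) : ℂ) ≠ 0 := by
    have : √(2 / Real.pi) ≠ 0 := by positivity
    exact_mod_cast this
  -- the sum of the components
  let S : ℝ → ℂ := fun ω => ∑ k, g k ω
  have hg : ∀ k, MemLp (g k) 2 μ₊ := fun k => Lp.memLp _
  have hS : MemLp S 2 μ₊ := memLp_finsetSum _ fun k _ => hg k
  have key : ∀ s > 0, ∀ j, (∫ ω in Ioi (0 : ℝ), (sinLaplace s ω : ℂ) * (g j ω - (N : ℂ)⁻¹ * S ω)) +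
      ∫ ω in Ioi (0 : ℝ), (robinLaplace κ s ω : ℂ) * ((N : ℂ)⁻¹ * S ω) = 0 := by
    intro s hs j
    have h1 := h s hs j
    rw [← integral_finsetSum _ fun k _ => integrable_mul_L2 (memLp_eigenfunctionLaplace hκ hs k j) _]
      at h1
    have e : ∀ ω : ℝ, ∑ k, (eigenfunctionLaplace N κ k j s ω : ℂ) * g k ω =
        ((√(2 / Real.pi) : ℝ) : ℂ) * ((sinLaplace s ω : ℂ) * (g j ω - (N : ℂ)⁻¹ * S ω) +
          (robinLaplace κ s ω : ℂ) * ((N : ℂ)⁻¹ * S ω)) := by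
      intro ω
      rw [← sum_edgeMix_mul (sinLaplace s ω) (robinLaplace κ s ω) (fun k => g k ω) j, Finset.mul_sum]
      refine Finset.sum_congr rfl fun k _ => ?_
      rw [eigenfunctionLaplace]
      push_cast
      ring
    simp only [e] at h1
    rw [integral_const_mul, integral_add] at h1
    · exact (mul_eq_zero.1 h1).resolve_left hπ
    · exact (memLp_sinLaplace hs).ofReal.integrable_mul ((hg j).sub (hS.const_mul _))
    · exact (memLp_robinLaplace hκ hs).ofReal.integrable_mul (hS.const_mul _)
  -- Summing over j removes the Dirichlet term, since the differences g_j - S/N add up to zero. Only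
  -- the Robin transform of S remains.
  have hsum : ∀ s > 0, ∫ ω in Ioi (0 : ℝ), (robinLaplace κ s ω : ℂ) * S ω = 0 := by
    intro s hs
    have h1 : ∑ j, ((∫ ω in Ioi (0 : ℝ), (sinLaplace s ω : ℂ) * (g j ω - (N : ℂ)⁻¹ * S ω)) +
      ∫ ω in Ioi (0 : ℝ), (robinLaplace κ s ω : ℂ) * ((N : ℂ)⁻¹ * S ω)) = 0 :=
      Finset.sum_eq_zero fun j _ => key s hs j
    rw [Finset.sum_add_distrib, ← integral_finsetSum] at h1
    · have e : ∀ ω : ℝ, ∑ j, (sinLaplace s ω : ℂ) * (g j ω - (N : ℂ)⁻¹ * S ω) = 0 := by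
        intro ω
        rw [← Finset.mul_sum, Finset.sum_sub_distrib]
        simp [S, hN']
      have e2 : ∀ ω : ℝ, (robinLaplace κ s ω : ℂ) * ((N : ℂ)⁻¹ * S ω) =
        (N : ℂ)⁻¹ * ((robinLaplace κ s ω : ℂ) * S ω) := fun ω => by ring
      simp only [e, integral_zero, zero_add, e2, integral_const_mul, Finset.sum_const,
        Finset.card_univ, Fintype.card_fin, nsmul_eq_mul] at h1
      rwa [← mul_assoc, mul_inv_cancel₀ hN', one_mul] at h1
    · exact fun j _ => (memLp_sinLaplace hs).ofReal.integrable_mul ((hg j).sub (hS.const_mul _))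
  -- Up to the nonzero factor s + κ this is the Stieltjes transform of ω(κ²+ω²)^{-1/2} S, whose
  -- prefactor is positive for ω > 0.
  have hS0 : S =ᵐ[μ₊] 0 := by
    have h1 : (fun ω => ((ω * (√(κ ^ 2 + ω ^ 2))⁻¹ : ℝ) : ℂ) * S ω) =ᵐ[μ₊] 0 := by
      have hcast : ∀ s > 0, ∀ ω : ℝ, (((s ^ 2 + ω ^ 2)⁻¹ : ℝ) : ℂ) *
          (((ω * (√(κ ^ 2 + ω ^ 2))⁻¹ : ℝ) : ℂ) * S ω) =
          ((s + κ : ℝ) : ℂ)⁻¹ * ((robinLaplace κ s ω : ℂ) * S ω) := by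
        intro s hs ω
        have : ((s + κ : ℝ) : ℂ) ≠ 0 := by
          have : s + κ ≠ 0 := by positivity
          exact_mod_cast this
        rw [robinLaplace]
        push_cast at this ⊢
        field_simp
      refine ae_eq_zero_of_stieltjes_eq_zero ?_ fun n => ?_
      · have := hcast 1 one_pos
        simp only [one_pow] at this
        simp only [this]
        exact ((memLp_robinLaplace hκ one_pos).ofReal.integrable_mul hS).const_mul _
      · simp only [hcast _ (Nat.cast_add_one_pos n)]
        rw [integral_const_mul, hsum _ (Nat.cast_add_one_pos n), mul_zero]
    rw [Filter.EventuallyEq, ae_restrict_iff' measurableSet_Ioi] at h1 ⊢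
    filter_upwards [h1] with ω hω hω0
    refine (mul_eq_zero.1 (hω hω0)).resolve_left ?_
    have h2 : (0 : ℝ) < ω := hω0
    have : ω * (√(κ ^ 2 + ω ^ 2))⁻¹ ≠ 0 := by positivity
    exact_mod_cast this
  -- With S = 0 each component separately has vanishing sine transform data, again a Stieltjes
  -- transform, now of ω g_j.
  have hj : ∀ s > 0, ∀ j, ∫ ω in Ioi (0 : ℝ), (sinLaplace s ω : ℂ) * g j ω = 0 := by
    intro s hs j
    rw [← key s hs j]
    have e2 : ∫ ω in Ioi (0 : ℝ), (robinLaplace κ s ω : ℂ) * ((N : ℂ)⁻¹ * S ω) = 0 := by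
      refine integral_eq_zero_of_ae ?_
      filter_upwards [hS0] with ω hω
      rw [hω]
      simp
    rw [e2, add_zero]
    refine integral_congr_ae ?_
    filter_upwards [hS0] with ω hω
    rw [hω]
    simp
  ext1 j
  refine Lp.ext (Filter.EventuallyEq.trans ?_ (Lp.coeFn_zero _ _ _).symm)
  have hcast : ∀ s : ℝ, ∀ ω : ℝ, (((s ^ 2 + ω ^ 2)⁻¹ : ℝ) : ℂ) * ((ω : ℂ) * g j ω) =
      (sinLaplace s ω : ℂ) * g j ω := by
    intro s ω
    rw [sinLaplace]
    push_cast
    ring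
  have h1 : (fun ω : ℝ => (ω : ℂ) * g j ω) =ᵐ[μ₊] 0 := by
    refine ae_eq_zero_of_stieltjes_eq_zero ?_ fun n => ?_
    · have := hcast 1
      simp only [one_pow] at this
      simp only [this]
      exact (memLp_sinLaplace one_pos).ofReal.integrable_mul (hg j)
    · simp only [hcast]
      exact hj _ (Nat.cast_add_one_pos n) j
  rw [Filter.EventuallyEq, ae_restrict_iff' measurableSet_Ioi] at h1 ⊢
  filter_upwards [h1] with ω hω hω0
  refine (mul_eq_zero.1 (hω hω0)).resolve_left ?_
  have h2 : (0 : ℝ) < ω := hω0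
  exact_mod_cast h2.ne'

/-- `U` is the generalized eigenfunction transform of the star graph, characterized by its values
on exponential functions. -/
def IsEigenTransform (κ : ℝ) (U : L2Star N ≃ₗᵢ[ℂ] L2Star N) : Prop :=
  ∀ s > 0, ∀ (j : Fin N) (u : L2Star N),
    ∫ x in Ioi (0 : ℝ), (Real.exp (-(s * x)) : ℂ) * u j x =
      ∑ k, ∫ ω in Ioi (0 : ℝ), (eigenfunctionLaplace N κ k j s ω : ℂ) * U u k ω

/-- The exponentials on single edges and the Laplace transforms of the eigenfunctions are total with
the same Gram matrix δ_{jl}/(s+t). The unitary between them has the required pairing with every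
exponential, because it preserves inner products. -/
theorem exists_isEigenTransform (hN : 0 < N) {κ : ℝ} (hκ : 0 ≤ κ) :
    ∃ U : L2Star N ≃ₗᵢ[ℂ] L2Star N, IsEigenTransform κ U := by
  have hexp : ∀ s : Ioi (0 : ℝ), ∀ j k : Fin N,
      MemLp (fun x : ℝ => if k = j then (Real.exp (-(s * x)) : ℂ) else 0) 2 μ₊ := by
    intro s j k
    split_ifs
    · exact memLp_exp_neg_mul s.2
    · exact MemLp.zero'
  let v : Ioi (0 : ℝ) × Fin N → L2Star N := fun i =>
    mkL2Star (fun k x => if k = i.2 then (Real.exp (-(i.1 * x)) : ℂ) else 0) (hexp i.1 i.2)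
  let w : Ioi (0 : ℝ) × Fin N → L2Star N := fun i =>
    mkL2Star (fun k ω => (eigenfunctionLaplace N κ k i.2 i.1 ω : ℂ))
      (fun k => memLp_eigenfunctionLaplace hκ i.1.2 k i.2)
  have hvin : ∀ i u, ⟪v i, u⟫_ℂ = ∫ x in Ioi (0 : ℝ), (Real.exp (-(i.1 * x)) : ℂ) * u i.2 x := by
    intro i u
    rw [inner_mkL2Star, Finset.sum_eq_single i.2]
    · simp only [if_true, Complex.conj_ofReal]
    · intro k _ hk
      simp [hk]
    · simp
  have hwin : ∀ i u, ⟪w i, u⟫_ℂ =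
      ∑ k, ∫ ω in Ioi (0 : ℝ), (eigenfunctionLaplace N κ k i.2 i.1 ω : ℂ) * u k ω := by
    intro i u
    rw [inner_mkL2Star]
    simp only [Complex.conj_ofReal]
  have hgram : ∀ i i', ⟪v i, v i'⟫_ℂ = ⟪w i, w i'⟫_ℂ := by
    rintro ⟨s, j⟩ ⟨t, l⟩
    have hst : ((s : ℝ) + t) ≠ 0 := by
      have h1 : (0 : ℝ) < s := s.2
      have h2 : (0 : ℝ) < t := t.2
      positivity
    have h1 : ⟪v (s, j), v (t, l)⟫_ℂ = (((if j = l then 1 else 0) * (1 / ((s : ℝ) + t)) : ℝ) : ℂ) := by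
      rw [hvin, integral_congr_ae (g := fun x : ℝ => (((if j = l then 1 else 0) *
        (Real.exp (-(s * x)) * Real.exp (-(t * x))) : ℝ) : ℂ)), integral_complex_ofReal,
        integral_const_mul, integral_exp_mul_exp s.2 t.2]
      filter_upwards [mkL2Star_ae_eq _ (hexp t l) j] with x hx
      simp only [v]
      rw [hx]
      split_ifs <;> simp
    have h2 : ⟪w (s, j), w (t, l)⟫_ℂ = ((∫ ω in Ioi (0 : ℝ), ∑ k,
        eigenfunctionLaplace N κ k j s ω * eigenfunctionLaplace N κ k l t ω : ℝ) : ℂ) := by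
      rw [hwin, ← integral_finsetSum _ fun k _ =>
        integrable_mul_L2 (memLp_eigenfunctionLaplace hκ s.2 k j) _, ← integral_complex_ofReal]
      refine integral_congr_ae ?_
      have h3 : ∀ᵐ ω ∂μ₊, ∀ k, w (t, l) k ω = (eigenfunctionLaplace N κ k l t ω : ℂ) :=
        ae_all_iff.2 fun k => mkL2Star_ae_eq _
          (fun k => memLp_eigenfunctionLaplace hκ t.2 k l) k
      filter_upwards [h3] with ω hω
      push_cast
      exact Finset.sum_congr rfl fun k _ => by rw [hω]
    -- The Dirichlet part carries δ_{jl} - 1/N and the Robin part 1/N. Both integrate to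
    -- (π/2)/(s+t), so the terms with 1/N cancel.
    have h4 : ∀ ω : ℝ, ∑ k, eigenfunctionLaplace N κ k j s ω * eigenfunctionLaplace N κ k l t ω =
        (2 / Real.pi) * (((if j = l then 1 else 0) - (N : ℝ)⁻¹) * (sinLaplace s ω * sinLaplace t ω) +
          (N : ℝ)⁻¹ * (robinLaplace κ s ω * robinLaplace κ t ω)) := by
      intro ω
      have h5 := sum_edgeMix_mul_edgeMix hN (sinLaplace s ω) (robinLaplace κ s ω) (sinLaplace t ω)
        (robinLaplace κ t ω) j l
      rw [edgeMix] at h5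
      rw [← h5, Finset.mul_sum]
      refine Finset.sum_congr rfl fun k _ => ?_
      have h6 : √(2 / Real.pi) * √(2 / Real.pi) = 2 / Real.pi := Real.mul_self_sqrt (by positivity)
      rw [← h6, eigenfunctionLaplace, eigenfunctionLaplace]
      ring
    obtain ⟨i1, j1⟩ := integral_sinLaplace_mul s.2 t.2
    obtain ⟨i2, j2⟩ := integral_robinLaplace_mul hκ s.2 t.2
    rw [h1, h2]
    simp only [h4]
    rw [integral_const_mul, integral_add (i1.const_mul _) (i2.const_mul _), integral_const_mul,
      integral_const_mul, j1, j2]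
    congr 1
    field_simp
    ring
  have hv : ∀ u, (∀ i, ⟪v i, u⟫_ℂ = 0) → u = 0 := fun u hu =>
    eq_zero_of_laplace_eq_zero fun s hs j => by
      rw [← hvin (⟨s, one_pos.trans_le hs⟩, j) u, hu]
  have hw : ∀ u, (∀ i, ⟪w i, u⟫_ℂ = 0) → u = 0 := fun u hu =>
    eq_zero_of_eigenfunctionLaplace hN hκ fun s hs j => by rw [← hwin (⟨s, hs⟩, j) u, hu]
  obtain ⟨U, hU⟩ := exists_linearIsometryEquiv_of_inner_eq hv hw hgram
  refine ⟨U, fun s hs j u => ?_⟩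
  have h1 := hvin (⟨s, hs⟩, j) u
  have h2 := hwin (⟨s, hs⟩, j) (U u)
  rw [← hU, U.inner_map_map] at h2
  rw [← h1, ← h2]

end Transform

/-! ### The spectral measure of multiplication by ω² -/

section MultiplicationPVM

theorem memLp_indicator {s : Set ℝ} (hs : MeasurableSet s) (u : Lp ℂ 2 μ₊) :
    MemLp (s.indicator u) 2 μ₊ := (Lp.memLp u).indicator hs

theorem indicator_toLp_add {s : Set ℝ} (hs : MeasurableSet s) (u v : Lp ℂ 2 μ₊) :
    (memLp_indicator hs (u + v)).toLp _ =
      (memLp_indicator hs u).toLp _ + (memLp_indicator hs v).toLp _ := by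
  rw [← MemLp.toLp_add, MemLp.toLp_eq_toLp_iff]
  filter_upwards [Lp.coeFn_add u v] with x h
  by_cases hx : x ∈ s
  · rw [Pi.add_apply, indicator_of_mem hx, indicator_of_mem hx, indicator_of_mem hx, h, Pi.add_apply]
  · simp [hx]

theorem indicator_toLp_smul {s : Set ℝ} (hs : MeasurableSet s) (c : ℂ) (u : Lp ℂ 2 μ₊) :
    (memLp_indicator hs (c • u)).toLp _ = c • (memLp_indicator hs u).toLp _ := by
  rw [← MemLp.toLp_const_smul, MemLp.toLp_eq_toLp_iff]
  filter_upwards [Lp.coeFn_smul c u] with x h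
  by_cases hx : x ∈ s <;> simp [hx, h]

theorem norm_indicator_toLp_le {s : Set ℝ} (hs : MeasurableSet s) (u : Lp ℂ 2 μ₊) :
    ‖(memLp_indicator hs u).toLp _‖ ≤ 1 * ‖u‖ := by
  rw [one_mul, Lp.norm_toLp, Lp.norm_def]
  exact ENNReal.toReal_mono (Lp.eLpNorm_ne_top u) (eLpNorm_indicator_le _)

/-- Multiplication by the indicator function of a measurable set on `L²((0,∞))`. -/
noncomputable def indicatorL2 {s : Set ℝ} (hs : MeasurableSet s) : Lp ℂ 2 μ₊ →L[ℂ] Lp ℂ 2 μ₊ :=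
  LinearMap.mkContinuous
    { toFun := fun u => (memLp_indicator hs u).toLp _
      map_add' := indicator_toLp_add hs
      map_smul' := indicator_toLp_smul hs } 1 (norm_indicator_toLp_le hs)

theorem indicatorL2_ae_eq {s : Set ℝ} (hs : MeasurableSet s) (u : Lp ℂ 2 μ₊) :
    indicatorL2 hs u =ᵐ[μ₊] s.indicator u :=
  (memLp_indicator hs u).coeFn_toLp

variable {N : ℕ}

/-- Multiplication by the indicator function of a measurable set on `L²((0,∞))^N`. -/
noncomputable def cutoff {s : Set ℝ} (hs : MeasurableSet s) : L2Star N →L[ℂ] L2Star N :=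
  ((PiLp.continuousLinearEquiv 2 ℂ fun _ : Fin N => Lp ℂ 2 μ₊).symm :
      (Fin N → Lp ℂ 2 μ₊) →L[ℂ] L2Star N) ∘L
    ContinuousLinearMap.pi fun k => indicatorL2 hs ∘L
      PiLp.proj 2 (fun _ : Fin N => Lp ℂ 2 μ₊) k

theorem cutoff_ae_eq {s : Set ℝ} (hs : MeasurableSet s) (u : L2Star N) (k : Fin N) :
    cutoff hs u k =ᵐ[μ₊] s.indicator (u k) :=
  indicatorL2_ae_eq hs (u k)

theorem L2Star_ext {u v : L2Star N} (h : ∀ k, u k =ᵐ[μ₊] v k) : u = v := by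
  ext1 k
  exact Lp.ext (h k)

theorem inner_cutoff_left {s : Set ℝ} (hs : MeasurableSet s) (u v : L2Star N) :
    ⟪cutoff hs u, v⟫_ℂ = ⟪u, cutoff hs v⟫_ℂ := by
  rw [inner_eq_sum_integral, inner_eq_sum_integral]
  refine Finset.sum_congr rfl fun k _ => integral_congr_ae ?_
  filter_upwards [cutoff_ae_eq hs u k, cutoff_ae_eq hs v k] with x h1 h2
  rw [h1, h2]
  by_cases hx : x ∈ s <;> simp [hx]

theorem cutoff_cutoff {s t : Set ℝ} (hs : MeasurableSet s) (ht : MeasurableSet t) (u : L2Star N) :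
    cutoff hs (cutoff ht u) = cutoff (hs.inter ht) u := by
  refine L2Star_ext fun k => ?_
  filter_upwards [cutoff_ae_eq hs (cutoff ht u) k, cutoff_ae_eq ht u k,
    cutoff_ae_eq (hs.inter ht) u k] with x h1 h2 h3
  rw [h1, h3]
  by_cases hx : x ∈ s <;> by_cases hx' : x ∈ t <;> simp [hx, hx', h2]

theorem cutoff_univ (u : L2Star N) : cutoff MeasurableSet.univ u = u := by
  refine L2Star_ext fun k => ?_
  filter_upwards [cutoff_ae_eq MeasurableSet.univ u k] with x h1
  rw [h1, indicator_univ]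

theorem cutoff_empty (u : L2Star N) : cutoff MeasurableSet.empty u = 0 := by
  refine L2Star_ext fun k => ?_
  filter_upwards [cutoff_ae_eq MeasurableSet.empty u k, Lp.coeFn_zero ℂ 2 μ₊] with x h1 h2
  rw [h1, indicator_empty]
  exact h2.symm

theorem cutoff_congr {s t : Set ℝ} (hs : MeasurableSet s) (ht : MeasurableSet t) (h : s = t)
    (u : L2Star N) : cutoff hs u = cutoff ht u := by
  subst h
  rfl

theorem isStarProjection_cutoff {s : Set ℝ} (hs : MeasurableSet s) :
    IsStarProjection (cutoff hs : L2Star N →L[ℂ] L2Star N) := by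
  refine ⟨?_, ?_⟩
  · ext1 u
    rw [mul_apply_eq_comp, cutoff_cutoff]
    exact cutoff_congr _ _ (inter_self s) u
  · rw [ContinuousLinearMap.isSelfAdjoint_iff_isSymmetric]
    exact fun u v => inner_cutoff_left hs u v

/-- The density `∑ k, |u_k|²`. -/
noncomputable def density (u : L2Star N) (ω : ℝ) : ℝ := ∑ k, ‖u k ω‖ ^ 2

theorem density_nonneg (u : L2Star N) (ω : ℝ) : 0 ≤ density u ω :=
  Finset.sum_nonneg fun _ _ => by positivity

theorem measurable_density (u : L2Star N) : Measurable (density u) :=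
  Finset.measurable_sum _ fun k _ => ((Lp.stronglyMeasurable (u k)).norm.measurable.pow_const 2)

theorem integrable_density (u : L2Star N) : Integrable (density u) μ₊ :=
  integrable_finsetSum _ fun k _ => (Lp.memLp (u k)).integrable_norm_pow (by norm_num)

theorem norm_sq_eq_integral_density (u : L2Star N) : ‖u‖ ^ 2 = ∫ ω, density u ω ∂μ₊ := by
  have h1 : ((‖u‖ ^ 2 : ℝ) : ℂ) = ⟪u, u⟫_ℂ := by
    rw [inner_self_eq_norm_sq_to_K]
    push_cast
    rfl
  have h2 : ⟪u, u⟫_ℂ = ((∫ ω, density u ω ∂μ₊ : ℝ) : ℂ) := by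
    unfold density
    rw [inner_eq_sum_integral,
      integral_finsetSum _ fun k _ => (Lp.memLp (u k)).integrable_norm_pow (by norm_num)]
    push_cast
    refine Finset.sum_congr rfl fun k _ => ?_
    rw [← integral_complex_ofReal]
    congr 1 with x
    rw [mul_comm, Complex.mul_conj, Complex.normSq_eq_norm_sq]
  exact_mod_cast h1.trans h2

theorem norm_sq_cutoff {s : Set ℝ} (hs : MeasurableSet s) (u : L2Star N) :
    ‖cutoff hs u‖ ^ 2 = ∫ ω in s, density u ω ∂μ₊ := by
  rw [norm_sq_eq_integral_density, ← integral_indicator hs]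
  refine integral_congr_ae ?_
  have h : ∀ᵐ ω ∂μ₊, ∀ k, cutoff hs u k ω = s.indicator (u k) ω :=
    ae_all_iff.2 fun k => cutoff_ae_eq hs u k
  filter_upwards [h] with ω hω
  by_cases hx : ω ∈ s <;> simp [density, hω, hx]

/-- The p_n are mutually orthogonal and behave as orthogonal projections of q, so the squared error
of a partial sum is ‖q‖² minus the sum of the ‖p_n‖². Convergence of the squared norms is therefore
enough, and for cut-offs that is countable additivity of an integral. -/
theorem hasSum_of_inner_eq {H : Type*} [NormedAddCommGroup H] [InnerProductSpace ℂ H] {p : ℕ → H}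
    {q : H} (h0 : ∀ m n, m ≠ n → ⟪p m, p n⟫_ℂ = 0) (h1 : ∀ n, ⟪q, p n⟫_ℂ = ((‖p n‖ ^ 2 : ℝ) : ℂ))
    (h2 : HasSum (fun n => ‖p n‖ ^ 2) (‖q‖ ^ 2)) : HasSum p q := by
  have key : ∀ F : Finset ℕ, ‖∑ n ∈ F, p n - q‖ ^ 2 = ‖q‖ ^ 2 - ∑ n ∈ F, ‖p n‖ ^ 2 := by
    intro F
    have e1 : ⟪∑ n ∈ F, p n, q⟫_ℂ = ((∑ n ∈ F, ‖p n‖ ^ 2 : ℝ) : ℂ) := by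
      rw [sum_inner]
      push_cast
      refine Finset.sum_congr rfl fun n _ => ?_
      rw [← inner_conj_symm, h1, Complex.conj_ofReal]
      push_cast
      rfl
    have e2 : ⟪∑ n ∈ F, p n, ∑ n ∈ F, p n⟫_ℂ = ((∑ n ∈ F, ‖p n‖ ^ 2 : ℝ) : ℂ) := by
      rw [sum_inner]
      push_cast
      refine Finset.sum_congr rfl fun n hn => ?_
      rw [inner_sum, Finset.sum_eq_single n (fun m _ hm => h0 _ _ hm.symm) (fun h => (h hn).elim),
        inner_self_eq_norm_sq_to_K]
      rfl
    have e3 : ‖∑ n ∈ F, p n‖ ^ 2 = ∑ n ∈ F, ‖p n‖ ^ 2 := by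
      rw [inner_self_eq_norm_sq_to_K] at e2
      exact Complex.ofReal_injective (by push_cast at e2 ⊢; exact e2)
    rw [norm_sub_sq (𝕜 := ℂ), e1, e3, RCLike.re_eq_complex_re, Complex.ofReal_re]
    ring
  have h3 : Filter.Tendsto (fun F : Finset ℕ => ‖∑ n ∈ F, p n - q‖ ^ 2) Filter.atTop (nhds 0) := by
    simp only [key]
    have := (tendsto_const_nhds (x := ‖q‖ ^ 2)).sub h2
    simpa using this
  have h4 := h3.sqrt
  simp only [Real.sqrt_zero, Real.sqrt_sq (norm_nonneg _)] at h4
  exact tendsto_iff_norm_sub_tendsto_zero.2 h4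

theorem hasSum_cutoff {s : ℕ → Set ℝ} (hs : ∀ n, MeasurableSet (s n))
    (hd : Pairwise (Function.onFun Disjoint s)) (u : L2Star N) :
    HasSum (fun n => cutoff (hs n) u) (cutoff (MeasurableSet.iUnion hs) u) := by
  refine hasSum_of_inner_eq (fun m n hmn => ?_) (fun n => ?_) ?_
  · rw [inner_cutoff_left, cutoff_cutoff, cutoff_congr _ MeasurableSet.empty
      (disjoint_iff_inter_eq_empty.1 (hd hmn)), cutoff_empty, inner_zero_right]
  · have h1 : cutoff (hs n) u = cutoff (hs n) (cutoff (MeasurableSet.iUnion hs) u) := by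
      rw [cutoff_cutoff]
      exact cutoff_congr _ _ (inter_eq_left.2 (subset_iUnion s n)).symm u
    have h2 : cutoff (hs n) (cutoff (hs n) u) = cutoff (hs n) u := by
      rw [cutoff_cutoff]
      exact cutoff_congr _ _ (inter_self _) u
    rw [← h2, ← inner_cutoff_left, ← h1, inner_self_eq_norm_sq_to_K, h2]
    push_cast
    rfl
  · simp only [norm_sq_cutoff]
    exact hasSum_integral_iUnion hs hd (integrable_density u).integrableOn

theorem measurableSet_sq_preimage {s : Set ℝ} (hs : MeasurableSet s) :
    MeasurableSet ((fun ω : ℝ => ω ^ 2) ⁻¹' s) :=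
  (measurable_id.pow_const 2) hs

theorem isStarProjection_conj {H : Type*} [NormedAddCommGroup H] [InnerProductSpace ℂ H]
    [CompleteSpace H] (U : H ≃ₗᵢ[ℂ] H) {P : H →L[ℂ] H} (hP : IsStarProjection P) :
    IsStarProjection ((U.symm : H →L[ℂ] H) ∘L P ∘L (U : H →L[ℂ] H)) := by
  have hadj : ContinuousLinearMap.adjoint P = P := hP.isSelfAdjoint
  have hid : ∀ x, P (P x) = P x := fun x =>
    congrArg (fun T : H →L[ℂ] H => T x) hP.isIdempotentElem.eq
  refine ⟨?_, ?_⟩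
  · ext1 u
    simp [hid]
  · rw [ContinuousLinearMap.isSelfAdjoint_iff_isSymmetric]
    intro u v
    simp only [ContinuousLinearMap.coe_coe, ContinuousLinearMap.comp_apply]
    change ⟪U.symm (P (U u)), v⟫_ℂ = ⟪u, U.symm (P (U v))⟫_ℂ
    rw [← U.inner_map_map, U.apply_symm_apply, ← U.inner_map_map u, U.apply_symm_apply,
      ← ContinuousLinearMap.adjoint_inner_right, hadj]

open Classical in
/-- The spectral measure of the operator that the unitary `U` transforms to multiplication
by `ω²`. -/
noncomputable def multiplicationPVM (U : L2Star N ≃ₗᵢ[ℂ] L2Star N) :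
    ProjValuedMeasure (L2Star N) where
  -- The spectral parameter is λ = ω², so the cut-off is to the preimage of s. The value 0 on
  -- nonmeasurable sets is a mere default.
  proj s := if hs : MeasurableSet s then
    (U.symm : L2Star N →L[ℂ] L2Star N) ∘L cutoff (measurableSet_sq_preimage hs) ∘L
      (U : L2Star N →L[ℂ] L2Star N) else 0
  isStarProjection s hs := by
    rw [dif_pos hs]
    exact isStarProjection_conj U (isStarProjection_cutoff _)
  proj_univ := by
    rw [dif_pos MeasurableSet.univ]
    ext1 u
    change U.symm (cutoff (measurableSet_sq_preimage MeasurableSet.univ) (U u)) = u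
    rw [cutoff_congr (measurableSet_sq_preimage MeasurableSet.univ) MeasurableSet.univ
      preimage_univ, cutoff_univ, U.symm_apply_apply]
  hasSum_iUnion s hs hd u := by
    have h1 := hasSum_cutoff (fun n => measurableSet_sq_preimage (hs n))
      (fun m n hmn => (hd hmn).preimage _) (U u)
    have h2 := h1.mapL (U.symm : L2Star N →L[ℂ] L2Star N)
    rw [dif_pos (MeasurableSet.iUnion hs)]
    simp only [dif_pos (hs _)]
    change HasSum _ (U.symm (cutoff (measurableSet_sq_preimage (MeasurableSet.iUnion hs)) (U u)))
    rw [cutoff_congr (measurableSet_sq_preimage (MeasurableSet.iUnion hs))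
      (MeasurableSet.iUnion fun n => measurableSet_sq_preimage (hs n)) preimage_iUnion]
    exact h2

theorem apply_multiplicationPVM (U : L2Star N ≃ₗᵢ[ℂ] L2Star N) {s : Set ℝ} (hs : MeasurableSet s)
    (u : L2Star N) : U ((multiplicationPVM U).proj s u) =
      cutoff (measurableSet_sq_preimage hs) (U u) := by
  simp only [multiplicationPVM]
  rw [dif_pos hs]
  exact U.apply_symm_apply _

theorem scalarMeasure_multiplicationPVM (U : L2Star N ≃ₗᵢ[ℂ] L2Star N) (u : L2Star N) :
    (multiplicationPVM U).scalarMeasure u =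
      (μ₊.withDensity fun ω => ENNReal.ofReal (density (U u) ω)).map fun ω => ω ^ 2 := by
  ext s hs
  rw [ProjValuedMeasure.scalarMeasure_apply _ _ hs, Measure.map_apply (by fun_prop) hs,
    withDensity_apply _ (measurableSet_sq_preimage hs), ← U.norm_map, apply_multiplicationPVM U hs,
    norm_sq_cutoff, ofReal_integral_eq_lintegral_ofReal (integrable_density _).integrableOn
      (Filter.Eventually.of_forall fun ω => density_nonneg _ ω)]

theorem lintegral_scalarMeasure_multiplicationPVM (U : L2Star N ≃ₗᵢ[ℂ] L2Star N) (u : L2Star N) :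
    ∫⁻ l : ℝ, ENNReal.ofReal (l ^ 2) ∂((multiplicationPVM U).scalarMeasure u) =
      ∫⁻ ω, ENNReal.ofReal (∑ k, ‖((ω ^ 2 : ℝ) : ℂ) * U u k ω‖ ^ 2) ∂μ₊ := by
  rw [scalarMeasure_multiplicationPVM, lintegral_map (by fun_prop) (by fun_prop),
    lintegral_withDensity_eq_lintegral_mul _ (measurable_density _).ennreal_ofReal (by fun_prop)]
  congr 1 with ω
  rw [Pi.mul_apply, ← ENNReal.ofReal_mul (density_nonneg _ _), density, Finset.sum_mul]
  congr 1
  refine Finset.sum_congr rfl fun k _ => ?_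
  rw [norm_mul, Complex.norm_real, mul_pow, Real.norm_eq_abs, sq_abs, mul_comm]

theorem integral_scalarMeasure_multiplicationPVM (U : L2Star N ≃ₗᵢ[ℂ] L2Star N) (u : L2Star N) :
    ∫ l : ℝ, l ∂((multiplicationPVM U).scalarMeasure u) = ∫ ω, density (U u) ω * ω ^ 2 ∂μ₊ := by
  rw [scalarMeasure_multiplicationPVM, integral_map (by fun_prop) (by fun_prop),
    integral_withDensity_eq_integral_toReal_smul (measurable_density _).ennreal_ofReal
      (Filter.Eventually.of_forall fun _ => ENNReal.ofReal_lt_top)]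
  congr 1 with ω
  rw [ENNReal.toReal_ofReal (density_nonneg _ _), smul_eq_mul]

/-- If `U` transforms `A` to multiplication by `ω²`, then `multiplicationPVM U` is its spectral
resolution. -/
theorem isSpectralResolution_multiplicationPVM {A : L2Star N →ₗ.[ℂ] L2Star N}
    {U : L2Star N ≃ₗᵢ[ℂ] L2Star N}
    (hA : ∀ u w, (u, w) ∈ A.graph ↔ ∀ k, U w k =ᵐ[μ₊] fun ω => ((ω ^ 2 : ℝ) : ℂ) * U u k ω) :
    IsSpectralResolution A (multiplicationPVM U) := by
  have hm : ∀ u : L2Star N, ∀ k, AEStronglyMeasurable (fun ω : ℝ => ((ω ^ 2 : ℝ) : ℂ) * U u k ω) μ₊ :=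
    fun u k => (by fun_prop : Continuous fun ω : ℝ => ((ω ^ 2 : ℝ) : ℂ)).aestronglyMeasurable.mul
      (Lp.aestronglyMeasurable _)
  refine ⟨fun u => ?_, fun u => ?_⟩
  · have h1 : u ∈ A.domain ↔ ∃ w, (u, w) ∈ A.graph := LinearPMap.mem_domain_iff
    -- Since U is onto, an admissible w exists exactly when ω² times the transform of u is square
    -- integrable on every component.
    have h2 : (∃ w, (u, w) ∈ A.graph) ↔
        ∀ k, MemLp (fun ω : ℝ => ((ω ^ 2 : ℝ) : ℂ) * U u k ω) 2 μ₊ := by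
      simp only [hA]
      constructor
      · rintro ⟨w, hw⟩ k
        exact (Lp.memLp (U w k)).ae_eq (hw k)
      · intro h
        refine ⟨U.symm (mkL2Star _ h), fun k => ?_⟩
        rw [U.apply_symm_apply]
        exact mkL2Star_ae_eq _ h k
    have h3 : (∀ k, MemLp (fun ω : ℝ => ((ω ^ 2 : ℝ) : ℂ) * U u k ω) 2 μ₊) ↔
        Integrable (fun ω => ∑ k, ‖((ω ^ 2 : ℝ) : ℂ) * U u k ω‖ ^ 2) μ₊ := by
      constructor
      · exact fun h => integrable_finsetSum _ fun k _ => (h k).integrable_norm_pow (by norm_num)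
      · intro h k
        rw [memLp_two_iff_integrable_sq_norm (hm u k)]
        refine h.mono ((hm u k).norm.pow 2) (Filter.Eventually.of_forall fun ω => ?_)
        rw [Real.norm_of_nonneg (by positivity), Real.norm_of_nonneg (by positivity)]
        exact Finset.single_le_sum (f := fun k => ‖((ω ^ 2 : ℝ) : ℂ) * U u k ω‖ ^ 2)
          (fun _ _ => by positivity) (Finset.mem_univ k)
    rw [h1, h2, h3, lintegral_scalarMeasure_multiplicationPVM]
    rw [Integrable, hasFiniteIntegral_iff_ofReal (Filter.Eventually.of_forall fun ω =>
      Finset.sum_nonneg fun _ _ => by positivity)]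
    refine and_iff_right ?_
    exact Finset.aestronglyMeasurable_fun_sum _ fun k _ => (hm u k).norm.pow 2
  · have h1 : ((u : L2Star N), A u) ∈ A.graph := LinearPMap.mem_graph A u
    have h2 := (hA _ _).1 h1
    rw [integral_scalarMeasure_multiplicationPVM, ← U.inner_map_map, inner_eq_sum_integral,
      ← integral_finsetSum _ fun k _ => ?_, ← integral_complex_ofReal]
    · refine integral_congr_ae ?_
      filter_upwards [ae_all_iff.2 h2] with ω hω
      simp only [hω, density]
      push_cast
      rw [Finset.sum_mul]
      refine Finset.sum_congr rfl fun k _ => ?_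
      have := Complex.mul_conj (U (u : L2Star N) k ω)
      rw [Complex.normSq_eq_norm_sq] at this
      push_cast at this
      rw [← this]
      ring
    · exact (Lp.memLp (U (u : L2Star N) k)).star.integrable_mul (Lp.memLp (U (A u) k))

end MultiplicationPVM

/-! ### Laplace transforms of primitives and an L² bound on unit windows -/

section LaplaceOfPrimitive

theorem integrable_mul_integral {μ ν : Measure ℝ} [SFinite μ] [SFinite ν] {f g : ℝ → ℂ}
    (hf : Integrable f μ) (hg : Integrable g ν) {K : ℝ → ℝ → ℂ}
    (hK : Measurable (Function.uncurry K)) {C : ℝ} (hC : ∀ x y, ‖K x y‖ ≤ C) :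
    Integrable (fun x => f x * ∫ y, K x y * g y ∂ν) μ := by
  have hint : Integrable (Function.uncurry fun x y => K x y * (f x * g y)) (μ.prod ν) := by
    refine Integrable.bdd_mul (f := Function.uncurry K) (c := C) (hf.mul_prod hg)
      hK.aestronglyMeasurable (Filter.Eventually.of_forall fun z => hC _ _)
  refine hint.integral_prod_left.congr (Filter.Eventually.of_forall fun x => ?_)
  simp only [Function.uncurry_apply_pair]
  rw [← integral_const_mul]
  congr 1 with y
  ring

/-- The Laplace transform of a primitive. -/
theorem laplace_primitive {g : ℝ → ℂ} {s : ℝ} (hs : 0 < s)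
    (hg : IntegrableOn (fun y => (Real.exp (-(s / 2 * y)) : ℂ) * g y) (Ioi 0)) :
    IntegrableOn (fun x => (Real.exp (-(s * x)) : ℂ) * ∫ y in (0 : ℝ)..x, g y) (Ioi 0) ∧
    ∫ x in Ioi (0 : ℝ), (Real.exp (-(s * x)) : ℂ) * ∫ y in (0 : ℝ)..x, g y =
      (s : ℂ)⁻¹ * ∫ x in Ioi (0 : ℝ), (Real.exp (-(s * x)) : ℂ) * g x := by
  -- Writing e^{-sx} = e^{-sx/2} e^{-s(x-y)/2} e^{-sy/2} spends half of the decay on each variable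
  -- and leaves a kernel bounded by 1, as the Fubini lemma requires.
  set K : ℝ → ℝ → ℂ := fun x y => if y < x then (Real.exp (-(s / 2 * (x - y))) : ℂ) else 0 with hKdef
  have hK : Measurable (Function.uncurry K) := by
    refine Measurable.ite (measurableSet_lt measurable_snd measurable_fst) ?_ measurable_const
    fun_prop
  have hC : ∀ x y, ‖K x y‖ ≤ 1 := by
    intro x y
    simp only [hKdef]
    split_ifs with h
    · rw [Complex.norm_real, Real.norm_of_nonneg (Real.exp_pos _).le, Real.exp_le_one_iff]
      have : 0 < s / 2 * (x - y) := mul_pos (by linarith) (by linarith)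
      linarith
    · simp
  have hf := integrableOn_exp_neg_mul (half_pos hs)
  have e1 : ∀ x ∈ Ioi (0 : ℝ), (Real.exp (-(s / 2 * x)) : ℂ) *
      ∫ y in Ioi (0 : ℝ), K x y * ((Real.exp (-(s / 2 * y)) : ℂ) * g y) =
      (Real.exp (-(s * x)) : ℂ) * ∫ y in (0 : ℝ)..x, g y := by
    intro x hx
    have hx0 : (0 : ℝ) ≤ x := le_of_lt hx
    rw [intervalIntegral.integral_of_le hx0, ← integral_const_mul, ← integral_const_mul,
      integral_Ioc_eq_integral_Ioo, ← integral_indicator measurableSet_Ioo,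
      ← integral_indicator measurableSet_Ioi]
    congr 1 with y
    by_cases hy : y ∈ Ioo (0 : ℝ) x
    · rw [indicator_of_mem hy, indicator_of_mem (show y ∈ Ioi (0 : ℝ) from hy.1)]
      simp only [hKdef, if_pos hy.2]
      rw [← mul_assoc, ← mul_assoc, ← Complex.ofReal_mul, ← Complex.ofReal_mul, ← Real.exp_add,
        ← Real.exp_add]
      congr 3
      ring
    · rw [indicator_of_notMem hy]
      by_cases hy0 : y ∈ Ioi (0 : ℝ)
      · rw [indicator_of_mem hy0]
        have : ¬ y < x := fun h => hy ⟨hy0, h⟩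
        simp [hKdef, this]
      · rw [indicator_of_notMem hy0]
  have e2 : ∀ y ∈ Ioi (0 : ℝ), ((Real.exp (-(s / 2 * y)) : ℂ) * g y) *
      ∫ x in Ioi (0 : ℝ), K x y * (Real.exp (-(s / 2 * x)) : ℂ) =
      (s : ℂ)⁻¹ * ((Real.exp (-(s * y)) : ℂ) * g y) := by
    intro y hy
    have e3 : ∫ x in Ioi (0 : ℝ), K x y * (Real.exp (-(s / 2 * x)) : ℂ) =
        (Real.exp (s / 2 * y) : ℂ) * ((s⁻¹ * Real.exp (-(s * y)) : ℝ) : ℂ) := by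
      have e4 : ∫ x in Ioi y, Real.exp (-(s * x)) = s⁻¹ * Real.exp (-(s * y)) := by
        have := integral_exp_mul_Ioi (a := -s) (by linarith) y
        rw [neg_div_neg_eq] at this
        simp only [neg_mul] at this
        rw [this]
        ring
      rw [← e4, ← integral_complex_ofReal, ← integral_const_mul, ← integral_indicator
        measurableSet_Ioi, ← integral_indicator measurableSet_Ioi]
      congr 1 with x
      have hy0 : (0 : ℝ) < y := hy
      by_cases hx : x ∈ Ioi y
      · rw [indicator_of_mem hx, indicator_of_mem (show x ∈ Ioi (0 : ℝ) from hy0.trans hx)]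
        simp only [hKdef, if_pos (show y < x from hx)]
        rw [← Complex.ofReal_mul, ← Complex.ofReal_mul, ← Real.exp_add, ← Real.exp_add]
        congr 2
        ring
      · rw [indicator_of_notMem hx]
        have : ¬ y < x := hx
        by_cases hx0 : x ∈ Ioi (0 : ℝ)
        · rw [indicator_of_mem hx0]
          simp [hKdef, this]
        · rw [indicator_of_notMem hx0]
    rw [e3]
    have e5 : (Real.exp (-(s / 2 * y)) : ℂ) * (Real.exp (s / 2 * y) : ℂ) = 1 := by
      rw [← Complex.ofReal_mul, ← Real.exp_add]
      simp
    push_cast at e5 ⊢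
    linear_combination (g y * (s : ℂ)⁻¹ * Complex.exp (-(s * y))) * e5
  constructor
  · exact (integrable_mul_integral hf hg hK hC).congr
      ((ae_restrict_iff' measurableSet_Ioi).2 (Filter.Eventually.of_forall e1))
  · have h := integral_mul_integral_swap hf hg hK hC
    rw [setIntegral_congr_fun measurableSet_Ioi e1, setIntegral_congr_fun measurableSet_Ioi e2,
      integral_const_mul] at h
    exact h

/-- Nonnegativity of the variance. -/
theorem sq_integral_le_integral_sq {μ : Measure ℝ} [IsProbabilityMeasure μ] {f : ℝ → ℝ}
    (hf : MemLp f 2 μ) : (∫ x, f x ∂μ) ^ 2 ≤ ∫ x, f x ^ 2 ∂μ := by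
  have h1 : Integrable f μ := hf.integrable (by norm_num)
  have h2 : Integrable (fun x => f x ^ 2) μ := hf.integrable_sq
  set c := ∫ x, f x ∂μ with hc
  have h3 : 0 ≤ ∫ x, (f x - c) ^ 2 ∂μ := integral_nonneg fun x => sq_nonneg _
  have e : ∀ x, (f x - c) ^ 2 = f x ^ 2 - 2 * c * f x + c ^ 2 := fun x => by ring
  have h4 : Integrable (fun x => 2 * c * f x) μ := h1.const_mul _
  have h5 : Integrable (fun x => f x ^ 2 - 2 * c * f x) μ := h2.sub h4
  simp only [e] at h3
  rw [integral_add h5 (integrable_const _), integral_sub h2 h4, integral_const_mul, ← hc] at h3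
  simp only [integral_const, smul_eq_mul, probReal_univ, one_mul] at h3
  linarith

/-- Jensen on the unit window and translation invariance. It serves to bound a first derivative in
L² by the function and its second derivative. -/
theorem memLp_integral_window {f : ℝ → ℝ} (hf : MemLp f 2) (hfm : Measurable f) :
    MemLp (fun x => ∫ r in Ioc (0 : ℝ) 1, f (x + r)) 2 := by
  have : IsProbabilityMeasure (volume.restrict (Ioc (0 : ℝ) 1)) := ⟨by simp⟩
  have hm : Measurable fun z : ℝ × ℝ => f (z.1 + z.2) := hfm.comp (measurable_fst.add measurable_snd)
  have hms : AEStronglyMeasurable (fun x => ∫ r in Ioc (0 : ℝ) 1, f (x + r)) volume :=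
    (hm.stronglyMeasurable.integral_prod_right' (ν := volume.restrict (Ioc (0 : ℝ) 1))
      ).aestronglyMeasurable
  have hint : Integrable (fun z : ℝ × ℝ => f (z.1 + z.2) ^ 2)
      (volume.prod (volume.restrict (Ioc (0 : ℝ) 1))) := by
    rw [integrable_prod_iff' (hm.pow_const 2).aestronglyMeasurable]
    constructor
    · exact Filter.Eventually.of_forall fun r => hf.integrable_sq.comp_add_right r
    · have : ∀ r : ℝ, ∫ x, ‖f (x + r) ^ 2‖ = ∫ x, ‖f x ^ 2‖ := fun r =>
        integral_add_right_eq_self (fun x => ‖f x ^ 2‖) r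
      simp only [this]
      exact integrable_const _
  have h1 := hint.integral_prod_left
  rw [memLp_two_iff_integrable_sq hms]
  refine h1.mono (hms.pow 2) (Filter.Eventually.of_forall fun x => ?_)
  rw [Real.norm_of_nonneg (sq_nonneg _),
    Real.norm_of_nonneg (integral_nonneg fun r => sq_nonneg _)]
  refine sq_integral_le_integral_sq ?_
  exact (hf.comp_measurePreserving (measurePreserving_add_left volume x)).restrict _

end LaplaceOfPrimitive

/-! ### The Hamiltonian is multiplication by ω² in the transform -/

section GraphCharacterization

variable {N : ℕ}

/-- The Laplace transform. -/
noncomputable def laplace (g : ℝ → ℂ) (s : ℝ) : ℂ :=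
  ∫ x in Ioi (0 : ℝ), (Real.exp (-(s * x)) : ℂ) * g x

theorem integrableOn_exp_mul_L2 {g : ℝ → ℂ} (hg : MemLp g 2 μ₊) {s : ℝ} (hs : 0 < s) :
    IntegrableOn (fun x => (Real.exp (-(s * x)) : ℂ) * g x) (Ioi 0) :=
  (memLp_exp_neg_mul hs).integrable_mul hg

theorem laplace_congr {g h : ℝ → ℂ} (hgh : g =ᵐ[μ₊] h) (s : ℝ) : laplace g s = laplace h s := by
  refine integral_congr_ae ?_
  filter_upwards [hgh] with x hx
  rw [hx]

theorem laplace_add_L2 (u v : Lp ℂ 2 μ₊) {s : ℝ} (hs : 0 < s) :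
    laplace (u + v : Lp ℂ 2 μ₊) s = laplace u s + laplace v s := by
  rw [laplace_congr (Lp.coeFn_add u v), laplace, laplace, laplace,
    ← integral_add (integrableOn_exp_mul_L2 (Lp.memLp u) hs)
      (integrableOn_exp_mul_L2 (Lp.memLp v) hs)]
  simp only [Pi.add_apply, mul_add]

theorem laplace_smul_L2 (c : ℂ) (u : Lp ℂ 2 μ₊) (s : ℝ) :
    laplace (c • u : Lp ℂ 2 μ₊) s = c * laplace u s := by
  rw [laplace_congr (Lp.coeFn_smul c u), laplace, laplace, ← integral_const_mul]
  refine integral_congr_ae (Filter.Eventually.of_forall fun x => ?_)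
  simp only [Pi.smul_apply, smul_eq_mul]
  ring

theorem integral_exp_neg_mul_complex {s : ℝ} (hs : 0 < s) :
    ∫ x in Ioi (0 : ℝ), (Real.exp (-(s * x)) : ℂ) = (s : ℂ)⁻¹ := by
  rw [integral_complex_ofReal]
  have := integral_exp_mul_Ioi (a := -s) (by linarith) 0
  simp only [neg_mul, mul_zero, Real.exp_zero] at this
  rw [this]
  push_cast
  rw [neg_div_neg_eq, one_div]

/-- The Laplace transform of a function with prescribed initial value and derivative. -/
theorem laplace_of_primitive {f g : ℝ → ℂ} {c : ℂ} {s : ℝ} (hs : 0 < s)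
    (hg : IntegrableOn (fun y => (Real.exp (-(s / 2 * y)) : ℂ) * g y) (Ioi 0))
    (hf : ∀ x, 0 ≤ x → f x = c + ∫ t in (0 : ℝ)..x, g t) :
    IntegrableOn (fun x => (Real.exp (-(s * x)) : ℂ) * f x) (Ioi 0) ∧
    laplace f s = (s : ℂ)⁻¹ * (c + laplace g s) := by
  obtain ⟨h1, h2⟩ := laplace_primitive hs hg
  have h3 : IntegrableOn (fun x => (Real.exp (-(s * x)) : ℂ) * c) (Ioi 0) :=
    (integrableOn_exp_neg_mul hs).mul_const c
  have e : ∀ x ∈ Ioi (0 : ℝ), (Real.exp (-(s * x)) : ℂ) * c +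
      (Real.exp (-(s * x)) : ℂ) * ∫ y in (0 : ℝ)..x, g y = (Real.exp (-(s * x)) : ℂ) * f x := by
    intro x hx
    rw [hf x (le_of_lt hx), mul_add]
  refine ⟨(h3.add h1).congr ((ae_restrict_iff' measurableSet_Ioi).2
    (Filter.Eventually.of_forall e)), ?_⟩
  rw [laplace, ← setIntegral_congr_fun measurableSet_Ioi e, integral_add h3 h1, h2,
    integral_mul_const, integral_exp_neg_mul_complex hs, laplace]
  ring

/-- Two applications of the rule for primitives. The boundary data enter only through a polynomial
of degree one in s, which is where the vertex condition becomes visible. -/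
theorem IsH2Representative.laplace_eq {u w : L2Star N} {f f' : Fin N → ℝ → ℂ}
    (h : IsH2Representative u w f f') {s : ℝ} (hs : 0 < s) (j : Fin N) :
    laplace (w j) s = f' j 0 + s * f j 0 - (s : ℂ) ^ 2 * laplace (u j) s := by
  have h1 := (laplace_of_primitive hs (integrableOn_exp_mul_L2 (h.memLp j) (half_pos hs))
    (h.eq_integral j)).2
  have hw : MemLp (fun x => -(w j x)) 2 μ₊ := (Lp.memLp (w j)).neg
  have h2 := (laplace_of_primitive (f := f' j) (c := f' j 0) hs
    (integrableOn_exp_mul_L2 hw (half_pos hs)) fun x hx => by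
      rw [intervalIntegral.integral_neg, ← sub_eq_add_neg, h.deriv_eq_integral j x hx]).2
  have h3 : laplace (fun x => -(w j x)) s = - laplace (w j) s := by
    simp only [laplace, mul_neg, integral_neg]
  have hs' : (s : ℂ) ≠ 0 := by exact_mod_cast hs.ne'
  rw [laplace_congr (h.ae_eq j), h1, h2, h3]
  field_simp
  ring

/-- After multiplication by s² + ω² the dependence on s is only through a matrix on the edges,
acting as 1 on vectors of sum zero and as s + κ on constants. Comparing s with σ leaves the ratio
(s+κ)/(σ+κ) on the constants. -/
theorem eigenfunctionLaplace_mul {κ s σ : ℝ} (hN : 0 < N) (hκ : 0 ≤ κ) (hs : 0 < s) (hσ : 0 < σ)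
    (k j : Fin N) (ω : ℝ) :
    eigenfunctionLaplace N κ k j s ω * (s ^ 2 + ω ^ 2) =
      (σ ^ 2 + ω ^ 2) * ∑ i, edgeMix N 1 ((s + κ) / (σ + κ)) i j *
        eigenfunctionLaplace N κ k i σ ω := by
  have h1 := sum_edgeMix_mul_edgeMix hN 1 ((s + κ) / (σ + κ)) (sinLaplace σ ω)
    (robinLaplace κ σ ω) j k
  have e : ∀ i, edgeMix N 1 ((s + κ) / (σ + κ)) i j * eigenfunctionLaplace N κ k i σ ω =
      √(2 / Real.pi) * (edgeMix N 1 ((s + κ) / (σ + κ)) i j *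
        edgeMix N (sinLaplace σ ω) (robinLaplace κ σ ω) i k) := by
    intro i
    rw [eigenfunctionLaplace, edgeMix_comm _ _ k i]
    ring
  simp only [e]
  rw [← Finset.mul_sum, h1, eigenfunctionLaplace, edgeMix_comm _ _ j k]
  have a1 : s ^ 2 + ω ^ 2 ≠ 0 := by positivity
  have a2 : σ ^ 2 + ω ^ 2 ≠ 0 := by positivity
  have a3 : σ + κ ≠ 0 := by positivity
  simp only [edgeMix, sinLaplace, robinLaplace]
  field_simp

/-- The preceding identity integrated against the transform of v. It expresses p = (H + σ²)v through
Laplace transforms only, and the data at σ determine the right-hand side for every s. -/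
theorem laplace_resolvent {κ s σ : ℝ} (hN : 0 < N) (hκ : 0 ≤ κ) (hs : 0 < s) (hσ : 0 < σ)
    {U : L2Star N ≃ₗᵢ[ℂ] L2Star N} (hU : IsEigenTransform κ U) {p v : L2Star N}
    (h : ∀ k, U p k =ᵐ[μ₊] fun ω => ((σ ^ 2 + ω ^ 2 : ℝ) : ℂ) * U v k ω) (j : Fin N) :
    laplace (p j) s + ((s : ℂ) ^ 2 - (σ : ℂ) ^ 2) * laplace (v j) s =
      ∑ i, (edgeMix N 1 ((s + κ) / (σ + κ)) i j : ℂ) * laplace (p i) σ := by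
  have hp : ∀ s > 0, ∀ j, laplace (p j) s = _ := fun s hs j => hU s hs j p
  have hv : laplace (v j) s = _ := hU s hs j v
  simp only [hp s hs, hp σ hσ, hv, Finset.mul_sum]
  rw [Finset.sum_comm, ← Finset.sum_add_distrib]
  refine Finset.sum_congr rfl fun k _ => ?_
  simp only [← integral_const_mul]
  rw [← integral_add (integrable_mul_L2 (memLp_eigenfunctionLaplace hκ hs k j) _)
    ((integrable_mul_L2 (memLp_eigenfunctionLaplace hκ hs k j) _).const_mul _),
    ← integral_finsetSum _ fun i _ =>
      (integrable_mul_L2 (memLp_eigenfunctionLaplace hκ hσ k i) _).const_mul _]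
  refine integral_congr_ae ?_
  filter_upwards [h k] with ω hω
  have e := congrArg (fun x : ℝ => (x : ℂ)) (eigenfunctionLaplace_mul hN hκ hs hσ k j ω)
  simp only [hω]
  push_cast at e ⊢
  have e2 : ∀ i, (edgeMix N 1 ((s + κ) / (σ + κ)) i j : ℂ) * ((eigenfunctionLaplace N κ k i σ ω : ℂ) *
      (((σ : ℂ) ^ 2 + (ω : ℂ) ^ 2) * U v k ω)) = ((σ : ℂ) ^ 2 + (ω : ℂ) ^ 2) *
      ((edgeMix N 1 ((s + κ) / (σ + κ)) i j : ℂ) * (eigenfunctionLaplace N κ k i σ ω : ℂ)) *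
        U v k ω := fun i => by ring
  simp only [e2]
  rw [← Finset.sum_mul, ← Finset.mul_sum, ← e]
  ring

/-- The Hamiltonian is contained in multiplication by `ω²`. -/
theorem eigenTransform_of_mem_hamiltonianGraph {κ α : ℝ} (hN : 0 < N) (hκ : 0 ≤ κ)
    (hα : α = N * κ) {U : L2Star N ≃ₗᵢ[ℂ] L2Star N} (hU : IsEigenTransform κ U) {u w : L2Star N}
    (h : (u, w) ∈ hamiltonianGraph N α) (k : Fin N) :
    U w k =ᵐ[μ₊] fun ω => ((ω ^ 2 : ℝ) : ℂ) * U u k ω := by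
  obtain ⟨f, f', hf, hb⟩ := h
  simp only at hf
  have hN' : (N : ℂ) ≠ 0 := by exact_mod_cast hN.ne'
  -- Laplace transforms are compared at points s ≥ 1, so any σ in (0, 1) keeps s² - σ² away from
  -- zero.
  set σ : ℝ := 1 / 2 with hσdef
  have hσ : 0 < σ := by norm_num [hσdef]
  -- Here g plays the role of (H + σ²)u, and v below is g divided by σ² + ω² on the transform side.
  -- It remains to see v = u, by comparing Laplace transforms.
  set g : L2Star N := w + ((σ : ℂ) ^ 2) • u with hg
  have hmem : ∀ k, MemLp (fun ω : ℝ => (((σ ^ 2 + ω ^ 2)⁻¹ : ℝ) : ℂ) * U g k ω) 2 μ₊ := by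
    intro k
    refine MemLp.of_le_mul (c := (σ ^ 2)⁻¹) (Lp.memLp (U g k)) ?_ (Filter.Eventually.of_forall ?_)
    · refine AEStronglyMeasurable.mul ?_ (Lp.aestronglyMeasurable _)
      exact Measurable.aestronglyMeasurable (by fun_prop)
    · intro ω
      rw [norm_mul, Complex.norm_real, Real.norm_of_nonneg (by positivity)]
      refine mul_le_mul_of_nonneg_right (inv_anti₀ (by positivity) ?_) (norm_nonneg _)
      nlinarith [sq_nonneg ω]
  set v : L2Star N := U.symm (mkL2Star _ hmem) with hv
  have hUv : ∀ k, U v k =ᵐ[μ₊] fun ω => (((σ ^ 2 + ω ^ 2)⁻¹ : ℝ) : ℂ) * U g k ω := by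
    intro k
    rw [hv, U.apply_symm_apply]
    exact mkL2Star_ae_eq _ hmem k
  have hUg : ∀ k, U g k =ᵐ[μ₊] fun ω => ((σ ^ 2 + ω ^ 2 : ℝ) : ℂ) * U v k ω := by
    intro k
    filter_upwards [hUv k] with ω hω
    rw [hω, ← mul_assoc, ← Complex.ofReal_mul, mul_inv_cancel₀ (by positivity)]
    simp
  have hLg : ∀ s > 0, ∀ j, laplace (g j) s =
      f' j 0 + s * f j 0 - ((s : ℂ) ^ 2 - (σ : ℂ) ^ 2) * laplace (u j) s := by
    intro s hs j
    have : g j = w j + ((σ : ℂ) ^ 2) • u j := rfl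
    rw [this, laplace_add_L2 _ _ hs, laplace_smul_L2, hf.laplace_eq hs j]
    ring
  have hvu : v = u := by
    rw [← sub_eq_zero]
    refine eq_zero_of_laplace_eq_zero fun s hs j => ?_
    have hs0 : 0 < s := one_pos.trans_le hs
    have h1 := laplace_resolvent hN hκ hs0 hσ hU hUg j
    have hσκ : (σ : ℂ) + κ ≠ 0 := by
      have : σ + κ ≠ 0 := by positivity
      exact_mod_cast this
    rw [sum_edgeMix_mul, hLg s hs0 j] at h1
    -- The mean over i of these values is (σ+κ)u(0), by the derivative condition. Replacing it by
    -- (s+κ)u(0) turns f'_j(0) + σu(0) into f'_j(0) + su(0), the polynomial for g at s.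
    have h0 : ∀ i, laplace (g i) σ = f' i 0 + σ * f j 0 := by
      intro i
      rw [hLg σ hσ, show f i 0 = f j 0 from hb.1 i j]
      ring
    have h00 : ∑ i, f' i 0 = α * f j 0 := hb.2 j
    simp only [h0, Finset.sum_add_distrib, h00, Finset.sum_const, Finset.card_univ, Fintype.card_fin, nsmul_eq_mul,
      hα] at h1
    have h2 : ((s : ℂ) ^ 2 - (σ : ℂ) ^ 2) * (laplace (v j) s - laplace (u j) s) = 0 := by
      push_cast at h1
      field_simp at h1
      refine mul_left_cancel₀ hσκ ?_
      linear_combination h1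
    have h3 : ((s : ℂ) ^ 2 - (σ : ℂ) ^ 2) ≠ 0 := by
      have : s ^ 2 - σ ^ 2 ≠ 0 := by
        have : σ ^ 2 < s ^ 2 := by rw [hσdef]; nlinarith
        linarith
      exact_mod_cast this
    have h4 : (v - u) j = v j + (-1 : ℂ) • u j := by
      rw [neg_one_smul, ← sub_eq_add_neg]
      rfl
    change laplace ((v - u) j) s = 0
    rw [h4, laplace_add_L2 _ _ hs0, laplace_smul_L2]
    linear_combination (mul_eq_zero.1 h2).resolve_left h3
  have hw : U w k = U g k + (-((σ : ℂ) ^ 2)) • U u k := by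
    have : w = g + (-((σ : ℂ) ^ 2)) • u := by
      rw [hg]
      module
    conv_lhs => rw [this, map_add, map_smul]
    rfl
  rw [hw]
  filter_upwards [Lp.coeFn_add (U g k) ((-((σ : ℂ) ^ 2)) • U u k),
    Lp.coeFn_smul (-((σ : ℂ) ^ 2)) (U u k), hUg k] with ω h1 h2 h3
  rw [h1, Pi.add_apply, h2, Pi.smul_apply, h3, hvu, smul_eq_mul]
  push_cast
  ring

/-- Multiplication by `ω²` is contained in the Hamiltonian. -/
theorem mem_hamiltonianGraph_of_eigenTransform {κ α : ℝ} (hN : 0 < N) (hκ : 0 ≤ κ)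
    (hα : α = N * κ) {U : L2Star N ≃ₗᵢ[ℂ] L2Star N} (hU : IsEigenTransform κ U) {u w : L2Star N}
    (h : ∀ k, U w k =ᵐ[μ₊] fun ω => ((ω ^ 2 : ℝ) : ℂ) * U u k ω) :
    (u, w) ∈ hamiltonianGraph N α := by
  have hN' : (N : ℂ) ≠ 0 := by exact_mod_cast hN.ne'
  have hκ1 : (1 : ℂ) + κ ≠ 0 := by
    have : 1 + κ ≠ 0 := by positivity
    exact_mod_cast this
  -- The boundary values are read off at σ = 1: with a = u(0) and b_j = u_j'(0) one needs q_j = b_j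
  -- + a, and Σ b_j = Nκa makes the mean of the q_j equal to (1+κ)a.
  let q : Fin N → ℂ := fun j => laplace ((u + w) j) 1
  let a : ℂ := ((N : ℂ)⁻¹ * ∑ i, q i) / (1 + κ)
  let b : Fin N → ℂ := fun j => q j - a
  have hL : ∀ s > 0, ∀ j, laplace (w j) s + (s : ℂ) ^ 2 * laplace (u j) s = b j + s * a := by
    intro s hs j
    have hp : ∀ k, U (u + w) k =ᵐ[μ₊] fun ω => ((1 ^ 2 + ω ^ 2 : ℝ) : ℂ) * U u k ω := by
      intro k
      have e : U (u + w) k = U u k + U w k := by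
        rw [map_add]
        rfl
      rw [e]
      filter_upwards [Lp.coeFn_add (U u k) (U w k), h k] with ω h1 h2
      rw [h1, Pi.add_apply, h2]
      push_cast
      ring
    have h1 := laplace_resolvent hN hκ hs one_pos hU hp j
    rw [sum_edgeMix_mul, show (u + w) j = u j + w j from rfl, laplace_add_L2 _ _ hs] at h1
    change _ = ((1 : ℝ) : ℂ) * (q j - (N : ℂ)⁻¹ * ∑ i, q i) + _ * ((N : ℂ)⁻¹ * ∑ i, q i) at h1
    have ha : (N : ℂ)⁻¹ * ∑ i, q i = a * (1 + κ) := (div_mul_cancel₀ _ hκ1).symm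
    rw [ha] at h1
    have h2 : (((s + κ) / (1 + κ) : ℝ) : ℂ) * (a * (1 + κ)) = a * (s + κ) := by
      push_cast
      field_simp
    rw [h2] at h1
    simp only [b]
    push_cast at h1
    linear_combination h1
  have hb : ∑ j, b j = α * a := by
    have ha : ∑ i, q i = N * (a * (1 + κ)) := by
      simp only [a]
      field_simp
    simp only [b, Finset.sum_sub_distrib, ha, hα, Finset.sum_const, Finset.card_univ,
      Fintype.card_fin, nsmul_eq_mul]
    push_cast
    ring
  -- Extension of w by zero, so that primitives are defined and continuous on the whole line.
  let W : Fin N → ℝ → ℂ := fun j => (Ioi (0 : ℝ)).indicator (w j)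
  have hW : ∀ j, MemLp (W j) 2 volume := fun j =>
    (memLp_indicator_iff_restrict measurableSet_Ioi).2 (Lp.memLp (w j))
  have hWm : ∀ j, Measurable (W j) := fun j =>
    (Lp.stronglyMeasurable (w j)).measurable.indicator measurableSet_Ioi
  have hWi : ∀ j x y, IntervalIntegrable (W j) volume x y := fun j x y =>
    (((hW j).locallyIntegrable (by norm_num)).integrableOn_isCompact
      isCompact_uIcc).intervalIntegrable
  have hWw : ∀ j, W j =ᵐ[μ₊] w j := fun j =>
    (ae_restrict_iff' measurableSet_Ioi).2 (Filter.Eventually.of_forall fun x hx =>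
      indicator_of_mem hx _)
  let f' : Fin N → ℝ → ℂ := fun j x => b j - ∫ t in (0 : ℝ)..x, W j t
  let f : Fin N → ℝ → ℂ := fun j x => a + ∫ t in (0 : ℝ)..x, f' j t
  have hf'c : ∀ j, Continuous (f' j) := fun j =>
    continuous_const.sub (intervalIntegral.continuous_primitive (hWi j) 0)
  have hfc : ∀ j, Continuous (f j) := fun j =>
    continuous_const.add (intervalIntegral.continuous_primitive
      (fun x y => (hf'c j).intervalIntegrable x y) 0)
  have hWp : ∀ j, MemLp (fun x => -(W j x)) 2 μ₊ := fun j => ((hW j).restrict _).neg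
  have hlap : ∀ s > 0, ∀ j, IntegrableOn (fun x => (Real.exp (-(s * x)) : ℂ) * f j x) (Ioi 0) ∧
      laplace (f j) s = laplace (u j) s := by
    intro s hs j
    have h1 : ∀ s > 0, IntegrableOn (fun x => (Real.exp (-(s * x)) : ℂ) * f' j x) (Ioi 0) ∧
        laplace (f' j) s = (s : ℂ)⁻¹ * (b j + laplace (fun x => -(W j x)) s) := fun s hs =>
      laplace_of_primitive hs (integrableOn_exp_mul_L2 (hWp j) (half_pos hs)) fun x _ => by
        rw [intervalIntegral.integral_neg, ← sub_eq_add_neg]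
    have h2 : laplace (fun x => -(W j x)) s = - laplace (w j) s := by
      rw [← laplace_congr (hWw j)]
      simp only [laplace, mul_neg, integral_neg]
    obtain ⟨h3, h4⟩ := laplace_of_primitive (f := f j) (c := a) hs (h1 _ (half_pos hs)).1
      fun x _ => rfl
    refine ⟨h3, ?_⟩
    have hs' : (s : ℂ) ≠ 0 := by exact_mod_cast hs.ne'
    rw [h4, (h1 s hs).2, h2]
    field_simp
    linear_combination -hL s hs j
  -- The function f integrates -w twice from the boundary values a and b_j, hence has the Laplace
  -- transform of u at every s > 0.
  have hfu : ∀ j, u j =ᵐ[μ₊] f j := by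
    intro j
    have hi : ∀ s > 0, IntegrableOn (fun x => (Real.exp (-(s * x)) : ℂ) * u j x) (Ioi 0) :=
      fun s hs => integrableOn_exp_mul_L2 (Lp.memLp (u j)) hs
    have h0 : (fun x => u j x - f j x) =ᵐ[μ₊] 0 := by
      refine ae_eq_zero_of_laplace_eq_zero (c := 1) ?_ fun n => ?_
      · simp only [mul_sub]
        exact (hi 1 one_pos).sub (hlap 1 one_pos j).1
      · have hn : (0 : ℝ) < 1 + n := by positivity
        simp only [mul_sub]
        rw [integral_sub (hi _ hn) (hlap _ hn j).1, sub_eq_zero]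
        exact (hlap _ hn j).2.symm
    filter_upwards [h0] with x hx
    exact sub_eq_zero.1 hx
  have hF : ∀ j, MemLp ((Ioi (0 : ℝ)).indicator (f j)) 2 volume := fun j =>
    (memLp_indicator_iff_restrict measurableSet_Ioi).2 ((memLp_congr_ae (hfu j)).1 (Lp.memLp (u j)))
  have hF1 : ∀ j, MemLp (fun x => (Ioi (0 : ℝ)).indicator (f j) (x + 1)) 2 volume := fun j =>
    (hF j).comp_measurePreserving (measurePreserving_add_right volume 1)
  have hwin : ∀ j, MemLp (fun x => ∫ r in Ioc (0 : ℝ) 1, ‖W j (x + r)‖) 2 volume := fun j =>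
    memLp_integral_window (hW j).norm (hWm j).norm
  refine ⟨f, f', ⟨hfu, fun j => ?_, fun j x hx => ?_, fun j x hx => ?_⟩, fun j k => ?_, fun k => ?_⟩
  -- Square integrability of f' has to be derived: f'(x) is f(x+1) - f(x) plus the mean over [x,
  -- x+1] of f'(x) - f'(t), and the latter is at most the integral of |W| over that window.
  · have hg := (((hF1 j).norm.add (hF j).norm).add (hwin j)).restrict (Ioi 0)
    refine hg.mono' (hf'c j).aestronglyMeasurable ?_
    refine (ae_restrict_iff' measurableSet_Ioi).2 (Filter.Eventually.of_forall fun x hx => ?_)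
    have hx0 : (0 : ℝ) < x := hx
    simp only [Pi.add_apply]
    rw [indicator_of_mem (show x ∈ Ioi (0 : ℝ) from hx),
      indicator_of_mem (show x + 1 ∈ Ioi (0 : ℝ) from by
        rw [mem_Ioi]
        linarith)]
    have e1 : f j (x + 1) - f j x = ∫ t in x..x + 1, f' j t := by
      simp only [f]
      rw [add_sub_add_left_eq_sub, intervalIntegral.integral_interval_sub_left
        ((hf'c j).intervalIntegrable _ _) ((hf'c j).intervalIntegrable _ _)]
    have e2 : f' j x = (f j (x + 1) - f j x) + ∫ t in x..x + 1, (f' j x - f' j t) := by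
      rw [intervalIntegral.integral_sub (by simp) ((hf'c j).intervalIntegrable _ _), e1]
      simp
    have e3 : ‖∫ t in x..x + 1, (f' j x - f' j t)‖ ≤
        (∫ r in Ioc (0 : ℝ) 1, ‖W j (x + r)‖) * |x + 1 - x| := by
      refine intervalIntegral.norm_integral_le_of_norm_le_const fun t ht => ?_
      rw [uIoc_of_le (by linarith)] at ht
      have e4 : f' j x - f' j t = ∫ z in x..t, W j z := by
        simp only [f']
        rw [sub_sub_sub_cancel_left, intervalIntegral.integral_interval_sub_left (hWi j _ _)
          (hWi j _ _)]
      rw [e4]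
      refine (intervalIntegral.norm_integral_le_integral_norm ht.1.le).trans ?_
      have e5 : ∫ r in Ioc (0 : ℝ) 1, ‖W j (x + r)‖ = ∫ z in x..x + 1, ‖W j z‖ := by
        rw [← intervalIntegral.integral_of_le zero_le_one,
          intervalIntegral.integral_comp_add_left (fun z => ‖W j z‖) x, add_zero]
      rw [e5]
      exact intervalIntegral.integral_mono_interval le_rfl ht.1.le ht.2
        (Filter.Eventually.of_forall fun z => norm_nonneg _) (hWi j _ _).norm
    rw [add_sub_cancel_left, abs_one, mul_one] at e3
    rw [e2]
    exact (norm_add_le _ _).trans (add_le_add (norm_sub_le _ _) e3)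
  · simp [f]
  · simp only [f', intervalIntegral.integral_same, sub_zero]
    rw [integral_congr_L2 (hWw j) hx]
  · simp [f]
  · simpa [f, f'] using hb

theorem mem_hamiltonianGraph_iff {κ α : ℝ} (hN : 0 < N) (hκ : 0 ≤ κ) (hα : α = N * κ)
    {U : L2Star N ≃ₗᵢ[ℂ] L2Star N} (hU : IsEigenTransform κ U) (u w : L2Star N) :
    (u, w) ∈ hamiltonianGraph N α ↔ ∀ k, U w k =ᵐ[μ₊] fun ω => ((ω ^ 2 : ℝ) : ℂ) * U u k ω :=
  ⟨eigenTransform_of_mem_hamiltonianGraph hN hκ hα hU,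
    mem_hamiltonianGraph_of_eigenTransform hN hκ hα hU⟩

theorem isSpectralResolution_hamiltonian {κ α : ℝ} (hN : 0 < N) (hκ : 0 ≤ κ) (hα : α = N * κ)
    {U : L2Star N ≃ₗᵢ[ℂ] L2Star N} (hU : IsEigenTransform κ U) :
    IsSpectralResolution (hamiltonian N α) (multiplicationPVM U) :=
  isSpectralResolution_multiplicationPVM fun u w => by
    rw [hamiltonian_graph, mem_hamiltonianGraph_iff hN hκ hα hU]

end GraphCharacterization

/-! ### The kernel of the spectral projection -/

section SpectralKernel

variable {N : ℕ}

theorem measurable_eigenfunction_swap (κ : ℝ) (k j : Fin N) :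
    Measurable (Function.uncurry fun x ω => (eigenfunction N κ k j ω x : ℂ)) := by
  unfold eigenfunction edgeMix robin Function.uncurry
  fun_prop

theorem measurable_eigenfunction_frequency (κ : ℝ) (k j : Fin N) (x : ℝ) :
    Measurable fun ω => eigenfunction N κ k j ω x := by
  unfold eigenfunction edgeMix robin
  fun_prop

theorem robin_mul_robin (κ ω x y : ℝ) : robin κ ω x * robin κ ω y =
    (ω * Real.cos (ω * x) + κ * Real.sin (ω * x)) * (ω * Real.cos (ω * y) + κ * Real.sin (ω * y)) *
      (κ ^ 2 + ω ^ 2)⁻¹ := by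
  rw [robin, robin, ← inv_sqrt_mul_inv_sqrt]
  ring

/-- The edge matrices multiply to (δ_{jl} - 1/N) sin sin plus 1/N times the product of the Robin
functions. The addition formulas give σ. -/
theorem sum_eigenfunction_mul_eigenfunction {κ α ω : ℝ} (hN : 0 < N) (hα : α = N * κ) (hω : 0 < ω)
    (j l : Fin N) (x y : ℝ) :
    ∑ k, eigenfunction N κ k j ω x * eigenfunction N κ k l ω y =
      spectralDensity N α j l ω x y := by
  have hN' : (N : ℝ) ≠ 0 := by exact_mod_cast hN.ne'
  have h1 := sum_edgeMix_mul_edgeMix hN (Real.sin (ω * x)) (robin κ ω x) (Real.sin (ω * y))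
    (robin κ ω y) j l
  have e : ∀ k, eigenfunction N κ k j ω x * eigenfunction N κ k l ω y = 2 / Real.pi *
      (edgeMix N (Real.sin (ω * x)) (robin κ ω x) k j *
        edgeMix N (Real.sin (ω * y)) (robin κ ω y) k l) := by
    intro k
    have h6 : √(2 / Real.pi) * √(2 / Real.pi) = 2 / Real.pi := Real.mul_self_sqrt (by positivity)
    rw [← h6, eigenfunction, eigenfunction]
    ring
  simp only [e]
  rw [← Finset.mul_sum, h1, edgeMix, robin_mul_robin, spectralDensity, hα, mul_add ω x y,
    Real.cos_add, Real.sin_add]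
  have h2 : κ ^ 2 + ω ^ 2 ≠ 0 := by positivity
  have h3 : (N * κ) ^ 2 + (N : ℝ) ^ 2 * ω ^ 2 = N ^ 2 * (κ ^ 2 + ω ^ 2) := by ring
  rw [h3]
  field_simp
  ring

/-- The inverse eigenfunction transform of integrable functions is the expected integral. -/
theorem symm_apply_ae_eq {κ : ℝ} {U : L2Star N ≃ₗᵢ[ℂ] L2Star N} (hU : IsEigenTransform κ U)
    {h : L2Star N} (hh : ∀ k, Integrable (h k) μ₊) (l : Fin N) :
    U.symm h l =ᵐ[μ₊] fun y =>
      ∑ k, ∫ ω in Ioi (0 : ℝ), (eigenfunction N κ k l ω y : ℂ) * h k ω := by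
  have hK : ∀ k, Measurable (Function.uncurry fun y ω => (eigenfunction N κ k l ω y : ℂ)) := fun k =>
    measurable_eigenfunction_swap κ k l
  have hC : ∀ k y ω, ‖(eigenfunction N κ k l ω y : ℂ)‖ ≤ √(2 / Real.pi) * 4 := fun k y ω => by
    rw [Complex.norm_real]
    exact abs_eigenfunction_le κ k l ω y
  have hint : ∀ s > 0, ∀ k, Integrable (fun y => (Real.exp (-(s * y)) : ℂ) *
      ∫ ω in Ioi (0 : ℝ), (eigenfunction N κ k l ω y : ℂ) * h k ω) μ₊ := fun s hs k =>
    integrable_mul_integral (integrableOn_exp_neg_mul hs) (hh k) (hK k) (hC k)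
  have hint0 : ∀ s > 0, Integrable (fun y => (Real.exp (-(s * y)) : ℂ) * U.symm h l y) μ₊ :=
    fun s hs => integrableOn_exp_mul_L2 (Lp.memLp _) hs
  have h0 : (fun y => U.symm h l y -
      ∑ k, ∫ ω in Ioi (0 : ℝ), (eigenfunction N κ k l ω y : ℂ) * h k ω) =ᵐ[μ₊] 0 := by
    -- Both sides are compared through Laplace transforms: that of the left side is given by the
    -- characterization of U, that of the right side by Fubini and the Laplace transform of the
    -- eigenfunctions.
    refine ae_eq_zero_of_laplace_eq_zero (c := 1) ?_ fun n => ?_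
    · simp only [mul_sub, Finset.mul_sum]
      exact (hint0 1 one_pos).sub (integrable_finsetSum _ fun k _ => hint 1 one_pos k)
    · have hn : (0 : ℝ) < 1 + n := by positivity
      simp only [mul_sub, Finset.mul_sum]
      rw [integral_sub (hint0 _ hn) (integrable_finsetSum _ fun k _ => hint _ hn k), sub_eq_zero,
        integral_finsetSum _ fun k _ => hint _ hn k, hU _ hn l, U.apply_symm_apply]
      refine Finset.sum_congr rfl fun k _ => ?_
      rw [integral_mul_integral_swap (integrableOn_exp_neg_mul hn) (hh k) (hK k) (hC k)]
      refine integral_congr_ae (Filter.Eventually.of_forall fun ω => ?_)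
      simp only
      rw [integral_exp_mul_eigenfunction hn, mul_comm]
  filter_upwards [h0] with x hx
  exact sub_eq_zero.1 hx

/-- The value at x of the inverse transform of the cut-off data is the pairing of Uf with the
eigenfunctions at x restricted to ω ≤ √λ. Unitarity moves the inverse transform onto these, where it
yields the integral of the sum of products of eigenfunctions. -/
theorem hasIntegralKernel_multiplicationPVM {κ α : ℝ} (hN : 0 < N) (hα : α = N * κ)
    {U : L2Star N ≃ₗᵢ[ℂ] L2Star N} (hU : IsEigenTransform κ U) {lam : ℝ} (hlam : 0 ≤ lam) :
    HasIntegralKernel ((multiplicationPVM U).proj (Icc 0 lam))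
      (fun j l x y => ∫ ω in (0 : ℝ)..√lam, spectralDensity N α j l ω x y) := by
  intro f j
  have hS := measurableSet_sq_preimage (measurableSet_Icc (a := (0 : ℝ)) (b := lam))
  set S : Set ℝ := (fun ω : ℝ => ω ^ 2) ⁻¹' Icc 0 lam with hSdef
  have hSI : Ioi (0 : ℝ) ∩ S = Ioc 0 √lam := by
    ext ω
    simp only [hSdef, mem_inter_iff, mem_Ioi, mem_preimage, mem_Icc, mem_Ioc]
    refine and_congr_right fun h => ?_
    rw [Real.le_sqrt h.le hlam]
    simp [sq_nonneg]
  -- On this bounded frequency range square integrable and bounded functions are integrable, which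
  -- the inversion formula requires.
  have hfin : IsFiniteMeasure (μ₊.restrict S) := by
    constructor
    rw [Measure.restrict_restrict hS, inter_comm, hSI]
    simp
  set h0 : L2Star N := cutoff hS (U f) with hh0
  have hint0 : ∀ k, Integrable (h0 k) μ₊ := by
    intro k
    rw [integrable_congr (cutoff_ae_eq hS (U f) k), integrable_indicator_iff hS]
    exact ((Lp.memLp (U f k)).restrict S).integrable (by norm_num)
  have hE : (multiplicationPVM U).proj (Icc 0 lam) f = U.symm h0 := by
    rw [LinearIsometryEquiv.eq_symm_apply, apply_multiplicationPVM U measurableSet_Icc]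
  have hmem : ∀ x k, MemLp (S.indicator fun ω => (eigenfunction N κ k j ω x : ℂ)) 2 μ₊ := by
    intro x k
    rw [memLp_indicator_iff_restrict hS]
    refine MemLp.of_bound (C := √(2 / Real.pi) * 4) ?_ (Filter.Eventually.of_forall fun ω => ?_)
    · exact (Complex.measurable_ofReal.comp
        (measurable_eigenfunction_frequency κ k j x)).aestronglyMeasurable
    · rw [Complex.norm_real]
      exact abs_eigenfunction_le κ k j ω x
  filter_upwards [symm_apply_ae_eq hU hint0 j] with x hx
  set hX : L2Star N := mkL2Star _ (hmem x) with hhX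
  have hXae : ∀ k, hX k =ᵐ[μ₊] S.indicator fun ω => (eigenfunction N κ k j ω x : ℂ) :=
    mkL2Star_ae_eq _ (hmem x)
  have hintX : ∀ k, Integrable (hX k) μ₊ := by
    intro k
    rw [integrable_congr (hXae k), integrable_indicator_iff hS]
    have := (memLp_indicator_iff_restrict hS).1 (hmem x k)
    exact this.integrable (by norm_num)
  have hker : ∀ l, U.symm hX l =ᵐ[μ₊] fun y =>
      ((∫ ω in (0 : ℝ)..√lam, spectralDensity N α j l ω x y : ℝ) : ℂ) := by
    intro l
    filter_upwards [symm_apply_ae_eq hU hintX l] with y hy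
    rw [hy, intervalIntegral.integral_of_le (Real.sqrt_nonneg _), ← integral_complex_ofReal]
    have e1 : ∀ k, ∫ ω in Ioi (0 : ℝ), (eigenfunction N κ k l ω y : ℂ) * hX k ω =
        ∫ ω in Ioc 0 √lam, ((eigenfunction N κ k j ω x * eigenfunction N κ k l ω y : ℝ) : ℂ) := by
      intro k
      rw [← hSI, ← setIntegral_indicator hS]
      refine integral_congr_ae ?_
      filter_upwards [hXae k] with ω hω
      rw [hω]
      by_cases hωS : ω ∈ S
      · rw [indicator_of_mem hωS, indicator_of_mem hωS]
        push_cast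
        ring
      · rw [indicator_of_notMem hωS, indicator_of_notMem hωS, mul_zero]
    simp only [e1]
    rw [← integral_finsetSum]
    · refine setIntegral_congr_fun measurableSet_Ioc fun ω hω => ?_
      rw [← sum_eigenfunction_mul_eigenfunction hN hα hω.1 j l x y]
      push_cast
      rfl
    · intro k _
      have hm := (measurable_eigenfunction_frequency κ k j x).mul
        (measurable_eigenfunction_frequency κ k l y)
      refine Integrable.ofReal (Integrable.of_bound
        (f := fun ω => eigenfunction N κ k j ω x * eigenfunction N κ k l ω y) (C := √(2 / Real.pi) * 4 * (√(2 / Real.pi) * 4))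
        hm.aestronglyMeasurable (Filter.Eventually.of_forall fun ω => ?_))
      refine (norm_mul _ _).le.trans ?_
      exact mul_le_mul (abs_eigenfunction_le κ k j ω x) (abs_eigenfunction_le κ k l ω y)
        (norm_nonneg _) (by positivity)
  constructor
  · intro l
    -- As a function of y the kernel is almost everywhere an element of L², so its product with f_l
    -- is integrable.
    refine ((Lp.memLp (U.symm hX l)).integrable_mul (Lp.memLp (f l))).congr ?_
    filter_upwards [hker l] with y hy
    rw [Pi.mul_apply, hy]
  · have h1 : ⟪hX, U f⟫_ℂ = ⟪U.symm hX, f⟫_ℂ := by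
      conv_lhs => rw [← U.apply_symm_apply hX]
      exact U.inner_map_map _ _
    rw [hE, hx]
    have h2 : ⟪hX, U f⟫_ℂ =
        ∑ k, ∫ ω in Ioi (0 : ℝ), (eigenfunction N κ k j ω x : ℂ) * h0 k ω := by
      rw [hhX, inner_mkL2Star]
      refine Finset.sum_congr rfl fun k _ => integral_congr_ae ?_
      filter_upwards [cutoff_ae_eq hS (U f) k] with ω hω
      rw [hω]
      by_cases hωS : ω ∈ S
      · rw [indicator_of_mem hωS, indicator_of_mem hωS, Complex.conj_ofReal]
      · rw [indicator_of_notMem hωS, indicator_of_notMem hωS]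
        simp
    rw [← h2, h1, inner_eq_sum_integral]
    refine Finset.sum_congr rfl fun l _ => integral_congr_ae ?_
    filter_upwards [hker l] with y hy
    rw [hy, Complex.conj_ofReal]

end SpectralKernel

/-! ### The wave kernel and its cosine transform -/

section WaveKernelMeasure

variable {N : ℕ}

theorem integrable_mul_exp_neg_abs (κ : ℝ) :
    Integrable (fun r : ℝ => |κ| * Real.exp (-(|κ| * r))) μ₊ := by
  rcases eq_or_ne κ 0 with rfl | h
  · simp
  · have h1 := exp_neg_integrableOn_Ioi 0 (abs_pos.2 h)
    simp only [neg_mul] at h1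
    exact Integrable.const_mul h1 _

/-- The exponential distribution of rate `|κ|` (the zero measure for `κ = 0`). -/
noncomputable def decayMeasure (κ : ℝ) : Measure ℝ :=
  -- The absolute value keeps the measure finite for every real κ; for κ ≥ 0 it changes nothing.
  μ₊.withDensity fun r => ENNReal.ofReal (|κ| * Real.exp (-(|κ| * r)))

instance (κ : ℝ) : IsFiniteMeasure (decayMeasure κ) :=
  isFiniteMeasure_withDensity_ofReal (integrable_mul_exp_neg_abs κ).2

theorem integral_decayMeasure {E : Type*} [NormedAddCommGroup E] [NormedSpace ℝ E] {κ : ℝ}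
    (hκ : 0 ≤ κ) (g : ℝ → E) :
    ∫ r, g r ∂(decayMeasure κ) = ∫ r in Ioi (0 : ℝ), (κ * Real.exp (-(κ * r))) • g r := by
  rw [decayMeasure, integral_withDensity_eq_integral_toReal_smul (by fun_prop)
    (Filter.Eventually.of_forall fun r => ENNReal.ofReal_lt_top)]
  refine integral_congr_ae (Filter.Eventually.of_forall fun r => ?_)
  simp only
  rw [ENNReal.toReal_ofReal (by positivity), abs_of_nonneg hκ]

/-- The wave kernel of the star graph; the strength of the vertex condition is `N * κ`. -/
noncomputable def waveKernel (N : ℕ) (κ : ℝ) (j l : Fin N) (x y : ℝ) : SignedMeasure ℝ :=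
  -- The direct pulse at time |x-y| on the same edge, the pulse that has passed the vertex at time
  -- x+y, and the exponential tail behind it caused by the delta interaction.
  ((if j = l then 1 else 0) / 2 : ℝ) • (Measure.dirac |x - y|).toSignedMeasure +
  ((N : ℝ)⁻¹ - (if j = l then 1 else 0) / 2 : ℝ) • (Measure.dirac (x + y)).toSignedMeasure -
  ((N : ℝ)⁻¹ : ℝ) • ((decayMeasure κ).map (fun r => x + y + r)).toSignedMeasure

theorem waveKernel_apply_eq_zero (κ : ℝ) (j l : Fin N) {x y : ℝ} (hx : 0 ≤ x) (hy : 0 ≤ y)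
    {s : Set ℝ} (hs : s ⊆ Iio 0) : waveKernel N κ j l x y s = 0 := by
  by_cases hm : MeasurableSet s
  · have hd : ∀ a : ℝ, 0 ≤ a → (Measure.dirac a).toSignedMeasure s = 0 := by
      intro a ha
      have : a ∉ s := fun h => absurd (hs h) (not_lt.2 ha)
      rw [Measure.toSignedMeasure_apply_measurable hm, Measure.real, Measure.dirac_apply' _ hm,
        indicator_of_notMem this]
      simp
    have he : ((decayMeasure κ).map (fun r => x + y + r)).toSignedMeasure s = 0 := by
      have h1 : (decayMeasure κ) ((fun r => x + y + r) ⁻¹' s) = 0 := by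
        refine withDensity_absolutelyContinuous _ _ ?_
        rw [Measure.restrict_apply ((measurable_const_add _) hm)]
        convert measure_empty (μ := (volume : Measure ℝ))
        ext r
        simp only [mem_inter_iff, mem_preimage, mem_Ioi, mem_empty_iff_false, iff_false, not_and,
          not_lt]
        intro hr
        have := hs hr
        rw [mem_Iio] at this
        linarith
      rw [Measure.toSignedMeasure_apply_measurable hm, Measure.real,
        Measure.map_apply (measurable_const_add _) hm, h1]
      simp
    simp only [waveKernel, sub_apply, add_apply, smul_apply, hd _ (abs_nonneg (x - y)), hd _ (add_nonneg hx hy), he, smul_zero,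
      add_zero, sub_zero]
  -- A vector measure takes the value 0 on nonmeasurable sets by convention.
  · exact VectorMeasure.not_measurable _ hm

theorem integral_waveKernel {E : Type*} [NormedAddCommGroup E] [NormedSpace ℝ E] [CompleteSpace E]
    {κ : ℝ} (hκ : 0 ≤ κ) (j l : Fin N) (x y : ℝ) {φ : ℝ → E} (hφ : Continuous φ) {C : ℝ}
    (hC : ∀ t, ‖φ t‖ ≤ C) :
    ∫ᵛ t, φ t ∂<•(waveKernel N κ j l x y) =
      ((if j = l then 1 else 0) / 2 : ℝ) • φ |x - y| +
      ((N : ℝ)⁻¹ - (if j = l then 1 else 0) / 2 : ℝ) • φ (x + y) -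
      ((N : ℝ)⁻¹ : ℝ) • ∫ r in Ioi (0 : ℝ), (κ * Real.exp (-(κ * r))) • φ (x + y + r) := by
  have hi : ∀ (μ : Measure ℝ) [IsFiniteMeasure μ], μ.toSignedMeasure.Integrable φ := by
    intro μ _
    rw [VectorMeasure.Integrable, Measure.variation_toSignedMeasure]
    exact Integrable.of_bound hφ.aestronglyMeasurable C (Filter.Eventually.of_forall hC)
  rw [waveKernel, VectorMeasure.integral_sub_vectorMeasure
    (((hi _).smul_vectorMeasure _).add_vectorMeasure ((hi _).smul_vectorMeasure _))
    ((hi _).smul_vectorMeasure _),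
    VectorMeasure.integral_add_vectorMeasure ((hi _).smul_vectorMeasure _)
      ((hi _).smul_vectorMeasure _), VectorMeasure.integral_smul_vectorMeasure,
    VectorMeasure.integral_smul_vectorMeasure, VectorMeasure.integral_smul_vectorMeasure,
    VectorMeasure.integral_toSignedMeasure, VectorMeasure.integral_toSignedMeasure,
    VectorMeasure.integral_toSignedMeasure, integral_dirac, integral_dirac,
    integral_map (by fun_prop) hφ.aestronglyMeasurable, integral_decayMeasure hκ]

theorem integral_decay_mul_cos {κ : ℝ} (hκ : 0 ≤ κ) (ω z : ℝ) :
    ∫ r in Ioi (0 : ℝ), κ * Real.exp (-(κ * r)) * Real.cos (ω * (z + r)) =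
      κ * (κ * Real.cos (ω * z) - ω * Real.sin (ω * z)) / (κ ^ 2 + ω ^ 2) := by
  rcases hκ.eq_or_lt with rfl | hκ
  · simp
  · obtain ⟨h1, h2⟩ := integral_exp_mul_cos_sin hκ ω
    have hi : IntegrableOn (fun x : ℝ => Real.exp (-(κ * x))) (Ioi 0) := by
      simpa [neg_mul] using exp_neg_integrableOn_Ioi 0 hκ
    have hc : IntegrableOn (fun x : ℝ => Real.exp (-(κ * x)) * Real.cos (ω * x)) (Ioi 0) :=
      Integrable.mul_bdd (c := 1) hi (by fun_prop) (Filter.Eventually.of_forall fun x => by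
        exact Real.abs_cos_le_one _)
    have hs : IntegrableOn (fun x : ℝ => Real.exp (-(κ * x)) * Real.sin (ω * x)) (Ioi 0) :=
      Integrable.mul_bdd (c := 1) hi (by fun_prop) (Filter.Eventually.of_forall fun x => by
        exact Real.abs_sin_le_one _)
    have e : ∀ r : ℝ, κ * Real.exp (-(κ * r)) * Real.cos (ω * (z + r)) =
        κ * Real.cos (ω * z) * (Real.exp (-(κ * r)) * Real.cos (ω * r)) -
        κ * Real.sin (ω * z) * (Real.exp (-(κ * r)) * Real.sin (ω * r)) := by
      intro r
      rw [mul_add, Real.cos_add]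
      ring
    simp only [e]
    rw [integral_sub (hc.const_mul _) (hs.const_mul _), integral_const_mul, integral_const_mul, h1,
      h2]
    ring

/-- The three terms are the cosine transforms of the three parts of the wave kernel. The factor
1/(κ²+ω²) comes from the tail. -/
theorem spectralDensity_eq {κ α : ℝ} (hN : 0 < N) (hκ : 0 ≤ κ) (hα : α = N * κ) (j l : Fin N)
    (x y : ℝ) {ω : ℝ} (hω : 0 < ω) :
    spectralDensity N α j l ω x y = (2 / Real.pi) *
      ((if j = l then 1 else 0) / 2 * Real.cos (ω * |x - y|) +
      ((N : ℝ)⁻¹ - (if j = l then 1 else 0) / 2) * Real.cos (ω * (x + y)) -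
      (N : ℝ)⁻¹ * ∫ r in Ioi (0 : ℝ), κ * Real.exp (-(κ * r)) * Real.cos (ω * (x + y + r))) := by
  have hN' : (N : ℝ) ≠ 0 := by exact_mod_cast hN.ne'
  have h2 : κ ^ 2 + ω ^ 2 ≠ 0 := by positivity
  have h3 : (N * κ) ^ 2 + (N : ℝ) ^ 2 * ω ^ 2 = N ^ 2 * (κ ^ 2 + ω ^ 2) := by ring
  have h4 : Real.cos (ω * |x - y|) = Real.cos (ω * x) * Real.cos (ω * y) +
      Real.sin (ω * x) * Real.sin (ω * y) := by
    rw [← Real.cos_sub, ← mul_sub, ← Real.cos_abs (ω * (x - y)), abs_mul, abs_of_pos hω]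
  have h5 : Real.cos (ω * (x + y)) = Real.cos (ω * x) * Real.cos (ω * y) -
      Real.sin (ω * x) * Real.sin (ω * y) := by
    rw [mul_add, Real.cos_add]
  rw [integral_decay_mul_cos hκ, spectralDensity, h4, hα, h3]
  generalize Real.sin (ω * (x + y)) = S
  rw [h5]
  field_simp
  ring

theorem spectralDensity_eq_integral_waveKernel {κ α : ℝ} (hN : 0 < N) (hκ : 0 ≤ κ)
    (hα : α = N * κ) (j l : Fin N) (x y : ℝ) {ω : ℝ} (hω : 0 < ω) :
    spectralDensity N α j l ω x y =
      (2 / Real.pi) * ∫ᵛ t, Real.cos (ω * t) ∂<•(waveKernel N κ j l x y) := by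
  rw [integral_waveKernel hκ j l x y (φ := fun t => Real.cos (ω * t)) (by fun_prop) (C := 1)
    fun t => Real.abs_cos_le_one _, spectralDensity_eq hN hκ hα j l x y hω]
  simp only [smul_eq_mul]

/-- Cosine inversion writes φ as a superposition of cosines, and integrating each against the kernel
gives σ. Fubini is needed only for the tail, since the other parts are point masses. -/
theorem integral_waveKernel_schwartz {κ α : ℝ} (hN : 0 < N) (hκ : 0 ≤ κ)
    (hα : α = N * κ) (j l : Fin N) (x y : ℝ) (φ : SchwartzMap ℝ ℂ) (he : ∀ t, φ (-t) = φ t) :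
    ∫ᵛ t, φ t ∂<•(waveKernel N κ j l x y) =
      ∫ ω in Ioi (0 : ℝ), (∫ t in Ioi (0 : ℝ), (Real.cos (ω * t) : ℂ) * φ t) *
        (spectralDensity N α j l ω x y : ℂ) := by
  set ψ : ℝ → ℂ := cosTransform φ with hψ
  have hψi : Integrable ψ μ₊ := (integrable_cosTransform φ he).integrableOn
  have hinv : ∀ t, φ t = (2 / Real.pi : ℝ) * ∫ ω in Ioi (0 : ℝ), (Real.cos (ω * t) : ℂ) * ψ ω := by
    intro t
    rw [cosTransform_cosTransform φ he t, cosTransform]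
    simp only [mul_comm t, hψ]
  have hcos : ∀ a, Integrable (fun ω => (Real.cos (ω * a) : ℂ) * ψ ω) μ₊ := by
    intro a
    have := integrable_cos_mul hψi a
    simpa only [mul_comm a] using this
  let d : ℝ → ℂ := fun r => ((κ * Real.exp (-(κ * r)) : ℝ) : ℂ)
  have hd : Integrable d μ₊ := by
    have := integrable_mul_exp_neg_abs κ
    rw [abs_of_nonneg hκ] at this
    exact this.ofReal
  let K : ℝ → ℝ → ℂ := fun ω r => (Real.cos (ω * (x + y + r)) : ℂ)
  have hK : Measurable (Function.uncurry K) := by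
    unfold K Function.uncurry
    fun_prop
  have hKC : ∀ ω r, ‖K ω r‖ ≤ 1 := fun ω r => by
    rw [Complex.norm_real]
    exact Real.abs_cos_le_one _
  have hKi := integrable_mul_integral hψi hd hK hKC
  have hKs := integral_mul_integral_swap hψi hd hK hKC
  rw [integral_waveKernel hκ j l x y φ.continuous (C := SchwartzMap.seminorm ℝ 0 0 φ)
    fun t => SchwartzMap.norm_le_seminorm ℝ φ t]
  have e1 : ∫ r in Ioi (0 : ℝ), (κ * Real.exp (-(κ * r))) • φ (x + y + r) =
      (2 / Real.pi : ℝ) * ∫ ω in Ioi (0 : ℝ), ψ ω * ∫ r in Ioi (0 : ℝ), K ω r * d r := by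
    rw [hKs, ← integral_const_mul]
    refine integral_congr_ae (Filter.Eventually.of_forall fun r => ?_)
    simp only [d, K]
    rw [hinv, Complex.real_smul]
    ring
  rw [e1, hinv, hinv]
  have e2 : ∀ ω ∈ Ioi (0 : ℝ), ψ ω * (spectralDensity N α j l ω x y : ℂ) =
      ((2 / Real.pi : ℝ) : ℂ) * ((((if j = l then 1 else 0) / 2 : ℝ) : ℂ) *
        ((Real.cos (ω * |x - y|) : ℂ) * ψ ω) +
      (((N : ℝ)⁻¹ - (if j = l then 1 else 0) / 2 : ℝ) : ℂ) * ((Real.cos (ω * (x + y)) : ℂ) * ψ ω) -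
      (((N : ℝ)⁻¹ : ℝ) : ℂ) * (ψ ω * ∫ r in Ioi (0 : ℝ), K ω r * d r)) := by
    intro ω hω
    have e3 : ∫ r in Ioi (0 : ℝ), K ω r * d r = ((∫ r in Ioi (0 : ℝ), κ * Real.exp (-(κ * r)) *
        Real.cos (ω * (x + y + r)) : ℝ) : ℂ) := by
      rw [← integral_complex_ofReal]
      refine integral_congr_ae (Filter.Eventually.of_forall fun r => ?_)
      simp only [d, K]
      push_cast
      ring
    rw [e3, spectralDensity_eq hN hκ hα j l x y hω]
    push_cast
    ring
  change _ = ∫ ω in Ioi (0 : ℝ), ψ ω * _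
  have e4 : ∀ (c c' : ℂ) (a a' : ℝ), Integrable (fun ω => c * ((Real.cos (ω * a) : ℂ) * ψ ω) +
      c' * ((Real.cos (ω * a') : ℂ) * ψ ω)) μ₊ := fun c c' a a' =>
    ((hcos a).const_mul c).add ((hcos a').const_mul c')
  rw [setIntegral_congr_fun measurableSet_Ioi e2, integral_const_mul,
    integral_sub (e4 _ _ _ _) (hKi.const_mul _),
    integral_add ((hcos _).const_mul _) ((hcos _).const_mul _), integral_const_mul,
    integral_const_mul, integral_const_mul]
  simp only [Complex.real_smul]
  ring

end WaveKernelMeasure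

/-! ### The d'Alembert solution on the star graph -/

section WaveSolution

variable {N : ℕ}

/-- The convolution of `F` with `e^{-κ r}` on the half line. -/
noncomputable def decayConvolution (κ : ℝ) (F : ℝ → ℂ) (τ : ℝ) : ℂ :=
  (Real.exp (-(κ * τ)) : ℂ) * ∫ y in (0 : ℝ)..τ, (Real.exp (κ * y) : ℂ) * F y

/-- The convolution solves y' + κy = F, the shape of the equation that the vertex condition imposes
on the emitted wave. -/
theorem hasDerivAt_decayConvolution (κ : ℝ) {F : ℝ → ℂ} (hF : Continuous F) (τ : ℝ) :
    HasDerivAt (decayConvolution κ F) (F τ - κ * decayConvolution κ F τ) τ := by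
  have hc : Continuous fun y : ℝ => (Real.exp (κ * y) : ℂ) * F y :=
    (Complex.continuous_ofReal.comp (by fun_prop)).mul hF
  have h1 : HasDerivAt (fun τ => ∫ y in (0 : ℝ)..τ, (Real.exp (κ * y) : ℂ) * F y)
      ((Real.exp (κ * τ) : ℂ) * F τ) τ :=
    intervalIntegral.integral_hasDerivAt_right (hc.intervalIntegrable _ _)
      hc.aestronglyMeasurable.stronglyMeasurableAtFilter hc.continuousAt
  have h2 : HasDerivAt (fun τ : ℝ => (Real.exp (-(κ * τ)) : ℂ))
      (((Real.exp (-(κ * τ)) * -(κ * 1) : ℝ)) : ℂ) τ :=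
    (((hasDerivAt_id τ).const_mul κ).neg.exp).ofReal_comp
  refine HasDerivAt.congr_deriv (h2.mul h1) ?_
  have e : (Real.exp (-(κ * τ)) : ℂ) * (Real.exp (κ * τ) : ℂ) = 1 := by
    rw [← Complex.ofReal_mul, ← Real.exp_add]
    simp
  rw [decayConvolution]
  push_cast at e ⊢
  linear_combination F τ * e

theorem contDiff_decayConvolution (κ : ℝ) {F : ℝ → ℂ} (hF : ContDiff ℝ (⊤ : ℕ∞) F) :
    ContDiff ℝ (⊤ : ℕ∞) (decayConvolution κ F) := by
  have hc : ContDiff ℝ (⊤ : ℕ∞) fun y : ℝ => (Real.exp (κ * y) : ℂ) * F y :=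
    (Complex.ofRealCLM.contDiff.comp (f := fun y : ℝ => Real.exp (κ * y)) (by fun_prop)).mul hF
  have h1 : ContDiff ℝ (⊤ : ℕ∞) fun τ => ∫ y in (0 : ℝ)..τ, (Real.exp (κ * y) : ℂ) * F y := by
    have hd : ∀ τ, HasDerivAt (fun τ => ∫ y in (0 : ℝ)..τ, (Real.exp (κ * y) : ℂ) * F y)
        ((Real.exp (κ * τ) : ℂ) * F τ) τ := fun τ =>
      intervalIntegral.integral_hasDerivAt_right (hc.continuous.intervalIntegrable _ _)
        hc.continuous.aestronglyMeasurable.stronglyMeasurableAtFilter hc.continuous.continuousAt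
    rw [contDiff_infty_iff_deriv]
    refine ⟨fun τ => (hd τ).differentiableAt, ?_⟩
    rw [funext fun τ => (hd τ).deriv]
    exact hc
  have h2 : ContDiff ℝ (⊤ : ℕ∞) fun τ : ℝ => (Real.exp (-(κ * τ)) : ℂ) :=
    Complex.ofRealCLM.contDiff.comp (f := fun y : ℝ => Real.exp (-(κ * y))) (by fun_prop)
  exact h2.mul h1

theorem decayConvolution_of_nonpos (κ : ℝ) {F : ℝ → ℂ} (hF : ∀ y ≤ 0, F y = 0) {τ : ℝ}
    (hτ : τ ≤ 0) : decayConvolution κ F τ = 0 := by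
  rw [decayConvolution, intervalIntegral.integral_zero_ae, mul_zero]
  refine Filter.Eventually.of_forall fun y hy => ?_
  rw [uIoc_of_ge hτ] at hy
  rw [hF y hy.2, mul_zero]

section dAlembert

variable {A B : ℝ → ℂ}

theorem hasDerivAt_time (hA : Differentiable ℝ A) (hB : Differentiable ℝ B) (t x : ℝ) :
    HasDerivAt (fun s => A (x + s) + B (x - s)) (deriv A (x + t) - deriv B (x - t)) t := by
  have h1 := (hA (x + t)).hasDerivAt.comp_const_add x t
  have h2 := (hB (x - t)).hasDerivAt.comp_const_sub x t
  rw [sub_eq_add_neg]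
  exact h1.add h2

theorem hasDerivAt_comp_neg (hA : Differentiable ℝ A) (z : ℝ) :
    HasDerivAt (fun z => A (-z)) (-deriv A (-z)) z := by
  simpa [Function.comp_def] using HasDerivAt.scomp z (hA (-z)).hasDerivAt (hasDerivAt_neg z)

theorem hasDerivAt_space (hA : Differentiable ℝ A) (hB : Differentiable ℝ B) (t x : ℝ) :
    HasDerivAt (fun z => A (z + t) + B (z - t)) (deriv A (x + t) + deriv B (x - t)) x := by
  have h1 := (hA (x + t)).hasDerivAt.comp_add_const x t
  have h2 := (hB (x - t)).hasDerivAt.comp_sub_const x t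
  exact h1.add h2

theorem dAlembert_wave (hA : ContDiff ℝ (⊤ : ℕ∞) A) (hB : ContDiff ℝ (⊤ : ℕ∞) B) (t x : ℝ) :
    deriv (deriv fun s => A (x + s) + B (x - s)) t =
      deriv (deriv fun z => A (z + t) + B (z - t)) x := by
  obtain ⟨a0, a1⟩ := contDiff_infty_iff_deriv.1 hA
  obtain ⟨b0, b1⟩ := contDiff_infty_iff_deriv.1 hB
  obtain ⟨a2, -⟩ := contDiff_infty_iff_deriv.1 a1
  obtain ⟨b2, -⟩ := contDiff_infty_iff_deriv.1 b1
  rw [funext fun s => (hasDerivAt_time a0 b0 s x).deriv,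
    funext fun z => (hasDerivAt_space a0 b0 t z).deriv, (hasDerivAt_space a2 b2 t x).deriv]
  have h1 := hasDerivAt_time (B := fun z => -deriv B z) a2 b2.neg t x
  simp only [← sub_eq_add_neg] at h1
  rw [h1.deriv, deriv.fun_neg, sub_neg_eq_add]

end dAlembert

/-- The wave that leaves the vertex, when `F` is the sum of the initial data. -/
noncomputable def outgoingWave (N : ℕ) (κ : ℝ) (F : ℝ → ℂ) (τ : ℝ) : ℂ :=
  (N : ℂ)⁻¹ * (F τ - κ * decayConvolution κ F τ)

theorem outgoingWave_of_nonpos (κ : ℝ) {F : ℝ → ℂ} (hF : ∀ y ≤ 0, F y = 0) {τ : ℝ}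
    (hτ : τ ≤ 0) : outgoingWave N κ F τ = 0 := by
  rw [outgoingWave, decayConvolution_of_nonpos κ hF hτ, hF τ hτ]
  simp

theorem contDiff_outgoingWave (κ : ℝ) {F : ℝ → ℂ} (hF : ContDiff ℝ (⊤ : ℕ∞) F) :
    ContDiff ℝ (⊤ : ℕ∞) (outgoingWave N κ F) :=
  contDiff_const.mul (hF.sub (contDiff_const.mul (contDiff_decayConvolution κ hF)))

/-- With h the emitted wave, the vertex condition reads F' - Nh' = Nκh, which is this equation. Its
solution, the convolution of F'/N with the exponential, is integrated by parts in `outgoingWave` so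
that F' does not appear. -/
theorem deriv_outgoingWave (κ : ℝ) {F : ℝ → ℂ} (hF : ContDiff ℝ (⊤ : ℕ∞) F) (τ : ℝ) :
    deriv (outgoingWave N κ F) τ = (N : ℂ)⁻¹ * deriv F τ - κ * outgoingWave N κ F τ := by
  have h1 := (hF.differentiable (by simp) τ).hasDerivAt
  have h2 := ((h1.sub ((hasDerivAt_decayConvolution κ hF.continuous τ).const_mul (κ : ℂ))).const_mul
    (N : ℂ)⁻¹).deriv
  refine Eq.trans h2 ?_
  rw [outgoingWave]
  ring

/-- The solution of the wave equation on the star graph. -/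
noncomputable def waveSolution (N : ℕ) (κ : ℝ) (f : Fin N → ℝ → ℂ) (j : Fin N) (t x : ℝ) : ℂ :=
  -- Incoming half, outgoing half, its odd reflection, and the wave emitted at the vertex evaluated
  -- at t - x. The data and the emitted wave vanish at nonpositive arguments, so the formula is
  -- smooth without case distinction.
  2⁻¹ * f j (x + t) + (2⁻¹ * f j (x - t) - 2⁻¹ * f j (-(x - t)) +
    outgoingWave N κ (fun y => ∑ l, f l y) (-(x - t)))

theorem isWaveSolution_waveSolution {κ α : ℝ} (hN : 0 < N) (hα : α = N * κ) {f : Fin N → ℝ → ℂ}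
    (hf : ∀ l, ContDiff ℝ (⊤ : ℕ∞) (f l)) (hs : ∀ l, tsupport (f l) ⊆ Ioi 0) :
    IsWaveSolution α f (waveSolution N κ f) := by
  have hN' : (N : ℂ) ≠ 0 := by exact_mod_cast hN.ne'
  set F : ℝ → ℂ := fun y => ∑ l, f l y with hFdef
  have hF : ContDiff ℝ (⊤ : ℕ∞) F := ContDiff.sum fun l _ => hf l
  have hf0 : ∀ l, ∀ y ≤ 0, f l y = 0 := fun l y hy =>
    image_eq_zero_of_notMem_tsupport fun h => absurd (hs l h) (not_lt.2 hy)
  have hf0' : ∀ l, ∀ y ≤ 0, deriv (f l) y = 0 := fun l y hy => by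
    by_contra h
    exact absurd (hs l (support_deriv_subset h)) (not_lt.2 hy)
  have hF0 : ∀ y ≤ 0, F y = 0 := fun y hy => Finset.sum_eq_zero fun l _ => hf0 l y hy
  have hFd : ∀ y, deriv F y = ∑ l, deriv (f l) y := fun y =>
    deriv_fun_sum fun l _ => (hf l).differentiable (by simp) y
  have hF0' : ∀ y ≤ 0, deriv F y = 0 := fun y hy => by
    rw [hFd]
    exact Finset.sum_eq_zero fun l _ => hf0' l y hy
  set h : ℝ → ℂ := outgoingWave N κ F with hh
  have hhc : ContDiff ℝ (⊤ : ℕ∞) h := contDiff_outgoingWave κ hF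
  have hh0 : ∀ τ ≤ 0, h τ = 0 := fun τ hτ => outgoingWave_of_nonpos κ hF0 hτ
  let A : Fin N → ℝ → ℂ := fun j z => 2⁻¹ * f j z
  let B : Fin N → ℝ → ℂ := fun j z => 2⁻¹ * f j z - 2⁻¹ * f j (-z) + h (-z)
  have hA : ∀ j, ContDiff ℝ (⊤ : ℕ∞) (A j) := fun j => contDiff_const.mul (hf j)
  have hB : ∀ j, ContDiff ℝ (⊤ : ℕ∞) (B j) := fun j =>
    ((contDiff_const.mul (hf j)).sub (contDiff_const.mul ((hf j).comp contDiff_neg))).add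
      (hhc.comp contDiff_neg)
  have hu : ∀ j t x, waveSolution N κ f j t x = A j (x + t) + B j (x - t) := fun j t x => rfl
  have hAd : ∀ j z, deriv (A j) z = 2⁻¹ * deriv (f j) z := fun j z =>
    (((hf j).differentiable (by simp) z).hasDerivAt.const_mul _).deriv
  have hBd : ∀ j z, deriv (B j) z = 2⁻¹ * deriv (f j) z + 2⁻¹ * deriv (f j) (-z) - deriv h (-z) := by
    intro j z
    have h1 := ((hf j).differentiable (by simp) z).hasDerivAt.const_mul (2⁻¹ : ℂ)
    have h2 := (hasDerivAt_comp_neg ((hf j).differentiable (by simp)) z).const_mul (2⁻¹ : ℂ)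
    have h3 := hasDerivAt_comp_neg (hhc.differentiable (by simp)) z
    refine Eq.trans ((h1.sub h2).add h3).deriv ?_
    ring
  have hdA := fun j => (hA j).differentiable (by simp)
  have hdB := fun j => (hB j).differentiable (by simp)
  refine ⟨fun j => ?_, fun j t _ x _ => ?_, fun j x hx => ?_, fun j x hx => ?_, fun t ht => ?_⟩
  · simp only [hu]
    have h1 : ContDiff ℝ (⊤ : ℕ∞) fun p : ℝ × ℝ => A j (p.2 + p.1) + B j (p.2 - p.1) :=
      ((hA j).comp (contDiff_snd.add contDiff_fst)).add ((hB j).comp (contDiff_snd.sub contDiff_fst))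
    exact (contDiff_infty.1 h1 2).contDiffOn
  · simp only [hu]
    exact dAlembert_wave (hA j) (hB j) t x
  · simp only [hu, A, B, add_zero, sub_zero]
    rw [hf0 j (-x) (by linarith), hh0 (-x) (by linarith)]
    ring
  · have h1 := hasDerivAt_time (hdA j) (hdB j) 0 x
    refine (HasDerivAt.congr_deriv h1 ?_).hasDerivWithinAt
    rw [add_zero, sub_zero, hAd, hBd, hf0' j (-x) (by linarith), hh, deriv_outgoingWave κ hF,
      hF0' (-x) (by linarith), ← hh, hh0 (-x) (by linarith)]
    ring
  -- At the vertex the incoming half cancels against the odd reflection in the value and doubles in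
  -- the derivative, leaving h(t) and f_j'(t) - h'(t).
  · have h0 : ∀ j, waveSolution N κ f j t 0 = h t := by
      intro j
      simp only [hu, A, B, zero_add, zero_sub, neg_neg]
      rw [hf0 j (-t) (by linarith)]
      ring
    have h1 : ∀ j, derivWithin (fun x => waveSolution N κ f j t x) (Ici 0) 0 =
        deriv (f j) t - deriv h t := by
      intro j
      have h2 := (hasDerivAt_space (hdA j) (hdB j) t 0).hasDerivWithinAt.derivWithin
        (uniqueDiffOn_Ici (0 : ℝ) 0 self_mem_Ici)
      refine Eq.trans h2 ?_
      rw [zero_add, zero_sub, hAd, hBd, neg_neg, hf0' j (-t) (by linarith)]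
      ring
    refine ⟨fun j k => (h0 j).trans (h0 k).symm, fun k => ?_⟩
    simp only [h0, h1]
    rw [Finset.sum_sub_distrib, ← hFd, hh, deriv_outgoingWave κ hF, Finset.sum_const,
      Finset.card_univ, Fintype.card_fin, nsmul_eq_mul, hα]
    push_cast
    field_simp
    ring

end WaveSolution

/-! ### The wave kernel represents the solution -/

section WaveKernelRepresentation

variable {N : ℕ}

theorem setIntegral_Ioi_eq_integral {g : ℝ → ℂ} (hg : ∀ y ≤ 0, g y = 0) :
    ∫ y in Ioi (0 : ℝ), g y = ∫ y, g y :=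
  setIntegral_eq_integral_of_forall_compl_eq_zero fun y hy => hg y (not_lt.1 hy)

/-- The two travelling halves for t > 0 form one integral over the whole line in y = x + t, with φ
evaluated at the distance |x-y|. -/
theorem integral_mul_reflection {φ g : ℝ → ℂ} (hφ : Continuous φ) {C : ℝ} (hC : ∀ t, ‖φ t‖ ≤ C)
    (hg : Integrable g) (hg0 : ∀ y ≤ 0, g y = 0) (x : ℝ) :
    ∫ t in Ioi (0 : ℝ), (φ t * g (x + t) + φ t * g (x - t)) =
      ∫ y in Ioi (0 : ℝ), φ |x - y| * g y := by
  have hi : Integrable fun t => φ |t| * g (x + t) :=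
    Integrable.bdd_mul (c := C) (hg.comp_add_left x)
      (hφ.comp continuous_abs).aestronglyMeasurable (Filter.Eventually.of_forall fun t => hC _)
  rw [setIntegral_Ioi_eq_integral (g := fun y => φ |x - y| * g y) fun y hy => by
    rw [hg0 y hy, mul_zero], ← integral_add_left_eq_self (fun y => φ |x - y| * g y) x]
  simp only [sub_add_cancel_left, abs_neg]
  rw [integral_eq_integral_Ioi_add_neg hi]
  refine setIntegral_congr_fun measurableSet_Ioi fun t ht => ?_
  have h0 : (0 : ℝ) < t := ht
  simp only [abs_neg, abs_of_pos h0, ← sub_eq_add_neg]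

theorem integral_mul_shift {g : ℝ → ℂ} (φ : ℝ → ℂ) (hg0 : ∀ y ≤ 0, g y = 0) {x : ℝ} (hx : 0 ≤ x) :
    ∫ t in Ioi (0 : ℝ), φ t * g (t - x) = ∫ y in Ioi (0 : ℝ), φ (x + y) * g y := by
  rw [setIntegral_Ioi_eq_integral fun y hy => by rw [hg0 (y - x) (by linarith), mul_zero],
    setIntegral_Ioi_eq_integral fun y hy => by rw [hg0 y hy, mul_zero],
    ← integral_add_left_eq_self (fun t => φ t * g (t - x)) x]
  simp only [add_sub_cancel_left]

/-- Fubini moves the convolution from F to φ, with r = τ - y. For κ ≥ 0 the truncated kernel is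
bounded by 1. -/
theorem integral_mul_decayConvolution {κ : ℝ} (hκ : 0 ≤ κ) {φ F : ℝ → ℂ} (hφ : Integrable φ)
    (hF : Integrable F) (x : ℝ) :
    Integrable (fun y => F y * ∫ r in Ioi (0 : ℝ), (Real.exp (-(κ * r)) : ℂ) * φ (x + y + r)) μ₊ ∧
    ∫ τ in Ioi (0 : ℝ), φ (x + τ) * decayConvolution κ F τ =
      ∫ y in Ioi (0 : ℝ), F y * ∫ r in Ioi (0 : ℝ), (Real.exp (-(κ * r)) : ℂ) * φ (x + y + r) := by
  set K : ℝ → ℝ → ℂ := fun τ y => if y < τ then (Real.exp (-(κ * (τ - y))) : ℂ) else 0 with hKdef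
  have hK : Measurable (Function.uncurry K) := by
    refine Measurable.ite (measurableSet_lt measurable_snd measurable_fst) ?_ measurable_const
    fun_prop
  have hK' : Measurable (Function.uncurry fun y τ => K τ y) := by
    refine Measurable.ite (measurableSet_lt measurable_fst measurable_snd) ?_ measurable_const
    fun_prop
  have hC : ∀ x y, ‖K x y‖ ≤ 1 := by
    intro x y
    simp only [hKdef]
    split_ifs with h
    · rw [Complex.norm_real, Real.norm_of_nonneg (Real.exp_pos _).le, Real.exp_le_one_iff]
      have : 0 ≤ κ * (x - y) := mul_nonneg hκ (by linarith)
      linarith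
    · simp
  have hφx : Integrable (fun τ => φ (x + τ)) μ₊ := (hφ.comp_add_left x).integrableOn
  have hF' : Integrable F μ₊ := hF.integrableOn
  have e1 : ∀ τ ∈ Ioi (0 : ℝ), φ (x + τ) * ∫ y in Ioi (0 : ℝ), K τ y * F y =
      φ (x + τ) * decayConvolution κ F τ := by
    intro τ hτ
    have hτ0 : (0 : ℝ) ≤ τ := le_of_lt hτ
    congr 1
    rw [decayConvolution, intervalIntegral.integral_of_le hτ0, ← integral_const_mul,
      integral_Ioc_eq_integral_Ioo, ← integral_indicator measurableSet_Ioo,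
      ← integral_indicator measurableSet_Ioi]
    congr 1 with y
    by_cases hy : y ∈ Ioo (0 : ℝ) τ
    · rw [indicator_of_mem hy, indicator_of_mem (show y ∈ Ioi (0 : ℝ) from hy.1)]
      simp only [hKdef, if_pos hy.2]
      rw [← mul_assoc, ← Complex.ofReal_mul, ← Real.exp_add]
      congr 3
      ring
    · rw [indicator_of_notMem hy]
      by_cases hy0 : y ∈ Ioi (0 : ℝ)
      · rw [indicator_of_mem hy0]
        have : ¬ y < τ := fun h => hy ⟨hy0, h⟩
        simp [hKdef, this]
      · rw [indicator_of_notMem hy0]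
  have e2 : ∀ y ∈ Ioi (0 : ℝ), F y * ∫ τ in Ioi (0 : ℝ), K τ y * φ (x + τ) =
      F y * ∫ r in Ioi (0 : ℝ), (Real.exp (-(κ * r)) : ℂ) * φ (x + y + r) := by
    intro y hy
    have hy0 : (0 : ℝ) < y := hy
    congr 1
    rw [← integral_indicator measurableSet_Ioi, ← integral_indicator measurableSet_Ioi,
      ← integral_add_left_eq_self _ y]
    congr 1 with r
    by_cases hr : r ∈ Ioi (0 : ℝ)
    · have hr0 : (0 : ℝ) < r := hr
      rw [indicator_of_mem hr, indicator_of_mem (show y + r ∈ Ioi (0 : ℝ) from add_pos hy0 hr0)]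
      simp only [hKdef, if_pos (lt_add_of_pos_right y hr0), add_sub_cancel_left, add_assoc]
    · rw [indicator_of_notMem hr]
      have : ¬ y < y + r := by simpa using hr
      by_cases hr0 : y + r ∈ Ioi (0 : ℝ)
      · rw [indicator_of_mem hr0]
        simp only [hKdef, if_neg this, zero_mul]
      · rw [indicator_of_notMem hr0]
  constructor
  · exact (integrable_mul_integral hF' hφx hK' fun y τ => hC τ y).congr
      ((ae_restrict_iff' measurableSet_Ioi).2 (Filter.Eventually.of_forall e2))
  · have h := integral_mul_integral_swap hφx hF' hK hC
    rwa [setIntegral_congr_fun measurableSet_Ioi e1, setIntegral_congr_fun measurableSet_Ioi e2] at h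

theorem isWaveKernel_waveKernel {κ α : ℝ} (hN : 0 < N) (hκ : 0 ≤ κ) (hα : α = N * κ) :
    IsWaveKernel N α (waveKernel N κ) := by
  refine ⟨fun j l x hx y hy s hs => waveKernel_apply_eq_zero κ j l hx hy hs, fun f hf => ?_⟩
  refine ⟨waveSolution N κ f, isWaveSolution_waveSolution hN hα (fun l => (hf l).1)
    fun l => (hf l).2.2, fun φ hφ hφc j x hx => ?_⟩
  obtain ⟨C, hC⟩ := hφc.exists_bound_of_continuous hφ
  have hφi : Integrable φ := hφ.integrable_of_hasCompactSupport hφc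
  have hfc : ∀ l, Continuous (f l) := fun l => (hf l).1.continuous
  have hfi : ∀ l, Integrable (f l) := fun l => (hfc l).integrable_of_hasCompactSupport (hf l).2.1
  have hf0 : ∀ l, ∀ y ≤ 0, f l y = 0 := fun l y hy =>
    image_eq_zero_of_notMem_tsupport fun h => absurd ((hf l).2.2 h) (not_lt.2 hy)
  set F : ℝ → ℂ := fun y => ∑ l, f l y with hFdef
  have hFs : ContDiff ℝ (⊤ : ℕ∞) F := ContDiff.sum fun l _ => (hf l).1
  have hFi : Integrable F := integrable_finsetSum _ fun l _ => hfi l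
  have hF0 : ∀ y ≤ 0, F y = 0 := fun y hy => Finset.sum_eq_zero fun l _ => hf0 l y hy
  let M : ℝ → ℂ := fun z => ∫ r in Ioi (0 : ℝ), (Real.exp (-(κ * r)) : ℂ) * φ (z + r)
  have i1 : ∀ l, Integrable (fun y => φ |x - y| * f l y) μ₊ := fun l =>
    Integrable.bdd_mul (c := C) (hfi l).integrableOn
      (hφ.comp (by fun_prop)).aestronglyMeasurable (Filter.Eventually.of_forall fun t => hC _)
  have i2 : ∀ l, Integrable (fun y => φ (x + y) * f l y) μ₊ := fun l =>
    Integrable.bdd_mul (c := C) (hfi l).integrableOn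
      (hφ.comp (by fun_prop)).aestronglyMeasurable (Filter.Eventually.of_forall fun t => hC _)
  have i3 : ∀ l, Integrable (fun y => f l y * M (x + y)) μ₊ := fun l =>
    (integral_mul_decayConvolution hκ hφi (hfi l) x).1
  have hG : ∀ l y, (∫ᵛ t, φ t ∂<•(waveKernel N κ j l x y)) * f l y =
      (if j = l then 2⁻¹ else 0 : ℂ) * (φ |x - y| * f l y) +
      ((N : ℂ)⁻¹ - if j = l then 2⁻¹ else 0) * (φ (x + y) * f l y) -
      (N : ℂ)⁻¹ * κ * (f l y * M (x + y)) := by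
    intro l y
    have e : ∫ r in Ioi (0 : ℝ), (κ * Real.exp (-(κ * r))) • φ (x + y + r) = κ * M (x + y) := by
      rw [← integral_const_mul]
      refine integral_congr_ae (Filter.Eventually.of_forall fun r => ?_)
      simp only [Complex.real_smul]
      push_cast
      ring
    rw [integral_waveKernel hκ j l x y hφ hC, e]
    simp only [Complex.real_smul]
    split_ifs <;> (push_cast; ring)
  have i4 : ∀ l, Integrable (fun y => (if j = l then 2⁻¹ else 0 : ℂ) * (φ |x - y| * f l y) +
      ((N : ℂ)⁻¹ - if j = l then 2⁻¹ else 0) * (φ (x + y) * f l y)) μ₊ := fun l =>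
    ((i1 l).const_mul _).add ((i2 l).const_mul _)
  simp only [hG]
  refine ⟨fun l => (i4 l).sub ((i3 l).const_mul _), ?_⟩
  -- Terms containing δ_{jl} select f_j alone, the others depend only on the sum F. This is the
  -- split into the Dirichlet part of the solution and the emitted wave.
  have hR : ∀ l, ∫ y in Ioi (0 : ℝ), ((if j = l then 2⁻¹ else 0 : ℂ) * (φ |x - y| * f l y) +
      ((N : ℂ)⁻¹ - if j = l then 2⁻¹ else 0) * (φ (x + y) * f l y) -
      (N : ℂ)⁻¹ * κ * (f l y * M (x + y))) =
      (if j = l then 2⁻¹ * ((∫ y in Ioi (0 : ℝ), φ |x - y| * f l y) -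
        ∫ y in Ioi (0 : ℝ), φ (x + y) * f l y) else 0) +
      (N : ℂ)⁻¹ * ((∫ y in Ioi (0 : ℝ), φ (x + y) * f l y) -
        κ * ∫ y in Ioi (0 : ℝ), f l y * M (x + y)) := by
    intro l
    rw [integral_sub (i4 l) ((i3 l).const_mul _),
      integral_add ((i1 l).const_mul _) ((i2 l).const_mul _), integral_const_mul,
      integral_const_mul, integral_const_mul]
    split_ifs <;> ring
  rw [Finset.sum_congr rfl fun l _ => hR l, Finset.sum_add_distrib, ← Finset.mul_sum,
    Finset.sum_sub_distrib, ← Finset.mul_sum, Finset.sum_ite_eq, if_pos (Finset.mem_univ j),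
    ← integral_finsetSum _ fun l _ => i2 l, ← integral_finsetSum _ fun l _ => i3 l]
  simp only [← Finset.mul_sum, ← Finset.sum_mul]
  -- the solution
  have hi : ∀ g : ℝ → ℂ, Continuous g → Integrable (fun t => φ t * g t) μ₊ := fun g hg =>
    ((hφ.mul hg).integrable_of_hasCompactSupport hφc.mul_right).integrableOn
  set h : ℝ → ℂ := outgoingWave N κ F with hh
  have hhc : Continuous h := (contDiff_outgoingWave κ hFs).continuous
  have hh0 : ∀ τ ≤ 0, h τ = 0 := fun τ hτ => outgoingWave_of_nonpos κ hF0 hτ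
  have a1 := hi (fun t => f j (x + t)) ((hfc j).comp (by fun_prop))
  have a2 := hi (fun t => f j (x - t)) ((hfc j).comp (by fun_prop))
  have a3 := hi (fun t => f j (t - x)) ((hfc j).comp (by fun_prop))
  have a4 := hi (fun t => h (t - x)) (hhc.comp (by fun_prop))
  have a12 : Integrable (fun t => φ t * f j (x + t) + φ t * f j (x - t)) μ₊ := a1.add a2
  have a34 : Integrable (fun t => 2⁻¹ * (φ t * f j (t - x)) - φ t * h (t - x)) μ₊ :=
    (a3.const_mul _).sub a4
  have eL : ∀ t, φ t * waveSolution N κ f j t x =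
      2⁻¹ * (φ t * f j (x + t) + φ t * f j (x - t)) -
        (2⁻¹ * (φ t * f j (t - x)) - φ t * h (t - x)) := by
    intro t
    rw [waveSolution, neg_sub]
    ring
  simp only [eL]
  rw [integral_sub (a12.const_mul _) a34, integral_sub (a3.const_mul _) a4, integral_const_mul,
    integral_const_mul, integral_mul_reflection hφ hC (hfi j) (hf0 j) x,
    integral_mul_shift φ (hf0 j) hx, integral_mul_shift φ hh0 hx]
  have hφx : HasCompactSupport fun y => φ (x + y) :=
    hφc.comp_homeomorph (Homeomorph.addLeft x)
  have hi2 : ∀ g : ℝ → ℂ, Continuous g → Integrable (fun t => φ (x + t) * g t) μ₊ := fun g hg =>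
    (((hφ.comp (by fun_prop : Continuous fun t => x + t)).mul hg).integrable_of_hasCompactSupport
      (HasCompactSupport.mul_right hφx)).integrableOn
  have eH : ∀ τ, φ (x + τ) * h τ = (N : ℂ)⁻¹ * (φ (x + τ) * F τ -
      κ * (φ (x + τ) * decayConvolution κ F τ)) := by
    intro τ
    rw [hh, outgoingWave]
    ring
  simp only [eH]
  rw [integral_const_mul, integral_sub (hi2 F hFs.continuous)
    ((hi2 _ (contDiff_decayConvolution κ hFs).continuous).const_mul _), integral_const_mul,
    (integral_mul_decayConvolution hκ hφi hFi x).2]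
  ring

end WaveKernelRepresentation

/-! ### Scattering eigenfunctions -/

section Scattering

variable {N : ℕ}

/-- Double-angle formulas for tan θ = t, that is, e^{-2iθ} = (1-it)/(1+it). -/
theorem exp_neg_two_mul_arctan (t : ℝ) :
    Complex.exp (-(2 * Complex.I * (Real.arctan t : ℝ))) =
      ((1 - t ^ 2 : ℝ) - Complex.I * (2 * t : ℝ)) / ((1 + t ^ 2 : ℝ) : ℂ) := by
  have h0 : 1 + t ^ 2 ≠ 0 := by positivity
  have h0' : ((1 + t ^ 2 : ℝ) : ℂ) ≠ 0 := by exact_mod_cast h0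
  have h1 : Real.cos (2 * Real.arctan t) = (1 - t ^ 2) / (1 + t ^ 2) := by
    rw [Real.cos_two_mul, Real.cos_sq_arctan]
    field_simp
    ring
  have h2 : Real.sin (2 * Real.arctan t) = 2 * t / (1 + t ^ 2) := by
    have h3 : Real.sin (Real.arctan t) = t * Real.cos (Real.arctan t) := by
      rw [← Real.tan_mul_cos (Real.cos_arctan_pos t).ne', Real.tan_arctan]
    have h4 := Real.cos_sq_arctan t
    rw [Real.sin_two_mul, h3]
    field_simp
    field_simp at h4
    linear_combination t * h4
  have e : -(2 * Complex.I * ((Real.arctan t : ℝ) : ℂ)) =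
      ((-(2 * Real.arctan t) : ℝ) : ℂ) * Complex.I := by
    push_cast
    ring
  rw [e, Complex.exp_mul_I, ← Complex.ofReal_cos, ← Complex.ofReal_sin, Real.cos_neg, Real.sin_neg,
    h1, h2]
  push_cast at h0' ⊢
  field_simp
  ring

/-- The transmission amplitude of the star graph. -/
theorem one_add_exp_arctan {α ω : ℝ} (hN : 0 < N) (hω : 0 < ω) :
    1 / (N : ℂ) * (1 + Complex.exp (-(2 * Complex.I * (Real.arctan (α / (N * ω)) : ℝ)))) =
      2 * ω * ((N * ω - Complex.I * α) / ((α : ℂ) ^ 2 + (N : ℂ) ^ 2 * (ω : ℂ) ^ 2)) := by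
  have hN' : (N : ℝ) ≠ 0 := by exact_mod_cast hN.ne'
  have hNc : (N : ℂ) ≠ 0 := by exact_mod_cast hN.ne'
  have hωc : (ω : ℂ) ≠ 0 := by exact_mod_cast hω.ne'
  have hD : (α : ℂ) ^ 2 + (N : ℂ) ^ 2 * (ω : ℂ) ^ 2 ≠ 0 := by
    have : α ^ 2 + (N : ℝ) ^ 2 * ω ^ 2 ≠ 0 := by positivity
    exact_mod_cast this
  have e : ((1 + (α / (N * ω)) ^ 2 : ℝ) : ℂ) =
      ((α : ℂ) ^ 2 + (N : ℂ) ^ 2 * (ω : ℂ) ^ 2) / ((N : ℂ) * ω) ^ 2 := by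
    push_cast
    field_simp
    ring
  rw [exp_neg_two_mul_arctan, e]
  push_cast
  field_simp
  ring

theorem scatteringFunction_eq {α ω : ℝ} (hN : 0 < N) (hω : 0 < ω) (j l : Fin N) (x : ℝ) :
    scatteringFunction N α ω j l x =
      -2 * Complex.I * (if j = l then 1 else 0) * (Real.sin (ω * x) : ℂ) +
        2 * ω * ((N * ω - Complex.I * α) / ((α : ℂ) ^ 2 + (N : ℂ) ^ 2 * (ω : ℂ) ^ 2)) *
          Complex.exp (Complex.I * ω * x) := by
  rw [scatteringFunction, one_add_exp_arctan hN hω]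
  have e1 : Complex.I * ω * x = ((ω * x : ℝ) : ℂ) * Complex.I := by
    push_cast
    ring
  have e2 : -(Complex.I * ω * x) = ((-(ω * x) : ℝ) : ℂ) * Complex.I := by
    push_cast
    ring
  rw [e2, e1, Complex.exp_mul_I, Complex.exp_mul_I, ← Complex.ofReal_cos, ← Complex.ofReal_sin,
    ← Complex.ofReal_cos, ← Complex.ofReal_sin, Real.cos_neg, Real.sin_neg]
  push_cast
  ring

theorem hasDerivAt_exp_mul_ofReal (c : ℂ) (x : ℝ) :
    HasDerivAt (fun x : ℝ => Complex.exp (c * x)) (c * Complex.exp (c * x)) x := by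
  have h := ((hasDerivAt_id (x : ℂ)).const_mul c).cexp.comp_ofReal
  simpa [mul_comm] using h

theorem hasDerivAt_scatteringFunction (α ω : ℝ) (j l : Fin N) (x : ℝ) :
    HasDerivAt (scatteringFunction N α ω j l)
      ((if j = l then 1 else 0) * (-(Complex.I * ω) * Complex.exp (-(Complex.I * ω) * x)) +
        (-(if j = l then 1 else 0) +
          1 / N * (1 + Complex.exp (-(2 * Complex.I * (Real.arctan (α / (N * ω)) : ℝ))))) *
          (Complex.I * ω * Complex.exp (Complex.I * ω * x))) x := by
  refine HasDerivAt.congr_of_eventuallyEq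
    (((hasDerivAt_exp_mul_ofReal (-(Complex.I * ω)) x).const_mul _).add
    ((hasDerivAt_exp_mul_ofReal (Complex.I * ω) x).const_mul _))
    (Filter.Eventually.of_forall fun y => ?_)
  simp only [scatteringFunction, Pi.add_apply, neg_mul]

theorem hasDerivAt_deriv_scatteringFunction (α ω : ℝ) (j l : Fin N) (x : ℝ) :
    HasDerivAt (deriv (scatteringFunction N α ω j l))
      (-(ω : ℂ) ^ 2 * scatteringFunction N α ω j l x) x := by
  have e : deriv (scatteringFunction N α ω j l) = fun x : ℝ => _ :=
    funext fun x => (hasDerivAt_scatteringFunction α ω j l x).deriv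
  rw [e]
  have h := (((hasDerivAt_exp_mul_ofReal (-(Complex.I * ω)) x).const_mul
    (-(Complex.I * ω))).const_mul (if j = l then 1 else 0)).add
    (((hasDerivAt_exp_mul_ofReal (Complex.I * ω) x).const_mul (Complex.I * ω)).const_mul
      (-(if j = l then 1 else 0) +
          1 / (N : ℂ) * (1 + Complex.exp (-(2 * Complex.I * (Real.arctan (α / (N * ω)) : ℝ))))))
  refine HasDerivAt.congr_deriv h ?_
  simp only [scatteringFunction, neg_mul]
  linear_combination ((ω : ℂ) ^ 2 * ((if j = l then 1 else 0) * Complex.exp (-(Complex.I * ω * x)) +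
    (-(if j = l then 1 else 0) +
      1 / N * (1 + Complex.exp (-(2 * Complex.I * (Real.arctan (α / (N * ω)) : ℝ))))) *
      Complex.exp (Complex.I * ω * x))) * Complex.I_sq

/-- In closed form the sine vanishes at the vertex, so the common value is T = 2ω/(Nω+iα). The
derivatives add up to iω(NT - 2) = αT. -/
theorem vertexCondition_scatteringFunction {α ω : ℝ} (hN : 0 < N) (hω : 0 < ω) (l : Fin N) :
    VertexCondition α (fun j => scatteringFunction N α ω j l 0)
      (fun j => deriv (scatteringFunction N α ω j l) 0) := by
  have hD : (α : ℂ) ^ 2 + (N : ℂ) ^ 2 * (ω : ℂ) ^ 2 ≠ 0 := by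
    have hN' : (N : ℝ) ≠ 0 := by exact_mod_cast hN.ne'
    have : α ^ 2 + (N : ℝ) ^ 2 * ω ^ 2 ≠ 0 := by positivity
    exact_mod_cast this
  refine ⟨fun j k => ?_, fun k => ?_⟩
  · simp only [scatteringFunction_eq hN hω]
    simp
  · simp only [(hasDerivAt_scatteringFunction α ω _ l 0).deriv, scatteringFunction_eq hN hω,
      one_add_exp_arctan hN hω]
    simp only [Complex.ofReal_zero, mul_zero, Complex.exp_zero, mul_one, Real.sin_zero, zero_add,
      Finset.sum_add_distrib, ← Finset.sum_mul, Finset.sum_neg_distrib, Finset.sum_const,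
      Finset.card_univ, Fintype.card_fin, nsmul_eq_mul, Finset.sum_ite_eq', Finset.mem_univ, if_true]
    simp only [div_eq_mul_inv]
    linear_combination 2 * Complex.I * ω * mul_inv_cancel₀ hD - 2 * N * α * (ω : ℂ) ^ 2 *
      ((α : ℂ) ^ 2 + (N : ℂ) ^ 2 * (ω : ℂ) ^ 2)⁻¹ * Complex.I_sq

theorem sum_scatteringFunction_mul_conj {α ω : ℝ} (hN : 0 < N) (hω : 0 < ω) (j j' : Fin N)
    (x y : ℝ) :
    1 / (2 * (Real.pi : ℂ)) * ∑ l, scatteringFunction N α ω j l x *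
      (starRingEnd ℂ) (scatteringFunction N α ω j' l y) =
      (spectralDensity N α j j' ω x y : ℂ) := by
  have hD : (α : ℂ) ^ 2 + (N : ℂ) ^ 2 * (ω : ℂ) ^ 2 ≠ 0 := by
    have hN' : (N : ℝ) ≠ 0 := by exact_mod_cast hN.ne'
    have : α ^ 2 + (N : ℝ) ^ 2 * ω ^ 2 ≠ 0 := by positivity
    exact_mod_cast this
  have hπ : (Real.pi : ℂ) ≠ 0 := by exact_mod_cast Real.pi_ne_zero
  have he : ∀ x : ℝ, Complex.exp (Complex.I * ω * x) =
      (Real.cos (ω * x) : ℂ) + Complex.I * (Real.sin (ω * x) : ℂ) := by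
    intro x
    have e1 : Complex.I * ω * x = ((ω * x : ℝ) : ℂ) * Complex.I := by
      push_cast
      ring
    rw [e1, Complex.exp_mul_I, ← Complex.ofReal_cos, ← Complex.ofReal_sin]
    ring
  have hs : ∀ l, scatteringFunction N α ω j l x *
      (starRingEnd ℂ) (scatteringFunction N α ω j' l y) =
      (if j = l then (if j' = l then 4 * (Real.sin (ω * x) : ℂ) * Real.sin (ω * y) else 0) else 0) +
      (if j = l then -2 * Complex.I * (Real.sin (ω * x) : ℂ) * (2 * ω * ((N * ω + Complex.I * α) /
        ((α : ℂ) ^ 2 + (N : ℂ) ^ 2 * (ω : ℂ) ^ 2)) * ((Real.cos (ω * y) : ℂ) -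
          Complex.I * (Real.sin (ω * y) : ℂ))) else 0) +
      (if j' = l then 2 * Complex.I * (Real.sin (ω * y) : ℂ) * (2 * ω * ((N * ω - Complex.I * α) /
        ((α : ℂ) ^ 2 + (N : ℂ) ^ 2 * (ω : ℂ) ^ 2)) * ((Real.cos (ω * x) : ℂ) +
          Complex.I * (Real.sin (ω * x) : ℂ))) else 0) +
      4 * (ω : ℂ) ^ 2 / ((α : ℂ) ^ 2 + (N : ℂ) ^ 2 * (ω : ℂ) ^ 2) * (((Real.cos (ω * x) : ℂ) +
          Complex.I * (Real.sin (ω * x) : ℂ)) * ((Real.cos (ω * y) : ℂ) -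
          Complex.I * (Real.sin (ω * y) : ℂ))) := by
    intro l
    -- This is |T|² for the transmission amplitude T. Being independent of l, it is multiplied by N
    -- in the sum and yields the cosine term of σ; the terms linear in T carry a Kronecker delta.
    have hq : 4 * (ω : ℂ) ^ 2 / ((α : ℂ) ^ 2 + (N : ℂ) ^ 2 * (ω : ℂ) ^ 2) =
        (2 * ω * ((N * ω - Complex.I * α) / ((α : ℂ) ^ 2 + (N : ℂ) ^ 2 * (ω : ℂ) ^ 2))) *
        (2 * ω * ((N * ω + Complex.I * α) / ((α : ℂ) ^ 2 + (N : ℂ) ^ 2 * (ω : ℂ) ^ 2))) := by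
      simp only [div_eq_mul_inv]
      linear_combination (-4 * (ω : ℂ) ^ 2 * ((α : ℂ) ^ 2 + (N : ℂ) ^ 2 * (ω : ℂ) ^ 2)⁻¹) *
        mul_inv_cancel₀ hD + 4 * (ω : ℂ) ^ 2 *
        (((α : ℂ) ^ 2 + (N : ℂ) ^ 2 * (ω : ℂ) ^ 2)⁻¹) ^ 2 * (α : ℂ) ^ 2 * Complex.I_sq
    rw [hq, scatteringFunction_eq hN hω, scatteringFunction_eq hN hω, he, he]
    simp only [map_add, map_mul, map_sub, map_div₀, map_pow, map_neg, Complex.conj_ofReal,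
      Complex.conj_I, map_natCast, apply_ite (starRingEnd ℂ), map_one, map_zero, map_ofNat,
      neg_mul, sub_neg_eq_add]
    generalize 2 * (ω : ℂ) * ((N * ω + Complex.I * α) /
      ((α : ℂ) ^ 2 + (N : ℂ) ^ 2 * (ω : ℂ) ^ 2)) = q
    generalize 2 * (ω : ℂ) * ((N * ω - Complex.I * α) /
      ((α : ℂ) ^ 2 + (N : ℂ) ^ 2 * (ω : ℂ) ^ 2)) = q'
    have hI := Complex.I_sq
    split_ifs
    · linear_combination (-4 * (Real.sin (ω * x) : ℂ) * Real.sin (ω * y)) * hI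
    · ring
    · ring
    · ring
  simp only [hs, Finset.sum_add_distrib, Finset.sum_ite_eq, Finset.mem_univ, if_true,
    Finset.sum_const, Finset.card_univ, Fintype.card_fin, nsmul_eq_mul]
  rw [spectralDensity, mul_add ω x y, Real.cos_add, Real.sin_add]
  push_cast
  have hI := Complex.I_sq
  rw [eq_comm]
  simp only [eq_comm (a := j') (b := j)]
  generalize Complex.cos ((ω : ℂ) * x) = cx
  generalize Complex.cos ((ω : ℂ) * y) = cy
  generalize Complex.sin ((ω : ℂ) * x) = sx
  generalize Complex.sin ((ω : ℂ) * y) = sy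
  split_ifs <;>
  · simp only [Complex.ofReal_one, Complex.ofReal_zero]
    field_simp
    ring_nf
    simp only [hI]
    ring

end Scattering

end StarGraph

/-! ### Assembly of the theorem -/

open StarGraph in
theorem mainTheorem4 (N : ℕ) (hN : 0 < N) (α : ℝ) (hα : 0 ≤ α) :
    -- the integral of `σ` over `ω ∈ [0, √λ]` is the kernel of the spectral projection of `H`
    (∃ E : ProjValuedMeasure (L2Star N), IsSpectralResolution (hamiltonian N α) E) ∧
    (∀ E : ProjValuedMeasure (L2Star N), IsSpectralResolution (hamiltonian N α) E →
      ∀ lam : ℝ, 0 ≤ lam →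
        HasIntegralKernel (E.proj (Icc 0 lam))
          (fun j l x y => ∫ ω in (0 : ℝ)..√lam, spectralDensity N α j l ω x y)) ∧
    -- the wave kernel is the Fourier cosine transform of `σ`, and conversely
    (∃ G : Fin N → Fin N → ℝ → ℝ → SignedMeasure ℝ, IsWaveKernel N α G ∧
      ∀ j l, ∀ x ≥ 0, ∀ y ≥ 0,
        (∀ φ : SchwartzMap ℝ ℂ, (∀ t, φ (-t) = φ t) →
          ∫ᵛ t, φ t ∂<•(G j l x y) =
            ∫ ω in Ioi (0 : ℝ), (∫ t in Ioi (0 : ℝ), (Real.cos (ω * t) : ℂ) * φ t) *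
              (spectralDensity N α j l ω x y : ℂ)) ∧
        ∀ ω > 0, spectralDensity N α j l ω x y =
          (2 / Real.pi) * ∫ᵛ t, Real.cos (ω * t) ∂<•(G j l x y)) ∧
    -- the scattering eigenfunctions and the agreement of their expansion with `σ`
    (∀ ω > 0,
      (∀ l,
        (∀ j x, HasDerivAt (deriv (scatteringFunction N α ω j l))
          (-(ω : ℂ) ^ 2 * scatteringFunction N α ω j l x) x) ∧
        VertexCondition α (fun j => scatteringFunction N α ω j l 0)
          (fun j => deriv (scatteringFunction N α ω j l) 0)) ∧
      (∀ j l x, scatteringFunction N α ω j l x =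
        -2 * Complex.I * (if j = l then 1 else 0) * (Real.sin (ω * x) : ℂ) +
          2 * ω * ((N * ω - Complex.I * α) / ((α : ℂ) ^ 2 + (N : ℂ) ^ 2 * (ω : ℂ) ^ 2)) *
            Complex.exp (Complex.I * ω * x)) ∧
      ∀ j j', ∀ x ≥ 0, ∀ y ≥ 0,
        1 / (2 * (Real.pi : ℂ)) * ∑ l, scatteringFunction N α ω j l x *
          (starRingEnd ℂ) (scatteringFunction N α ω j' l y) =
        (spectralDensity N α j j' ω x y : ℂ)) := by
  have hN' : (N : ℝ) ≠ 0 := by exact_mod_cast hN.ne'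
  have hκ : 0 ≤ α / N := by positivity
  have hακ : α = N * (α / N) := by field_simp
  obtain ⟨U, hU⟩ := exists_isEigenTransform hN hκ
  have hE := isSpectralResolution_hamiltonian hN hκ hακ hU
  refine ⟨⟨_, hE⟩, fun E hE' lam hlam => ?_, ⟨waveKernel N (α / N),
    isWaveKernel_waveKernel hN hκ hακ, fun j l x _ y _ => ⟨fun φ he => ?_, fun ω hω => ?_⟩⟩,
    fun ω hω => ⟨fun l => ⟨fun j x => ?_, ?_⟩, fun j l x => ?_, fun j j' x _ y _ => ?_⟩⟩
  -- By uniqueness on compact intervals, an arbitrary spectral resolution may be replaced by the one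
  -- built from U.
  · rw [hE'.proj_Icc_unique hE hlam]
    exact hasIntegralKernel_multiplicationPVM hN hακ hU hlam
  · exact integral_waveKernel_schwartz hN hκ hακ j l x y φ he
  · exact spectralDensity_eq_integral_waveKernel hN hκ hακ j l x y hω
  · exact hasDerivAt_deriv_scatteringFunction α ω j l x
  · exact vertexCondition_scatteringFunction hN hω l
  · exact scatteringFunction_eq hN hω j l x
  · exact sum_scatteringFunction_mul_conj hN hω j j' x y
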